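/- **Setting.** Let $a_0=0$ and let $(a_i)_{i\in\mathbb Z\setminus\{0\}}$ be real random variables on a probability space with $a_{-i}=a_i$ for all $i$, with $a_1,a_2,\dots$ independent, and such that for all $i\neq 0$: $\mathbb E[a_i]=0$, $\operatorname{Var}[a_i]=1$, $\mathbb E[|a_i|^4]=\kappa$, and for every integer $k>2$ there is a constant $C_k<\infty$ with $\mathbb E[|a_i|^k]<C_k$ for all $i\ne0$. Let $(b_n)$ be a real sequence (for instance of integers) with $b_n\le n$ for $n\ge1$, $b_n\to\infty$ and $b_n/n\to b$ (so that $b\in[0,1]$). For $t>0$ and $p\ge 2$ put $$A_n(t)=\frac1{\sqrt{b_n}}\big(a_{i-j}\,\delta_{|i-j|\le\lfloor b_nt\rfloor}\big)_{i,j=1}^n,\qquad \omega_p(t)=\frac{\sqrt{b_n}}{n}\Big(\operatorname{tr}A_n(t)^p-\mathbb E[\operatorname{tr}A_n(t)^p]\Big),$$ where $\delta_{|i-j|\le m}$ is $1$ if $|i-j|\le m$ and $0$ otherwise (the dependence of $\omega_p(t)$ on $n$ is suppressed). **Partitions.** A *pair partition* of $\{1,\dots,p+q\}$ is a partition all of whose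 blocks have two elements; a *cross* is a block that meets both $\{1,\dots,p\}$ and $\{p+1,\dots,p+q\}$. Let $\tilde{\mathcal P}_2(p,q)$ be the set of pair partitions of $\{1,\dots,p+q\}$ with at least three crosses (empty if $p+q$ is odd). If $p,q$ are both even, let $\mathcal P_{2,4}(p,q)$ be the set of partitions of $\{1,\dots,p+q\}$ with exactly one block of four elements, two of them in $\{1,\dots,p\}$ and two in $\{p+1,\dots,p+q\}$, all other blocks having two elements and being contained in $\{1,\dots,p\}$ or in $\{p+1,\dots,p+q\}$; otherwise $\mathcal P_{2,4}(p,q)=\emptyset$. **Integrals.** Given a partition $\pi$ in one of these sets, attach a real variable $x_V$ to each block $V$ of $\pi$. Let the domain $D_\pi$ be given by $x_V\in[-t_1,t_1]$ if $V$ meets $\{1,\dots,p\}$ and $x_V\in[-t_2,t_2]$ otherwise. For $i$ in the block $V$ put $y_i=\pm x_V$, where the sign is $+$ if $i$ is the smallest element of $V$, or if $V$ has four elements and $i$ is its largest element, and is $-$ otherwise. With $I=\mathbf 1_{[0,1]}$ and $\sigma\in\{1,-1\}$ put $$W_\sigma=\prod_{j=1}^pI\Big(x_0+b\sum_{i=1}^jy_i\Big)\prod_{j=p+1}^{p+q}I\Big(y_0+\sigma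 b\sum_{i=p+1}^{j}y_i\Big).$$ For $\pi\in\tilde{\mathcal P}_2(p,q)$ let $$\tilde f_I^{\mp}(\pi,t_1,t_2)=\int_0^1\!dx_0\int_0^1\!dy_0\int_{D_\pi}\delta\Big(\sum_{i=1}^py_i\Big)W_{\pm1}\,\prod_Vdx_V,$$ where $\delta$ is the Dirac delta: since $\sum_{i=1}^py_i$ is the sum of the $x_V$ over the crosses $V$, this means that one (any) of these $x_V$ is replaced by minus the sum of the others, still subject to $|x_V|\le t_1$, and is not integrated over. For $\pi\in\mathcal P_{2,4}(p,q)$ let $$\tilde f_{II}^{\mp}(\pi,t_1,t_2)=\int_0^1\!dx_0\int_0^1\!dy_0\int_{D_\pi}W_{\pm1}\,\prod_Vdx_V.$$ In both formulas the superscript $-$ goes with $W_{+1}$ and the superscript $+$ with $W_{-1}$. **Lemma.** Let $p,q\ge2$ be integers and let $0<t_1\le t_2$ be numbers in $(0,1/b)$, where $(0,1/b)=(0,\infty)$ if $b=0$. Then for every $n$ with $b_n>0$ the variables $\operatorname{tr}A_n(t_1)^p$, $\operatorname{tr}A_n(t_2)^q$ and $\omega_p(t_1)\omega_q(t_2)$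 are integrable, and $$\lim_{n\to\infty}\mathbb E[\omega_p(t_1)\,\omega_q(t_2)]=\sum_{\pi\in\tilde{\mathcal P}_2(p,q)}\big(\tilde f_I^-(\pi,t_1,t_2)+\tilde f_I^+(\pi,t_1,t_2)\big)+(\kappa-1)\sum_{\pi\in\mathcal P_{2,4}(p,q)}\big(\tilde f_{II}^-(\pi,t_1,t_2)+\tilde f_{II}^+(\pi,t_1,t_2)\big).$$ -/

import Mathlib

open MeasureTheory ProbabilityTheory Filter Topology

noncomputable section

namespace BandToeplitz

/-! ### The matrix model -/

/-- The `n × n` random band Toeplitz matrix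
`A_n(t) = b_n^{-1/2} (a_{i-j} δ_{|i-j| ≤ [b_n t]})_{i,j}`. -/
def bandMatrix {Ω : Type*} (a : ℤ → Ω → ℝ) (bn : ℕ → ℝ) (n : ℕ) (t : ℝ) (w : Ω) :
    Matrix (Fin n) (Fin n) ℝ :=
  Matrix.of fun i j =>
    (1 / √(bn n)) * (if |((i : ℕ) : ℤ) - ((j : ℕ) : ℤ)| ≤ ⌊bn n * t⌋
      then a (((i : ℕ) : ℤ) - ((j : ℕ) : ℤ)) w else 0)

/-- The random variable `tr (A_n(t)^p)`. -/
def tracePow {Ω : Type*} (a : ℤ → Ω → ℝ) (bn : ℕ → ℝ) (p n : ℕ) (t : ℝ) (w : Ω) : ℝ :=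
  Matrix.trace (bandMatrix a bn n t w ^ p)

/-- The rescaled fluctuation
`ω_p(t) = (√b_n / n) (tr A_n(t)^p - E[tr A_n(t)^p])`. -/
def fluctuation {Ω : Type*} [MeasurableSpace Ω] (μ : Measure Ω) (a : ℤ → Ω → ℝ) (bn : ℕ → ℝ)
    (p n : ℕ) (t : ℝ) (w : Ω) : ℝ :=
  √(bn n) / (n : ℝ) * (tracePow a bn p n t w - ∫ w', tracePow a bn p n t w' ∂μ)

/-- The interval `(0, 1/b)`, understood as `(0, ∞)` when `b = 0`. -/
def timeInterval (b : ℝ) : Set ℝ := if b = 0 then Set.Ioi 0 else Set.Ioo 0 (1 / b)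

/-! ### Partitions

The set `{1, …, N}` is modelled by `Fin N`, with `i : Fin N` standing for the number `i + 1`;
so the elements `1, …, p` of `{1, …, p + q}` are the `i : Fin (p + q)` with `i.val < p`. -/

/-- Partitions of an `N`-element ordered set. -/
abbrev Part (N : ℕ) : Type := Finpartition (Finset.univ : Finset (Fin N))

/-- The block contains an element of `{1, …, p}` and an element of `{p + 1, …, p + q}`. -/
def IsCross (p : ℕ) {q : ℕ} (B : Finset (Fin (p + q))) : Prop :=
  (∃ i ∈ B, i.val < p) ∧ ∃ j ∈ B, p ≤ j.val

open Classical in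
/-- The pair partitions of `{1, …, p + q}` with at least three crosses. (There is no pair
partition at all if `p + q` is odd.) -/
def pairPartitions (p q : ℕ) : Finset (Part (p + q)) :=
  Finset.univ.filter fun π =>
    (∀ B ∈ π.parts, B.card = 2) ∧ 3 ≤ (π.parts.filter fun B => IsCross p B).card

open Classical in
/-- The partitions `P_{2,4}(p, q)`: one block `V` has four elements, two in `{1, …, p}` and two in
`{p + 1, …, p + q}`; all others have two elements and lie on one side. Empty unless `p` and `q`
are both even. -/
def pairQuadPartitions (p q : ℕ) : Finset (Part (p + q)) :=
  Finset.univ.filter fun π =>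
    Even p ∧ Even q ∧ ∃ V ∈ π.parts,
      V.card = 4 ∧
      (V.filter fun i => i.val < p).card = 2 ∧
      (V.filter fun i => p ≤ i.val).card = 2 ∧
      ∀ B ∈ π.parts, B ≠ V →
        B.card = 2 ∧ ((∀ i ∈ B, i.val < p) ∨ ∀ i ∈ B, p ≤ i.val)

/-! ### The integrals -/

/-- The measure `δ(∑ i, c i * x i) dx` on `ι → ℝ` for `c ≠ 0`: for an index `k` with `c k ≠ 0` the
variable `x k` is integrated out against the Dirac mass, that is, the remaining variables carry
Lebesgue measure, `x k = -(∑_{i ≠ k} c i * x i) / c k`, and the density is `1 / |c k|`. (The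
measure does not depend on the `k` chosen; it is set to `0` if `c = 0`.) -/
def deltaMeasure {ι : Type*} [Fintype ι] [DecidableEq ι] (c : ι → ℝ) : Measure (ι → ℝ) :=
  open Classical in
  if h : ∃ k, c k ≠ 0 then
    let k : ι := h.choose
    ENNReal.ofReal (1 / |c k|) •
      Measure.map
        (fun (z : {i : ι // i ≠ k} → ℝ) (i : ι) =>
          if hi : i = k then -(∑ j : {i : ι // i ≠ k}, c j.1 * z j) / c k else z ⟨i, hi⟩)
        volume
  else 0

open Classical in
/-- The sign `ε_π(i)`: `1` if `i` is the smallest element of its block, `-1` otherwise. -/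
def epsSign {N : ℕ} (π : Part N) (i : Fin N) : ℝ :=
  if ∀ j ∈ π.part i, i ≤ j then 1 else -1

open Classical in
/-- The sign `τ_π(i)`: in the block of four elements it is `1` for the smallest and for the largest
element and `-1` for the two others; in the other blocks it is `1` for the smallest element and
`-1` otherwise. -/
def tauSign {N : ℕ} (π : Part N) (i : Fin N) : ℝ :=
  if (∀ j ∈ π.part i, i ≤ j) ∨ ((π.part i).card = 4 ∧ ∀ j ∈ π.part i, j ≤ i) then 1 else -1

/-- The block of `i`, as an index of the block variables `x`. -/
def blockOf {N : ℕ} (π : Part N) (i : Fin N) : {B : Finset (Fin N) // B ∈ π.parts} :=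
  ⟨π.part i, π.part_mem.2 (Finset.mem_univ i)⟩

/-- The unknowns `y i = ± x_{π(i)}`, for a choice `s` of signs. -/
def yVar {N : ℕ} (π : Part N) (s : Fin N → ℝ) (x : {B : Finset (Fin N) // B ∈ π.parts} → ℝ)
    (i : Fin N) : ℝ :=
  s i * x (blockOf π i)

open Classical in
/-- The domain of the block variables: `[-t₁, t₁]` for the blocks that meet `{1, …, p}`, and
`[-t₂, t₂]` for the others. -/
def box (p : ℕ) {q : ℕ} (π : Part (p + q)) (t₁ t₂ : ℝ) :
    Set ({B : Finset (Fin (p + q)) // B ∈ π.parts} → ℝ) :=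
  {x | ∀ B, x B ∈ if ∃ i ∈ B.1, i.val < p then Set.Icc (-t₁) t₁ else Set.Icc (-t₂) t₂}

/-- The indicator function of `[0, 1]`. -/
def ind01 (v : ℝ) : ℝ := (Set.Icc (0 : ℝ) 1).indicator (fun _ => (1 : ℝ)) v

/-- The integrand
`∏_{j=1}^p I_{[0,1]}(x₀ + b ∑_{i=1}^j y_i) ∏_{j=p+1}^{p+q} I_{[0,1]}(y₀ + σ b ∑_{i=p+1}^j y_i)`,
where `σ` is a sign. -/
def weight (p : ℕ) {q : ℕ} (b σ : ℝ) (y : Fin (p + q) → ℝ) (x₀ y₀ : ℝ) : ℝ :=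
  (∏ j : Fin (p + q) with j.val < p,
      ind01 (x₀ + b * ∑ i : Fin (p + q) with i ≤ j, y i)) *
    ∏ j : Fin (p + q) with p ≤ j.val,
      ind01 (y₀ + σ * b * ∑ i : Fin (p + q) with p ≤ i.val ∧ i ≤ j, y i)

open Classical in
/-- The coefficients of `∑_{i=1}^p y_i` (with `y_i = ε_π(i) x_{π(i)}`) as a linear form in `x`. -/
def firstSumCoeff (p : ℕ) {q : ℕ} (π : Part (p + q))
    (B : {B : Finset (Fin (p + q)) // B ∈ π.parts}) : ℝ :=
  ∑ i ∈ B.1 with i.val < p, epsSign π i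

/-- The type I integral, with the factor `δ(∑_{i=1}^p y_i)`; `σ = 1` gives `f_I^-` and `σ = -1`
gives `f_I^+`. -/
def typeI (p : ℕ) {q : ℕ} (b σ : ℝ) (π : Part (p + q)) (t₁ t₂ : ℝ) : ℝ :=
  ∫ x₀ in Set.Icc (0 : ℝ) 1, ∫ y₀ in Set.Icc (0 : ℝ) 1,
    ∫ x in box p π t₁ t₂, weight p b σ (yVar π (epsSign π) x) x₀ y₀
      ∂(deltaMeasure (firstSumCoeff p π))

/-- The type II integral; `σ = 1` gives `f_II^-` and `σ = -1` gives `f_II^+`. -/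
def typeII (p : ℕ) {q : ℕ} (b σ : ℝ) (π : Part (p + q)) (t₁ t₂ : ℝ) : ℝ :=
  ∫ x₀ in Set.Icc (0 : ℝ) 1, ∫ y₀ in Set.Icc (0 : ℝ) 1,
    ∫ x in box p π t₁ t₂, weight p b σ (yVar π (tauSign π) x) x₀ y₀

/-- `f_I^-(π, t₁, t₂)`. -/
def fIminus (p : ℕ) {q : ℕ} (b : ℝ) (π : Part (p + q)) (t₁ t₂ : ℝ) : ℝ := typeI p b 1 π t₁ t₂

/-- `f_I^+(π, t₁, t₂)`. -/
def fIplus (p : ℕ) {q : ℕ} (b : ℝ) (π : Part (p + q)) (t₁ t₂ : ℝ) : ℝ := typeI p b (-1) π t₁ t₂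

/-- `f_II^-(π, t₁, t₂)`. -/
def fIIminus (p : ℕ) {q : ℕ} (b : ℝ) (π : Part (p + q)) (t₁ t₂ : ℝ) : ℝ := typeII p b 1 π t₁ t₂

/-- `f_II^+(π, t₁, t₂)`. -/
def fIIplus (p : ℕ) {q : ℕ} (b : ℝ) (π : Part (p + q)) (t₁ t₂ : ℝ) : ℝ := typeII p b (-1) π t₁ t₂

end BandToeplitz

end

namespace BandToeplitz

section Moments

variable {Ω : Type*} [MeasurableSpace Ω] {μ : Measure Ω}

/-- All absolute moments of `f` are finite. -/
def HasAllMoments (μ : Measure Ω) (f : Ω → ℝ) : Prop := ∀ k : ℕ, MemLp f k μ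

namespace HasAllMoments

variable {f g : Ω → ℝ}

lemma integrable (hf : HasAllMoments μ f) : Integrable f μ :=
  memLp_one_iff_integrable.1 (by simpa using hf 1)

lemma sub (hf : HasAllMoments μ f) (hg : HasAllMoments μ g) :
    HasAllMoments μ (fun w => f w - g w) := fun k => (hf k).sub (hg k)

lemma const [IsProbabilityMeasure μ] (c : ℝ) : HasAllMoments μ (fun _ => c) :=
  fun _ => memLp_const c

lemma mul [IsProbabilityMeasure μ] (hf : HasAllMoments μ f) (hg : HasAllMoments μ g) :
    HasAllMoments μ (fun w => f w * g w) := by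
  intro k
  have h : ENNReal.HolderTriple ((2 * k : ℕ) : ENNReal) ((2 * k : ℕ) : ENNReal) (k : ENNReal) := by
    constructor
    rcases Nat.eq_zero_or_pos k with rfl | hk
    · simp
    · push_cast
      rw [ENNReal.mul_inv (by simp) (by simp), ← add_mul, ENNReal.inv_two_add_inv_two, one_mul]
  exact MemLp.mul (hpqr := h) (hg (2 * k)) (hf (2 * k))

lemma sum {ι : Type*} {s : Finset ι} {F : ι → Ω → ℝ} (h : ∀ i ∈ s, HasAllMoments μ (F i)) :
    HasAllMoments μ (fun w => ∑ i ∈ s, F i w) := fun k => memLp_finsetSum s fun i hi => h i hi k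

lemma prod [IsProbabilityMeasure μ] {ι : Type*} {s : Finset ι} {F : ι → Ω → ℝ}
    (h : ∀ i ∈ s, HasAllMoments μ (F i)) : HasAllMoments μ (fun w => ∏ i ∈ s, F i w) := by
  classical
  induction s using Finset.induction_on with
  | empty => simpa using const (μ := μ) 1
  | insert i s his ih =>
    simp only [Finset.prod_insert his]
    exact (h i (Finset.mem_insert_self i s)).mul
      (ih fun j hj => h j (Finset.mem_insert_of_mem hj))

lemma of_integrable_pow [IsProbabilityMeasure μ] (hf : AEStronglyMeasurable f μ)
    (h : ∀ k : ℕ, 2 < k → Integrable (fun w => |f w| ^ k) μ) : HasAllMoments μ f := by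
  intro k
  have h3 : MemLp f ((k + 3 : ℕ) : ENNReal) μ := by
    rw [← integrable_norm_rpow_iff hf (by simp) (by simp)]
    simpa only [ENNReal.toReal_natCast, Real.rpow_natCast, Real.norm_eq_abs] using
      h (k + 3) (by omega)
  exact h3.mono_exponent (by gcongr; omega)

end HasAllMoments

lemma integral_prod_pow_eq_of_injective {a : ℤ → Ω → ℝ}
    (ha_meas : ∀ i, Measurable (a i)) (ha_symm : ∀ i, a (-i) = a i)
    (ha_indep : iIndepFun (fun i : ℕ => a ((i : ℤ) + 1)) μ)
    {ι : Type*} [Fintype ι] {x : ι → ℤ} (hx : ∀ V, x V ≠ 0)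
    (hinj : Function.Injective fun V => |x V|) (e : ι → ℕ) :
    ∫ w, ∏ V, a (x V) w ^ e V ∂μ = ∏ V, ∫ w, a (x V) w ^ e V ∂μ := by
  have hrep : ∀ V, a (x V) = a ((((x V).natAbs - 1 : ℕ) : ℤ) + 1) := by
    intro V
    have h0 := hx V
    rcases le_total 0 (x V) with h | h
    · congr 1; omega
    · rw [← ha_symm (x V)]; congr 1; omega
  have hg : Function.Injective fun V => ((x V).natAbs - 1 : ℕ) := by
    intro V W h
    apply hinj
    have h1 := hx V
    have h2 := hx W
    simp only [Int.abs_eq_natAbs] at h ⊢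
    omega
  have hi := (ha_indep.precomp hg).comp (fun V (r : ℝ) => r ^ e V)
    (fun V => measurable_id.pow_const _)
  have := hi.integral_fun_prod_eq_prod_integral
    (fun V => (((ha_meas _).pow_const _).aestronglyMeasurable))
  simpa [hrep, Function.comp_def] using this

end Moments

/-- The covariance of the product of the `a (J i)` over the first `p` indices and the product over
the last `q` indices. -/
noncomputable def covar {Ω : Type*} [MeasurableSpace Ω] (μ : Measure Ω) (a : ℤ → Ω → ℝ) (p : ℕ) {q : ℕ}
    (J : Fin (p + q) → ℤ) : ℝ :=
  ∫ w, ∏ i, a (J i) w ∂μ -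
    (∫ w, ∏ i : Fin (p + q) with i.val < p, a (J i) w ∂μ) *
      ∫ w, ∏ i : Fin (p + q) with p ≤ i.val, a (J i) w ∂μ

lemma apply_units_mul {Ω : Type*} {a : ℤ → Ω → ℝ} (ha_symm : ∀ i, a (-i) = a i) (s : ℤˣ) (x : ℤ) :
    a ((s : ℤ) * x) = a x := by
  rcases Int.units_eq_one_or s with rfl | rfl
  · simp
  · simp [ha_symm]

section Covar

variable {Ω : Type*} [MeasurableSpace Ω] {μ : Measure Ω} {a : ℤ → Ω → ℝ} {p q : ℕ}
  {ι : Type*} [DecidableEq ι]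

/-- The number of indices among the first `p` in the fibre of `f` over `V`. -/
def fiberFst (p : ℕ) {q : ℕ} (f : Fin (p + q) → ι) (V : ι) : ℕ :=
  (Finset.univ.filter fun i : Fin (p + q) => i.val < p ∧ f i = V).card

/-- The number of indices among the last `q` in the fibre of `f` over `V`. -/
def fiberSnd (p : ℕ) {q : ℕ} (f : Fin (p + q) → ι) (V : ι) : ℕ :=
  (Finset.univ.filter fun i : Fin (p + q) => p ≤ i.val ∧ f i = V).card

lemma prod_comp_eq_prod_pow_card [Fintype ι] {N : ℕ} (g : ι → ℝ) (f : Fin N → ι)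
    (P : Fin N → Prop) [DecidablePred P] :
    ∏ i with P i, g (f i) = ∏ V, g V ^ (Finset.univ.filter fun i => P i ∧ f i = V).card := by
  rw [← Finset.prod_fiberwise (Finset.univ.filter P) f]
  refine Finset.prod_congr rfl fun V _ => ?_
  rw [Finset.filter_filter, Finset.prod_congr rfl (g := fun _ => g V), Finset.prod_const]
  intro i hi
  rw [(Finset.mem_filter.1 hi).2.2]

lemma covar_eq [Fintype ι] (ha_meas : ∀ i, Measurable (a i)) (ha_symm : ∀ i, a (-i) = a i)
    (ha_indep : iIndepFun (fun i : ℕ => a ((i : ℤ) + 1)) μ)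
    {x : ι → ℤ} (hx : ∀ V, x V ≠ 0) (hinj : Function.Injective fun V => |x V|)
    (f : Fin (p + q) → ι) (s : Fin (p + q) → ℤˣ) :
    covar μ a p (fun i => (s i : ℤ) * x (f i)) =
      ∏ V, ∫ w, a (x V) w ^ (fiberFst p f V + fiberSnd p f V) ∂μ -
        ∏ V, ((∫ w, a (x V) w ^ fiberFst p f V ∂μ) * ∫ w, a (x V) w ^ fiberSnd p f V ∂μ) := by
  have h1 : ∀ w, ∏ i : Fin (p + q) with i.val < p, a (x (f i)) w =
      ∏ V, a (x V) w ^ fiberFst p f V := fun w =>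
    prod_comp_eq_prod_pow_card (fun V => a (x V) w) f (fun i => i.val < p)
  have h2 : ∀ w, ∏ i : Fin (p + q) with p ≤ i.val, a (x (f i)) w =
      ∏ V, a (x V) w ^ fiberSnd p f V := fun w =>
    prod_comp_eq_prod_pow_card (fun V => a (x V) w) f (fun i => p ≤ i.val)
  have h3 : ∀ w, ∏ i : Fin (p + q), a (x (f i)) w =
      ∏ V, a (x V) w ^ (fiberFst p f V + fiberSnd p f V) := by
    intro w
    rw [← Finset.prod_filter_mul_prod_filter_not Finset.univ (fun i : Fin (p + q) => i.val < p)]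
    simp only [not_lt]
    rw [h1, h2, ← Finset.prod_mul_distrib]
    simp only [pow_add]
  simp only [covar, apply_units_mul ha_symm, h1, h2, h3]
  rw [integral_prod_pow_eq_of_injective ha_meas ha_symm ha_indep hx hinj,
    integral_prod_pow_eq_of_injective ha_meas ha_symm ha_indep hx hinj,
    integral_prod_pow_eq_of_injective ha_meas ha_symm ha_indep hx hinj, Finset.prod_mul_distrib]

end Covar

end BandToeplitz

namespace BandToeplitz

/-- The assumptions on the entries of the matrix: a symmetric sequence, independent on the positive
integers, with mean `0`, variance `1`, fourth moment `κ` and bounded higher moments. -/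
structure IsEntrySequence {Ω : Type*} [MeasurableSpace Ω] (μ : Measure Ω) (a : ℤ → Ω → ℝ)
    (κ : ℝ) : Prop where
  meas : ∀ i, Measurable (a i)
  zero : a 0 = 0
  symm : ∀ i, a (-i) = a i
  indep : iIndepFun (fun i : ℕ => a ((i : ℤ) + 1)) μ
  mean : ∀ i, i ≠ 0 → ∫ w, a i w ∂μ = 0
  sq : ∀ i, i ≠ 0 → ∫ w, a i w ^ 2 ∂μ = 1
  fourth : ∀ i, i ≠ 0 → ∫ w, a i w ^ 4 ∂μ = κ
  moments : ∀ k : ℕ, 2 < k → ∃ C : ℝ, ∀ i, i ≠ 0 →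
    Integrable (fun w => |a i w| ^ k) μ ∧ ∫ w, |a i w| ^ k ∂μ < C

section Covar

variable {Ω : Type*} [MeasurableSpace Ω] {μ : Measure Ω} [IsProbabilityMeasure μ]
  {a : ℤ → Ω → ℝ} {κ : ℝ} {p q : ℕ}

lemma IsEntrySequence.hasAllMoments (h : IsEntrySequence μ a κ) (i : ℤ) :
    HasAllMoments μ (a i) := by
  rcases eq_or_ne i 0 with rfl | hi
  · rw [h.zero]; exact HasAllMoments.const 0
  · exact HasAllMoments.of_integrable_pow (h.meas i).aestronglyMeasurable fun k hk =>
      ((h.moments k hk).choose_spec i hi).1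

lemma IsEntrySequence.exists_moment_bound (h : IsEntrySequence μ a κ) (k : ℕ) :
    ∃ C : ℝ, ∀ i, i ≠ 0 → |∫ w, a i w ^ k ∂μ| ≤ C := by
  obtain hk | hk := le_or_gt k 2
  · refine ⟨1, fun i hi => ?_⟩
    interval_cases k
    · simp
    · simp [h.mean i hi]
    · simp [h.sq i hi]
  · obtain ⟨C, hC⟩ := h.moments k hk
    refine ⟨C, fun i hi => ?_⟩
    calc |∫ w, a i w ^ k ∂μ| ≤ ∫ w, |a i w ^ k| ∂μ := abs_integral_le_integral_abs
      _ = ∫ w, |a i w| ^ k ∂μ := by simp only [abs_pow]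
      _ ≤ C := (hC i hi).2.le

variable {ι : Type*} [DecidableEq ι] [Fintype ι] {x : ι → ℤ}

lemma covar_eq_zero_of_fiber_eq_one (h : IsEntrySequence μ a κ) (hx : ∀ V, x V ≠ 0)
    (hinj : Function.Injective fun V => |x V|) (f : Fin (p + q) → ι) (s : Fin (p + q) → ℤˣ)
    {V : ι} (hV : fiberFst p f V + fiberSnd p f V = 1) :
    covar μ a p (fun i => (s i : ℤ) * x (f i)) = 0 := by
  rw [covar_eq h.meas h.symm h.indep hx hinj, Finset.prod_eq_zero (Finset.mem_univ V),
    Finset.prod_eq_zero (Finset.mem_univ V), sub_zero]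
  · rcases (by omega : fiberFst p f V = 1 ∨ fiberSnd p f V = 1) with h1 | h1
    · simp [h1, h.mean _ (hx V)]
    · simp [h1, h.mean _ (hx V)]
  · simp [hV, h.mean _ (hx V)]

lemma covar_eq_zero_of_no_cross (h : IsEntrySequence μ a κ) (hx : ∀ V, x V ≠ 0)
    (hinj : Function.Injective fun V => |x V|) (f : Fin (p + q) → ι) (s : Fin (p + q) → ℤˣ)
    (hV : ∀ V, fiberFst p f V = 0 ∨ fiberSnd p f V = 0) :
    covar μ a p (fun i => (s i : ℤ) * x (f i)) = 0 := by
  rw [covar_eq h.meas h.symm h.indep hx hinj, sub_eq_zero]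
  refine Finset.prod_congr rfl fun V _ => ?_
  rcases hV V with h1 | h1 <;> simp [h1]

lemma covar_eq_one (h : IsEntrySequence μ a κ) (hx : ∀ V, x V ≠ 0)
    (hinj : Function.Injective fun V => |x V|) (f : Fin (p + q) → ι) (s : Fin (p + q) → ℤˣ)
    (hall : ∀ V, fiberFst p f V + fiberSnd p f V = 2) {V : ι} (hV : fiberFst p f V = 1) :
    covar μ a p (fun i => (s i : ℤ) * x (f i)) = 1 := by
  rw [covar_eq h.meas h.symm h.indep hx hinj]
  rw [Finset.prod_eq_zero (f := fun V => (∫ w, a (x V) w ^ fiberFst p f V ∂μ) *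
    ∫ w, a (x V) w ^ fiberSnd p f V ∂μ) (Finset.mem_univ V), sub_zero]
  · refine Finset.prod_eq_one fun W _ => ?_
    rw [hall W, h.sq _ (hx W)]
  · simp [hV, h.mean _ (hx V)]

lemma covar_eq_sub_one (h : IsEntrySequence μ a κ) (hx : ∀ V, x V ≠ 0)
    (hinj : Function.Injective fun V => |x V|) (f : Fin (p + q) → ι) (s : Fin (p + q) → ℤˣ)
    {V : ι} (hV : fiberFst p f V = 2 ∧ fiberSnd p f V = 2)
    (hall : ∀ W, W ≠ V → (fiberFst p f W = 2 ∧ fiberSnd p f W = 0) ∨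
      (fiberFst p f W = 0 ∧ fiberSnd p f W = 2)) :
    covar μ a p (fun i => (s i : ℤ) * x (f i)) = κ - 1 := by
  rw [covar_eq h.meas h.symm h.indep hx hinj,
    Finset.prod_eq_single_of_mem V (Finset.mem_univ V),
    Finset.prod_eq_single_of_mem V (Finset.mem_univ V)]
  · simp [hV.1, hV.2, h.sq _ (hx V), h.fourth _ (hx V)]
  · intro W _ hW
    rcases hall W hW with h1 | h1 <;> simp [h1.1, h1.2, h.sq _ (hx W)]
  · intro W _ hW
    rcases hall W hW with h1 | h1 <;> simp [h1.1, h1.2, h.sq _ (hx W)]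

lemma exists_covar_bound (h : IsEntrySequence μ a κ) (f : Fin (p + q) → ι) :
    ∃ C : ℝ, ∀ (s : Fin (p + q) → ℤˣ) (x : ι → ℤ), (∀ V, x V ≠ 0) →
      (Function.Injective fun V => |x V|) →
      |covar μ a p (fun i => (s i : ℤ) * x (f i))| ≤ C := by
  choose M hM using h.exists_moment_bound
  refine ⟨∏ V, M (fiberFst p f V + fiberSnd p f V) +
    ∏ V, (M (fiberFst p f V) * M (fiberSnd p f V)), fun s x hx hinj => ?_⟩
  rw [covar_eq h.meas h.symm h.indep hx hinj]
  refine (abs_sub _ _).trans (add_le_add ?_ ?_)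
  · rw [Finset.abs_prod]
    exact Finset.prod_le_prod (fun _ _ => abs_nonneg _) fun V _ => hM _ _ (hx V)
  · rw [Finset.abs_prod]
    refine Finset.prod_le_prod (fun _ _ => abs_nonneg _) fun V _ => ?_
    rw [abs_mul]
    exact mul_le_mul (hM _ _ (hx V)) (hM _ _ (hx V)) (abs_nonneg _)
      ((abs_nonneg _).trans (hM _ _ (hx V)))

end Covar

end BandToeplitz

namespace BandToeplitz

/-- The number of starting points in `{0, …, n - 1}` from which the displacements `S k`, `k ∈ A`,
do not leave `{0, …, n - 1}`. -/
def pathCount {κ : Type*} (n : ℕ) (A : Finset κ) (S : κ → ℤ) : ℕ :=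
  ((Finset.range n).filter fun u : ℕ => ∀ k ∈ A, 0 ≤ (u : ℤ) + S k ∧ (u : ℤ) + S k < n).card

section Trace

variable {n m : ℕ} {c : ℤ → ℝ} {K : ℤ}

lemma filter_le_zero_eq (m : ℕ) :
    (Finset.univ.filter fun i : Fin (m + 1) => i ≤ 0) = {0} := by
  ext i; simp

lemma sum_cons_filter_le_succ (x : ℤ) (J : Fin m → ℤ) (k : Fin m) :
    ∑ i : Fin (m + 1) with i ≤ k.succ, (Fin.cons x J : Fin (m + 1) → ℤ) i =
      x + ∑ i with i ≤ k, J i := by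
  rw [Finset.sum_filter, Fin.sum_univ_succ, Finset.sum_filter]
  simp [Fin.succ_le_succ_iff]

lemma sum_piFinset_succ (m : ℕ) (A : Finset ℤ) (F : (Fin (m + 1) → ℤ) → ℝ) :
    ∑ J ∈ Fintype.piFinset (fun _ : Fin (m + 1) => A), F J =
      ∑ x ∈ A, ∑ J ∈ Fintype.piFinset (fun _ : Fin m => A), F (Fin.cons x J) := by
  rw [← Finset.sum_product']
  refine Finset.sum_nbij' (fun J => (J 0, Fin.tail J)) (fun y => Fin.cons y.1 y.2) ?_ ?_ ?_ ?_ ?_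
  · intro J hJ
    rw [Fintype.mem_piFinset] at hJ
    simp [Finset.mem_product, Fintype.mem_piFinset, hJ, Fin.tail]
  · intro y hy
    rw [Finset.mem_product, Fintype.mem_piFinset] at hy
    rw [Fintype.mem_piFinset]
    intro i
    refine Fin.cases ?_ (fun j => ?_) i
    · simpa using hy.1
    · simpa using hy.2 j
  · intro J _; simp
  · intro y _; simp
  · intro J _; simp

lemma sum_fin_toeplitz (hc : ∀ x, c (-x) = c x) (hK : ∀ x, K < |x| → c x = 0) (u : ℤ)
    (G : ℤ → ℝ) :
    ∑ w : Fin n, c (u - (w : ℕ)) * G (w : ℕ) =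
      ∑ x ∈ Finset.Icc (-K) K, if 0 ≤ u + x ∧ u + x < n then c x * G (u + x) else 0 := by
  rw [← Finset.sum_filter, Fin.sum_univ_eq_sum_range (fun w => c (u - (w : ℕ)) * G (w : ℕ)) n]
  have h1 : ∑ w ∈ Finset.range n, c (u - (w : ℕ)) * G (w : ℕ) =
      ∑ w ∈ (Finset.range n).filter (fun w : ℕ => |u - w| ≤ K), c (u - (w : ℕ)) * G (w : ℕ) := by
    rw [Finset.sum_filter]
    refine Finset.sum_congr rfl fun w _ => ?_
    split_ifs with h
    · rfl
    · rw [hK _ (not_le.1 h), zero_mul]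
  rw [h1]
  refine Finset.sum_nbij' (fun w => (w : ℤ) - u) (fun x => (u + x).toNat) ?_ ?_ ?_ ?_ ?_
  · intro w hw
    simp only [Finset.mem_filter, Finset.mem_range, Finset.mem_Icc, abs_le] at hw ⊢
    omega
  · intro x hx
    simp only [Finset.mem_filter, Finset.mem_range, Finset.mem_Icc, abs_le] at hx ⊢
    omega
  · intro w _
    simp
  · intro x hx
    simp only [Finset.mem_filter] at hx
    omega
  · intro w _
    rw [← hc, neg_sub, add_sub_cancel]

lemma toeplitz_pow_apply (hc : ∀ x, c (-x) = c x) (hK : ∀ x, K < |x| → c x = 0) (m : ℕ)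
    (u v : Fin n) :
    ((Matrix.of fun i j : Fin n => c (((i : ℕ) : ℤ) - ((j : ℕ) : ℤ))) ^ m) u v =
      ∑ J ∈ Fintype.piFinset (fun _ : Fin m => Finset.Icc (-K) K),
        if (∀ k, 0 ≤ ((u : ℕ) : ℤ) + ∑ i with i ≤ k, J i ∧ ((u : ℕ) : ℤ) + ∑ i with i ≤ k, J i < n) ∧
          ((u : ℕ) : ℤ) + ∑ i, J i = (v : ℕ) then ∏ l, c (J l) else 0 := by
  induction m generalizing u with
  | zero =>
    simp [Matrix.one_apply, Fin.ext_iff]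
  | succ m ih =>
    rw [pow_succ', Matrix.mul_apply]
    simp only [ih, Matrix.of_apply]
    rw [sum_fin_toeplitz hc hK (((u : ℕ) : ℤ)) fun w : ℤ =>
      ∑ J ∈ Fintype.piFinset (fun _ : Fin m => Finset.Icc (-K) K),
        if (∀ k, 0 ≤ w + ∑ i with i ≤ k, J i ∧ w + ∑ i with i ≤ k, J i < n) ∧
          w + ∑ i, J i = (v : ℕ) then ∏ l, c (J l) else 0, sum_piFinset_succ]
    refine Finset.sum_congr rfl fun x _ => ?_
    simp only [Fin.forall_fin_succ, sum_cons_filter_le_succ, filter_le_zero_eq,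
      Finset.sum_singleton, Fin.cons_zero, Fin.sum_cons, Fin.prod_univ_succ, Fin.cons_succ]
    split_ifs with hx
    · rw [Finset.mul_sum]
      refine Finset.sum_congr rfl fun J _ => ?_
      simp only [hx, add_assoc, true_and, mul_ite, mul_zero]
    · symm
      refine Finset.sum_eq_zero fun J _ => ?_
      rw [if_neg]
      tauto

lemma trace_toeplitz_pow (hc : ∀ x, c (-x) = c x) (hK : ∀ x, K < |x| → c x = 0) (m : ℕ) :
    ((Matrix.of fun i j : Fin n => c (((i : ℕ) : ℤ) - ((j : ℕ) : ℤ))) ^ m).trace =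
      ∑ J ∈ Fintype.piFinset (fun _ : Fin m => Finset.Icc (-K) K),
        if ∑ i, J i = 0 then
          (pathCount n Finset.univ fun k => ∑ i with i ≤ k, J i) * ∏ l, c (J l) else 0 := by
  simp only [Matrix.trace, Matrix.diag_apply, toeplitz_pow_apply hc hK]
  rw [Finset.sum_comm]
  refine Finset.sum_congr rfl fun J _ => ?_
  simp only [add_eq_left]
  by_cases h : ∑ i, J i = 0
  · simp only [h, and_true, if_true]
    rw [Fin.sum_univ_eq_sum_range (fun u : ℕ => if (∀ k, 0 ≤ (u : ℤ) + ∑ i with i ≤ k, J i ∧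
      (u : ℤ) + ∑ i with i ≤ k, J i < n) then ∏ l, c (J l) else 0) n, ← Finset.sum_filter,
      Finset.sum_const, nsmul_eq_mul]
    simp [pathCount]
  · simp [h]

end Trace

end BandToeplitz

namespace BandToeplitz

section Halves

variable {p q : ℕ}

@[to_additive]
lemma prod_filter_lt_eq {M : Type*} [CommMonoid M] (f : Fin (p + q) → M) :
    ∏ i with i.val < p, f i = ∏ i : Fin p, f (Fin.castAdd q i) := by
  rw [Finset.prod_filter, Fin.prod_univ_add]
  simp

@[to_additive]
lemma prod_filter_ge_eq {M : Type*} [CommMonoid M] (f : Fin (p + q) → M) :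
    ∏ i with p ≤ i.val, f i = ∏ i : Fin q, f (Fin.natAdd p i) := by
  rw [Finset.prod_filter, Fin.prod_univ_add, Finset.prod_eq_one, one_mul]
  · simp
  · intro i _
    exact if_neg (Nat.not_le.2 i.2)

/-- The partial sums of the first `p` terms. -/
def sumFst {M : Type*} [AddCommMonoid M] (y : Fin (p + q) → M) (k : Fin (p + q)) : M :=
  ∑ i with i ≤ k, y i

/-- The partial sums of the last `q` terms. -/
def sumSnd (p : ℕ) {q : ℕ} {M : Type*} [AddCommMonoid M] (y : Fin (p + q) → M)
    (k : Fin (p + q)) : M :=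
  ∑ i : Fin (p + q) with p ≤ i.val ∧ i ≤ k, y i

/-- The first `p` indices. -/
def firstHalf (p q : ℕ) : Finset (Fin (p + q)) := Finset.univ.filter fun i => i.val < p

/-- The last `q` indices. -/
def secondHalf (p q : ℕ) : Finset (Fin (p + q)) := Finset.univ.filter fun i => p ≤ i.val

lemma pathCount_firstHalf (n : ℕ) (J : Fin (p + q) → ℤ) :
    pathCount n (firstHalf p q) (sumFst J) =
      pathCount n Finset.univ fun k : Fin p => ∑ i with i ≤ k, J (Fin.castAdd q i) := by
  have h : ∀ k : Fin p, sumFst J (Fin.castAdd q k) = ∑ i with i ≤ k, J (Fin.castAdd q i) := by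
    intro k
    rw [sumFst, Finset.sum_filter, Fin.sum_univ_add, Finset.sum_filter]
    simp only [Fin.le_def, Fin.val_castAdd, Fin.val_natAdd]
    simp only [add_eq_left]
    refine Finset.sum_eq_zero fun i _ => if_neg ?_
    have := k.2
    omega
  simp only [pathCount, firstHalf, Finset.mem_filter, Finset.mem_univ, true_and, true_implies,
    ← h]
  congr 1
  refine Finset.filter_congr fun u _ => ⟨fun hu k => hu (Fin.castAdd q k) k.2, fun hu k hk => ?_⟩
  exact hu ⟨k, hk⟩

lemma pathCount_secondHalf (n : ℕ) (J : Fin (p + q) → ℤ) :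
    pathCount n (secondHalf p q) (sumSnd p J) =
      pathCount n Finset.univ fun k : Fin q => ∑ i with i ≤ k, J (Fin.natAdd p i) := by
  have h : ∀ k : Fin q, sumSnd p J (Fin.natAdd p k) = ∑ i with i ≤ k, J (Fin.natAdd p i) := by
    intro k
    rw [sumSnd, Finset.sum_filter, Fin.sum_univ_add, Finset.sum_filter]
    simp only [Fin.le_def, Fin.val_castAdd, Fin.val_natAdd]
    rw [Finset.sum_eq_zero, zero_add]
    · simp
    · exact fun i _ => if_neg fun hi => absurd i.2 (not_lt.2 hi.1)
  simp only [← h]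
  simp only [pathCount, secondHalf, Finset.mem_filter, Finset.mem_univ, true_and, true_implies]
  congr 1
  refine Finset.filter_congr fun u _ => ⟨fun hu k => hu (Fin.natAdd p k) (by simp),
    fun hu k hk => ?_⟩
  have hk' : k = Fin.natAdd p ⟨k.val - p, by omega⟩ := Fin.ext (Nat.add_sub_of_le hk).symm
  rw [hk']
  exact hu _

lemma sum_piFinset_add (A : Finset ℤ) (F : (Fin (p + q) → ℤ) → ℝ) :
    ∑ J ∈ Fintype.piFinset (fun _ : Fin (p + q) => A), F J =
      ∑ J₁ ∈ Fintype.piFinset (fun _ : Fin p => A), ∑ J₂ ∈ Fintype.piFinset (fun _ : Fin q => A),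
        F (Fin.append J₁ J₂) := by
  rw [← Finset.sum_product']
  refine Finset.sum_nbij'
    (fun J => (fun i => J (Fin.castAdd q i), fun i => J (Fin.natAdd p i)))
    (fun y => Fin.append y.1 y.2) ?_ ?_ ?_ ?_ ?_
  · intro J hJ
    rw [Fintype.mem_piFinset] at hJ
    simp [Finset.mem_product, Fintype.mem_piFinset, hJ]
  · intro y hy
    simp only [Finset.mem_product, Fintype.mem_piFinset] at hy ⊢
    intro i
    refine Fin.addCases (fun j => ?_) (fun j => ?_) i
    · simpa using hy.1 j
    · simpa using hy.2 j
  · intro J _; exact Fin.append_castAdd_natAdd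
  · intro y _; simp
  · intro J _; rw [Fin.append_castAdd_natAdd]

end Halves

/-- The contribution of the step sequence `J` to the covariance of two traces of powers. -/
noncomputable def summand {Ω : Type*} [MeasurableSpace Ω] (μ : Measure Ω) (a : ℤ → Ω → ℝ)
    (p : ℕ) {q : ℕ} (n : ℕ) (m₁ m₂ : ℤ) (J : Fin (p + q) → ℤ) : ℝ :=
  if (∑ i ∈ firstHalf p q, J i = 0 ∧ ∑ i ∈ secondHalf p q, J i = 0) ∧
      ∀ i, |J i| ≤ if i.val < p then m₁ else m₂ then
    pathCount n (firstHalf p q) (sumFst J) * pathCount n (secondHalf p q) (sumSnd p J) *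
      covar μ a p J
  else 0

section Expectation

variable {Ω : Type*} [MeasurableSpace Ω] {μ : Measure Ω} [IsProbabilityMeasure μ]
  {a : ℤ → Ω → ℝ} {κ : ℝ} {p q : ℕ}

lemma tracePow_eq (h : IsEntrySequence μ a κ) (bn : ℕ → ℝ) (p n : ℕ) (t : ℝ) {K : ℤ}
    (hK : ⌊bn n * t⌋ ≤ K) (w : Ω) :
    tracePow a bn p n t w = ∑ J ∈ Fintype.piFinset (fun _ : Fin p => Finset.Icc (-K) K),
      (1 / √(bn n)) ^ p * ((if ∑ i, J i = 0 ∧ ∀ i, |J i| ≤ ⌊bn n * t⌋ then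
        (pathCount n Finset.univ fun k => ∑ i with i ≤ k, J i : ℝ) else 0) *
          ∏ i, a (J i) w) := by
  rw [tracePow, bandMatrix, trace_toeplitz_pow (c := fun x => (1 / √(bn n)) *
    (if |x| ≤ ⌊bn n * t⌋ then a x w else 0)) (K := K)]
  · refine Finset.sum_congr rfl fun J _ => ?_
    rw [Finset.prod_mul_distrib, Finset.prod_const, Finset.card_univ, Fintype.card_fin,
      Fintype.prod_ite_zero]
    by_cases h1 : ∑ i, J i = 0 <;> by_cases h2 : ∀ i, |J i| ≤ ⌊bn n * t⌋
    · simp only [h1, h2, implies_true, and_self, if_true]; ring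
    · simp [h1, h2]
    · simp [h1]
    · simp [h1]
  · intro x; simp only [abs_neg, h.symm]
  · intro x hx
    rw [if_neg (not_le.2 (hK.trans_lt hx)), mul_zero]

lemma hasAllMoments_tracePow (h : IsEntrySequence μ a κ) (bn : ℕ → ℝ) (p n : ℕ) (t : ℝ) :
    HasAllMoments μ (tracePow a bn p n t) := by
  have : tracePow a bn p n t = fun w => _ := funext fun w => tracePow_eq h bn p n t le_rfl w
  rw [this]
  exact HasAllMoments.sum fun J _ => (HasAllMoments.const _).mul
    ((HasAllMoments.const _).mul (HasAllMoments.prod fun i _ => h.hasAllMoments _))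

lemma hasAllMoments_fluctuation (h : IsEntrySequence μ a κ) (bn : ℕ → ℝ) (p n : ℕ) (t : ℝ) :
    HasAllMoments μ (fluctuation μ a bn p n t) :=
  (HasAllMoments.const _).mul ((hasAllMoments_tracePow h bn p n t).sub (HasAllMoments.const _))

lemma covariance_prod_eq_covar (h : IsEntrySequence μ a κ) (J₁ : Fin p → ℤ) (J₂ : Fin q → ℤ) :
    cov[fun w => ∏ i, a (J₁ i) w, fun w => ∏ i, a (J₂ i) w; μ] =
      covar μ a p (Fin.append J₁ J₂) := by
  rw [covariance_eq_sub]
  · simp only [covar, prod_filter_lt_eq, prod_filter_ge_eq, Fin.prod_univ_add, Fin.append_left,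
      Fin.append_right, Pi.mul_apply]
  · exact HasAllMoments.prod (fun i _ => h.hasAllMoments _) 2
  · exact HasAllMoments.prod (fun i _ => h.hasAllMoments _) 2

lemma integral_fluctuation_mul (h : IsEntrySequence μ a κ) (bn : ℕ → ℝ) (n : ℕ) (t₁ t₂ : ℝ)
    {K : ℤ} (hK₁ : ⌊bn n * t₁⌋ ≤ K) (hK₂ : ⌊bn n * t₂⌋ ≤ K) :
    ∫ w, fluctuation μ a bn p n t₁ w * fluctuation μ a bn q n t₂ w ∂μ =
      (√(bn n) / n) ^ 2 * (1 / √(bn n)) ^ (p + q) *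
        ∑ J ∈ Fintype.piFinset (fun _ : Fin (p + q) => Finset.Icc (-K) K),
          summand μ a p n ⌊bn n * t₁⌋ ⌊bn n * t₂⌋ J := by
  have e1 : ∫ w, fluctuation μ a bn p n t₁ w * fluctuation μ a bn q n t₂ w ∂μ =
      (√(bn n) / n) ^ 2 * cov[tracePow a bn p n t₁, tracePow a bn q n t₂; μ] := by
    rw [covariance, ← integral_const_mul]
    refine integral_congr_ae (Eventually.of_forall fun w => ?_)
    simp only [fluctuation]
    ring
  have f1 : tracePow a bn p n t₁ = fun w => _ := funext fun w => tracePow_eq h bn p n t₁ hK₁ w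
  have f2 : tracePow a bn q n t₂ = fun w => _ := funext fun w => tracePow_eq h bn q n t₂ hK₂ w
  rw [e1, f1, f2, mul_assoc]
  congr 1
  rw [covariance_fun_sum_fun_sum', sum_piFinset_add, Finset.mul_sum]
  · refine Finset.sum_congr rfl fun J₁ _ => ?_
    rw [Finset.mul_sum]
    refine Finset.sum_congr rfl fun J₂ _ => ?_
    rw [covariance_const_mul_left, covariance_const_mul_left, covariance_const_mul_right,
      covariance_const_mul_right, covariance_prod_eq_covar h]
    have hs1 : ∑ i ∈ firstHalf p q, Fin.append J₁ J₂ i = ∑ i, J₁ i := by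
      rw [firstHalf, sum_filter_lt_eq]; simp
    have hs2 : ∑ i ∈ secondHalf p q, Fin.append J₁ J₂ i = ∑ i, J₂ i := by
      rw [secondHalf, sum_filter_ge_eq]; simp
    have hb : (∀ i : Fin (p + q), |Fin.append J₁ J₂ i| ≤
        if i.val < p then ⌊bn n * t₁⌋ else ⌊bn n * t₂⌋) ↔
        (∀ i, |J₁ i| ≤ ⌊bn n * t₁⌋) ∧ ∀ i, |J₂ i| ≤ ⌊bn n * t₂⌋ := by
      constructor
      · intro hi
        exact ⟨fun i => by simpa using hi (Fin.castAdd q i),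
          fun i => by simpa using hi (Fin.natAdd p i)⟩
      · rintro ⟨h1, h2⟩ i
        refine Fin.addCases (fun j => ?_) (fun j => ?_) i
        · simpa using h1 j
        · simpa using h2 j
    rw [summand, hs1, hs2, pathCount_firstHalf, pathCount_secondHalf]
    simp only [hb, Fin.append_left, Fin.append_right]
    split_ifs <;> first | ring1 | (exfalso; tauto)
  · exact fun J _ => (HasAllMoments.const _).mul
      ((HasAllMoments.const _).mul (HasAllMoments.prod fun i _ => h.hasAllMoments _)) 2
  · exact fun J _ => (HasAllMoments.const _).mul
      ((HasAllMoments.const _).mul (HasAllMoments.prod fun i _ => h.hasAllMoments _)) 2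

end Expectation

end BandToeplitz

namespace BandToeplitz

section Decomposition

variable {N : ℕ}

/-- The blocks of a partition. -/
abbrev Blocks (π : Part N) : Type := {B : Finset (Fin N) // B ∈ π.parts}

/-- The block variables are nonzero and have distinct absolute values. -/
def Admissible {ι : Type*} (x : ι → ℤ) : Prop :=
  (∀ V, x V ≠ 0) ∧ Function.Injective fun V => |x V|

/-- The steps with signs `s` and block variables `x`. -/
def steps (π : Part N) (s : Fin N → ℤˣ) (x : Blocks π → ℤ) (i : Fin N) : ℤ :=
  (s i : ℤ) * x (blockOf π i)

open Classical in
/-- The signs that are `1` at the smallest element of each block. -/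
noncomputable def normSigns (π : Part N) : Finset (Fin N → ℤˣ) :=
  Finset.univ.filter fun s => ∀ i, (∀ j ∈ π.part i, i ≤ j) → s i = 1

/-- The partition whose blocks are the level sets of `|J|`. -/
noncomputable def absKernel (J : Fin N → ℤ) : Part N :=
  open Classical in Finpartition.ofSetoid (Setoid.ker fun i => |J i|)

lemma mem_part_self (π : Part N) (i : Fin N) : i ∈ π.part i := π.mem_part_self.2 (Finset.mem_univ i)

lemma part_eq_of_mem_part {π : Part N} {i j : Fin N} (h : j ∈ π.part i) :
    π.part j = π.part i :=
  π.part_eq_of_mem (π.part_mem.2 (Finset.mem_univ i)) h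

lemma mem_part_iff {π : Part N} {i j : Fin N} : j ∈ π.part i ↔ π.part j = π.part i :=
  ⟨part_eq_of_mem_part, fun h => h ▸ mem_part_self π j⟩

lemma part_ext {π ρ : Part N} (h : ∀ i, π.part i = ρ.part i) : π = ρ := by
  have key : ∀ (π : Part N) B, B ∈ π.parts ↔ ∃ i, π.part i = B := by
    intro π B
    constructor
    · intro hB
      obtain ⟨i, hi⟩ := π.nonempty_of_mem_parts hB
      exact ⟨i, π.part_eq_of_mem hB hi⟩
    · rintro ⟨i, rfl⟩
      exact π.part_mem.2 (Finset.mem_univ i)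
  ext B
  simp [key, h]

lemma mem_part_absKernel {J : Fin N → ℤ} {i j : Fin N} :
    j ∈ (absKernel J).part i ↔ |J i| = |J j| := by
  classical
  unfold absKernel
  rw [Finpartition.mem_part_ofSetoid_iff_rel]
  rfl

/-- The smallest element of the block of `i`. -/
noncomputable def rep (π : Part N) (i : Fin N) : Fin N := (π.part i).min' ⟨i, mem_part_self π i⟩

lemma rep_mem (π : Part N) (i : Fin N) : rep π i ∈ π.part i := Finset.min'_mem _ _

lemma part_rep (π : Part N) (i : Fin N) : π.part (rep π i) = π.part i :=
  part_eq_of_mem_part (rep_mem π i)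

lemma rep_le {π : Part N} {i j : Fin N} (h : j ∈ π.part (rep π i)) : rep π i ≤ j := by
  rw [part_rep] at h
  exact Finset.min'_le _ _ h

lemma rep_eq_self {π : Part N} {i : Fin N} (h : ∀ j ∈ π.part i, i ≤ j) : rep π i = i :=
  le_antisymm (Finset.min'_le _ _ (mem_part_self π i)) (h _ (rep_mem π i))

/-- The smallest element of a block. -/
noncomputable def blockMin {π : Part N} (V : Blocks π) : Fin N :=
  V.1.min' (π.nonempty_of_mem_parts V.2)

lemma blockOf_eq_iff {π : Part N} {i : Fin N} {V : Blocks π} : blockOf π i = V ↔ i ∈ V.1 := by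
  rw [Subtype.ext_iff]
  exact π.part_eq_iff_mem V.2

lemma blockOf_eq_blockOf {π : Part N} {i j : Fin N} :
    blockOf π i = blockOf π j ↔ π.part i = π.part j := Subtype.ext_iff

lemma blockMin_mem {π : Part N} (V : Blocks π) : blockMin V ∈ V.1 := Finset.min'_mem _ _

lemma blockOf_blockMin {π : Part N} (V : Blocks π) : blockOf π (blockMin V) = V :=
  blockOf_eq_iff.2 (blockMin_mem V)

lemma blockMin_blockOf (π : Part N) (i : Fin N) : blockMin (blockOf π i) = rep π i := rfl

lemma blockMin_le {π : Part N} (V : Blocks π) {j : Fin N} (h : j ∈ π.part (blockMin V)) :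
    blockMin V ≤ j := by
  refine Finset.min'_le _ _ ?_
  rw [← blockOf_eq_iff, blockOf_eq_blockOf.2 (part_eq_of_mem_part h), blockOf_blockMin]

lemma abs_units_mul (u : ℤˣ) (x : ℤ) : |(u : ℤ) * x| = |x| := by
  rcases Int.units_eq_one_or u with rfl | rfl <;> simp

lemma abs_steps (π : Part N) (s : Fin N → ℤˣ) (x : Blocks π → ℤ) (i : Fin N) :
    |steps π s x i| = |x (blockOf π i)| := abs_units_mul _ _

lemma absKernel_steps {π : Part N} (s : Fin N → ℤˣ) {x : Blocks π → ℤ} (hx : Admissible x) :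
    absKernel (steps π s x) = π := by
  refine part_ext fun i => Finset.ext fun j => ?_
  rw [mem_part_absKernel, abs_steps, abs_steps, mem_part_iff, hx.2.eq_iff, blockOf_eq_blockOf,
    eq_comm]

open Classical in
/-- The signs of the `J i` relative to the value at the smallest element of the block. -/
noncomputable def relSign (π : Part N) (J : Fin N → ℤ) (i : Fin N) : ℤˣ :=
  if J i = J (rep π i) then 1 else -1

lemma relSign_mem_normSigns (π : Part N) (J : Fin N → ℤ) : relSign π J ∈ normSigns π := by
  classical
  simp only [normSigns, Finset.mem_filter, Finset.mem_univ, true_and, relSign]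
  intro i hi
  rw [rep_eq_self hi, if_pos rfl]

lemma normSigns_rep {π : Part N} {s : Fin N → ℤˣ} (hs : s ∈ normSigns π) (i : Fin N) :
    s (rep π i) = 1 := by
  classical
  simp only [normSigns, Finset.mem_filter, Finset.mem_univ, true_and] at hs
  exact hs _ fun j hj => rep_le hj

lemma normSigns_blockMin {π : Part N} {s : Fin N → ℤˣ} (hs : s ∈ normSigns π) (V : Blocks π) :
    s (blockMin V) = 1 := by
  classical
  simp only [normSigns, Finset.mem_filter, Finset.mem_univ, true_and] at hs
  exact hs _ fun j hj => blockMin_le V hj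

lemma relSign_steps {π : Part N} {s : Fin N → ℤˣ} (hs : s ∈ normSigns π) {x : Blocks π → ℤ}
    (hx : Admissible x) : relSign π (steps π s x) = s := by
  funext i
  have h1 : blockOf π (rep π i) = blockOf π i := blockOf_eq_blockOf.2 (part_rep π i)
  have h0 := hx.1 (blockOf π i)
  rcases Int.units_eq_one_or (s i) with h | h
  · simp [relSign, steps, normSigns_rep hs, h1, h]
  · rw [relSign, if_neg, h]
    simp only [steps, normSigns_rep hs, h1, h]
    intro h2
    apply h0
    simp at h2
    omega

lemma steps_relSign {π : Part N} {J : Fin N → ℤ} (hJ : absKernel J = π) :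
    steps π (relSign π J) (fun V => J (blockMin V)) = J := by
  funext i
  have h1 : |J i| = |J (rep π i)| := by
    rw [← mem_part_absKernel, hJ]; exact rep_mem π i
  simp only [steps, relSign, blockMin_blockOf]
  split_ifs with h
  · simp [h]
  · rcases abs_eq_abs.1 h1 with h2 | h2
    · exact absurd h2 h
    · simp [h2]

lemma admissible_blockMin {π : Part N} {J : Fin N → ℤ} (hJ : absKernel J = π)
    (h0 : ∀ i, J i ≠ 0) : Admissible fun V : Blocks π => J (blockMin V) := by
  refine ⟨fun V => h0 _, fun V W hVW => ?_⟩
  have h : blockMin V ∈ (absKernel J).part (blockMin W) := mem_part_absKernel.2 hVW.symm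
  rw [hJ] at h
  rw [← blockOf_blockMin V, ← blockOf_blockMin W, blockOf_eq_blockOf, ← mem_part_iff]
  exact h

open Classical in
lemma sum_box_eq_sum_partitions (K : ℤ) (F : (Fin N → ℤ) → ℝ)
    (hF : ∀ J i, J i = 0 → F J = 0) :
    ∑ J ∈ Fintype.piFinset (fun _ : Fin N => Finset.Icc (-K) K), F J =
      ∑ π : Part N, ∑ s ∈ normSigns π,
        ∑ x ∈ Fintype.piFinset (fun _ : Blocks π => Finset.Icc (-K) K) with Admissible x,
          F (steps π s x) := by
  rw [← Finset.sum_subset (Finset.filter_subset (fun J => ∀ i, J i ≠ 0) _),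
    ← Finset.sum_fiberwise _ absKernel]
  · refine Finset.sum_congr rfl fun π _ => ?_
    rw [← Finset.sum_fiberwise_of_maps_to (g := relSign π) (t := normSigns π)
      fun J _ => relSign_mem_normSigns π J]
    refine Finset.sum_congr rfl fun s hs => ?_
    refine Finset.sum_nbij' (fun J V => J (blockMin V)) (steps π s) ?_ ?_ ?_ ?_ ?_
    · intro J hJ
      simp only [Finset.mem_filter, Fintype.mem_piFinset] at hJ ⊢
      exact ⟨fun V => hJ.1.1.1 _, admissible_blockMin hJ.1.2 hJ.1.1.2⟩
    · intro x hx
      simp only [Finset.mem_filter, Fintype.mem_piFinset, Finset.mem_Icc, ← abs_le] at hx ⊢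
      refine ⟨⟨⟨fun i => ?_, fun i => ?_⟩, absKernel_steps s hx.2⟩, relSign_steps hs hx.2⟩
      · rw [abs_steps]; exact hx.1 _
      · rw [← abs_ne_zero, abs_steps, abs_ne_zero]; exact hx.2.1 _
    · intro J hJ
      simp only [Finset.mem_filter] at hJ
      have := steps_relSign hJ.1.2
      rwa [hJ.2] at this
    · intro x _
      funext V
      simp only [steps, normSigns_blockMin hs, blockOf_blockMin]
      simp
    · intro J hJ
      simp only [Finset.mem_filter] at hJ
      have := steps_relSign hJ.1.2
      rw [hJ.2] at this
      rw [this]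
  · intro J hJ hJ'
    simp only [Finset.mem_filter, not_and, not_forall, not_not] at hJ'
    obtain ⟨i, hi⟩ := hJ' hJ
    exact hF J i hi

/-- Changing the signs of the block variables does not change the sum over all of them. -/
lemma sum_steps_flip (K : ℤ) (π : Part N) (F : (Fin N → ℤ) → ℝ) (s s' : Fin N → ℤˣ)
    (ε : Blocks π → ℤˣ) (hs : ∀ i, s i = s' i * ε (blockOf π i))
    [DecidablePred fun x : Blocks π → ℤ => Admissible x] :
    ∑ x ∈ Fintype.piFinset (fun _ : Blocks π => Finset.Icc (-K) K) with Admissible x,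
        F (steps π s x) =
      ∑ x ∈ Fintype.piFinset (fun _ : Blocks π => Finset.Icc (-K) K) with Admissible x,
        F (steps π s' x) := by
  have hmem : ∀ x : Blocks π → ℤ,
      x ∈ (Fintype.piFinset fun _ : Blocks π => Finset.Icc (-K) K).filter Admissible →
      (fun V => (ε V : ℤ) * x V) ∈
        (Fintype.piFinset fun _ : Blocks π => Finset.Icc (-K) K).filter Admissible := by
    intro x hx
    simp only [Finset.mem_filter, Fintype.mem_piFinset, Finset.mem_Icc, ← abs_le, Admissible,
      abs_units_mul] at hx ⊢
    refine ⟨hx.1, fun V => ?_, hx.2.2⟩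
    exact mul_ne_zero (ε V).ne_zero (hx.2.1 V)
  have hinv : ∀ x : Blocks π → ℤ, (fun V => (ε V : ℤ) * ((ε V : ℤ) * x V)) = x := by
    intro x
    funext V
    rcases Int.units_eq_one_or (ε V) with h | h <;> simp [h]
  refine Finset.sum_nbij' (fun x V => (ε V : ℤ) * x V) (fun x V => (ε V : ℤ) * x V) hmem hmem
    (fun x _ => hinv x) (fun x _ => hinv x) fun x _ => ?_
  congr 1
  funext i
  simp only [steps, hs, Units.val_mul, mul_assoc]

end Decomposition

end BandToeplitz

namespace BandToeplitz

section Riemann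

variable {ι : Type*} [Fintype ι]

lemma sum_eq_integral_floor (B : Finset (ι → ℤ)) (g : (ι → ℤ) → ℝ) (hg : ∀ x, x ∉ B → g x = 0) :
    ∑ x ∈ B, g x = ∫ w : ι → ℝ, g fun V => ⌊w V⌋ := by
  classical
  let cube : (ι → ℤ) → Set (ι → ℝ) := fun x => Set.pi Set.univ fun V => Set.Ico (x V : ℝ) (x V + 1)
  have hmem : ∀ x w, w ∈ cube x ↔ (fun V => ⌊w V⌋) = x := by
    intro x w
    simp only [cube, Set.mem_pi, Set.mem_univ, true_implies, Set.mem_Ico, funext_iff,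
      Int.floor_eq_iff]
  have hmeas : ∀ x, MeasurableSet (cube x) := fun x =>
    MeasurableSet.univ_pi fun V => measurableSet_Ico
  have hvol : ∀ x, volume.real (cube x) = 1 := by
    intro x
    simp only [cube, Measure.real]
    rw [Real.volume_pi_Ico_toReal]
    · simp
    · intro V; simp
  have hfin : ∀ x, volume (cube x) ≠ ⊤ := by
    intro x h
    have := hvol x
    simp [Measure.real, h] at this
  have hdec : (fun w : ι → ℝ => g fun V => ⌊w V⌋) =
      fun w => ∑ x ∈ B, (cube x).indicator (fun _ => g x) w := by
    funext w
    have h1 : ∀ x, (cube x).indicator (fun _ => g x) w =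
        if (fun V => ⌊w V⌋) = x then g x else 0 := by
      intro x
      simp only [Set.indicator_apply, hmem]
    simp only [h1, Finset.sum_ite_eq]
    split_ifs with h
    · rfl
    · exact hg _ h
  rw [hdec, integral_finsetSum]
  · refine Finset.sum_congr rfl fun x _ => ?_
    rw [integral_indicator_const _ (hmeas x), hvol, one_smul]
  · intro x _
    exact (integrable_indicator_iff (hmeas x)).2 (integrableOn_const (hfin x))

lemma measurable_comp_floor_mul (g : (ι → ℤ) → ℝ) (c : ℝ) :
    Measurable fun z : ι → ℝ => g fun V => ⌊c * z V⌋ := by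
  have : Measurable g := Measurable.of_discrete
  exact this.comp (measurable_pi_lambda _ fun V => (measurable_const.mul (measurable_pi_apply V)).floor)

lemma sum_div_pow_eq_integral (B : Finset (ι → ℤ)) (g : (ι → ℤ) → ℝ)
    (hg : ∀ x, x ∉ B → g x = 0) {c : ℝ} (hc : 0 < c) :
    (∑ x ∈ B, g x) / c ^ Fintype.card ι = ∫ z : ι → ℝ, g fun V => ⌊c * z V⌋ := by
  rw [sum_eq_integral_floor B g hg]
  have := Measure.integral_comp_smul (volume : Measure (ι → ℝ))
    (fun w => g fun V => ⌊w V⌋) c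
  simp only [Pi.smul_apply, smul_eq_mul, Module.finrank_pi] at this
  rw [this, abs_of_pos (by positivity), div_eq_inv_mul]

lemma tendsto_floor_mul_div {b : ℕ → ℝ} (hb : Tendsto b atTop atTop) (z : ℝ) :
    Tendsto (fun n => (⌊b n * z⌋ : ℝ) / b n) atTop (𝓝 z) := by
  have h1 : Tendsto (fun n => z - 1 / b n) atTop (𝓝 z) := by
    simpa using tendsto_const_nhds.sub (tendsto_inv_atTop_zero.comp hb)
  refine tendsto_of_tendsto_of_tendsto_of_le_of_le' h1 tendsto_const_nhds ?_ ?_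
  · filter_upwards [hb.eventually_gt_atTop 0] with n hn
    rw [le_div_iff₀ hn, sub_mul, one_div, inv_mul_cancel₀ hn.ne', mul_comm]
    exact (Int.sub_one_lt_floor _).le
  · filter_upwards [hb.eventually_gt_atTop 0] with n hn
    rw [div_le_iff₀ hn, mul_comm z]
    exact Int.floor_le _

/-- Convergence of Riemann sums over a lattice of mesh `1 / b n`. -/
lemma tendsto_riemann_sum [DecidableEq ι] {b : ℕ → ℝ} (hb : Tendsto b atTop atTop) {t C : ℝ} {K : ℕ → ℤ}
    (hK : ∀ n, ⌊b n * t⌋ ≤ K n) {G : ℕ → (ι → ℤ) → ℝ} (hC : ∀ n x, |G n x| ≤ C)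
    (hsupp : ∀ n x, G n x ≠ 0 → ∀ V, |x V| ≤ ⌊b n * t⌋) {g : (ι → ℝ) → ℝ}
    (hlim : ∀ᵐ z : ι → ℝ, Tendsto (fun n => G n fun V => ⌊b n * z V⌋) atTop (𝓝 (g z))) :
    Tendsto (fun n => (∑ x ∈ Fintype.piFinset (fun _ : ι => Finset.Icc (-K n) (K n)), G n x) /
      b n ^ Fintype.card ι) atTop (𝓝 (∫ z, g z)) := by
  have hev : (fun n => ∫ z : ι → ℝ, G n fun V => ⌊b n * z V⌋) =ᶠ[atTop]
      fun n => (∑ x ∈ Fintype.piFinset (fun _ : ι => Finset.Icc (-K n) (K n)), G n x) /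
        b n ^ Fintype.card ι := by
    filter_upwards [hb.eventually_gt_atTop 0] with n hn
    rw [sum_div_pow_eq_integral _ _ _ hn]
    intro x hx
    by_contra h
    refine hx (Fintype.mem_piFinset.2 fun V => ?_)
    rw [Finset.mem_Icc, ← abs_le]
    exact (hsupp n x h V).trans (hK n)
  refine Tendsto.congr' hev ?_
  let A : Set (ι → ℝ) := Set.pi Set.univ fun _ => Set.Icc (-(t + 1)) (t + 1)
  have hA : MeasurableSet A := MeasurableSet.univ_pi fun V => measurableSet_Icc
  have hC0 : 0 ≤ C := (abs_nonneg _).trans (hC 0 0)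
  refine tendsto_integral_filter_of_dominated_convergence (A.indicator fun _ => C) ?_ ?_ ?_ hlim
  · exact Eventually.of_forall fun n => (measurable_comp_floor_mul (G n) (b n)).aestronglyMeasurable
  · filter_upwards [hb.eventually_ge_atTop 1] with n hn
    refine Eventually.of_forall fun z => ?_
    rw [Real.norm_eq_abs]
    by_cases h : G n (fun V => ⌊b n * z V⌋) = 0
    · rw [h, abs_zero]
      exact Set.indicator_nonneg (fun _ _ => hC0) z
    · rw [Set.indicator_of_mem]
      · exact hC n _
      · intro V _
        have h1 := hsupp n _ h V
        rw [Int.le_floor] at h1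
        push_cast at h1
        rw [abs_le] at h1
        have h2 := Int.floor_le (b n * z V)
        have h3 := Int.lt_floor_add_one (b n * z V)
        constructor
        · by_contra h4
          push Not at h4
          nlinarith
        · by_contra h4
          push Not at h4
          nlinarith
  · refine (integrable_indicator_iff hA).2 (integrableOn_const ?_)
    exact (isCompact_univ_pi fun _ => isCompact_Icc).measure_lt_top.ne

lemma ae_linear_ne {c : ι → ℝ} (hc : c ≠ 0) (r : ℝ) : ∀ᵐ z : ι → ℝ, ∑ V, c V * z V ≠ r := by
  classical
  obtain ⟨k, hk⟩ := Function.ne_iff.1 hc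
  simp only [Pi.zero_apply] at hk
  let φ : (ι → ℝ) →ᵃ[ℝ] ℝ :=
    (∑ V, c V • (LinearMap.proj V : (ι → ℝ) →ₗ[ℝ] ℝ)).toAffineMap
  have hφ : ∀ z, φ z = ∑ V, c V * z V := by
    intro z; simp [φ]
  let s : AffineSubspace ℝ (ι → ℝ) := (AffineSubspace.mk' r ⊥).comap φ
  have hs : ∀ z, z ∈ s ↔ ∑ V, c V * z V = r := by
    intro z
    rw [← hφ]
    simp [s, AffineSubspace.mem_mk', sub_eq_zero]
  have hne : s ≠ ⊤ := by
    intro h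
    have h1 : (0 : ι → ℝ) ∈ s := h ▸ AffineSubspace.mem_top _ _ _
    have h2 : (Pi.single k 1 : ι → ℝ) ∈ s := h ▸ AffineSubspace.mem_top _ _ _
    rw [hs] at h1 h2
    simp [Pi.single_apply] at h1 h2
    exact hk (h2.trans h1.symm)
  have := Measure.addHaar_affineSubspace volume s hne
  rw [ae_iff]
  convert this using 2
  ext z
  simpa using (hs z).symm

end Riemann

section Limits

lemma eventually_abs_le_floor_iff {b : ℕ → ℝ} (hb : Tendsto b atTop atTop) {x : ℕ → ℤ} {w t : ℝ}
    (hx : Tendsto (fun n => (x n : ℝ) / b n) atTop (𝓝 w)) (hw : |w| ≠ t) :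
    ∀ᶠ n in atTop, (|x n| ≤ ⌊b n * t⌋ ↔ |w| ≤ t) := by
  have h := hx.abs
  rcases lt_or_gt_of_ne hw with h1 | h1
  · filter_upwards [h.eventually_lt_const h1, hb.eventually_gt_atTop 0] with n hn hbn
    rw [abs_div, abs_of_pos hbn, div_lt_iff₀ hbn] at hn
    simp only [h1.le, iff_true, Int.le_floor]
    push_cast
    linarith
  · filter_upwards [h.eventually_const_lt h1, hb.eventually_gt_atTop 0] with n hn hbn
    rw [abs_div, abs_of_pos hbn, lt_div_iff₀ hbn] at hn
    simp only [not_le.2 h1, iff_false, Int.le_floor]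
    push_cast
    linarith

lemma eventually_admissible {ι : Type*} [Finite ι] {b : ℕ → ℝ}
    {x : ℕ → ι → ℤ} {w : ι → ℝ} (hx : ∀ V, Tendsto (fun n => (x n V : ℝ) / b n) atTop (𝓝 (w V)))
    (hw : ∀ V, w V ≠ 0) (hinj : Function.Injective fun V => |w V|) :
    ∀ᶠ n in atTop, Admissible (x n) := by
  have h1 : ∀ V, ∀ᶠ n in atTop, x n V ≠ 0 := by
    intro V
    filter_upwards [(hx V).eventually_ne (hw V)] with n hn h0
    simp [h0] at hn
  have h2 : ∀ V W, ∀ᶠ n in atTop, V ≠ W → |x n V| ≠ |x n W| := by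
    intro V W
    by_cases hVW : V = W
    · exact Eventually.of_forall fun n h => absurd hVW h
    · have h3 := ((hx V).abs.sub (hx W).abs).eventually_ne (sub_ne_zero.2 (hinj.ne hVW))
      filter_upwards [h3] with n hn _ h0
      apply hn
      rw [abs_div, abs_div, ← Int.cast_abs, ← Int.cast_abs, h0, sub_self]
  filter_upwards [eventually_all.2 h1, eventually_all.2 fun V => eventually_all.2 (h2 V)]
    with n hn1 hn2
  exact ⟨hn1, fun V W h => by_contra fun hne => hn2 V W hne h⟩

lemma eventually_interval_iff {y : ℕ → ℤ} {Y : ℝ}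
    (hy : Tendsto (fun n : ℕ => (y n : ℝ) / n) atTop (𝓝 Y)) (h0 : Y ≠ 0) (h1 : Y ≠ 1) :
    ∀ᶠ n : ℕ in atTop, ((0 ≤ y n ∧ y n < n) ↔ Y ∈ Set.Icc (0 : ℝ) 1) := by
  have hpos : ∀ᶠ n : ℕ in atTop, (0 : ℝ) < n := by
    filter_upwards [eventually_gt_atTop 0] with n hn
    exact_mod_cast hn
  have key : ∀ᶠ n : ℕ in atTop, (0 ≤ (y n : ℝ) ∧ (y n : ℝ) < n ↔ Y ∈ Set.Icc (0 : ℝ) 1) := by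
    rcases lt_or_gt_of_ne h0 with h | h
    · filter_upwards [hy.eventually_lt_const h, hpos] with n hn hp
      rw [div_lt_iff₀ hp, zero_mul] at hn
      exact ⟨fun hh => absurd hh.1 (not_le.2 hn), fun hh => absurd hh.1 (not_le.2 h)⟩
    · rcases lt_or_gt_of_ne h1 with h' | h'
      · filter_upwards [hy.eventually_const_lt h, hy.eventually_lt_const h', hpos] with n hn hn' hp
        rw [lt_div_iff₀ hp, zero_mul] at hn
        rw [div_lt_iff₀ hp, one_mul] at hn'
        exact ⟨fun _ => ⟨h.le, h'.le⟩, fun _ => ⟨hn.le, hn'⟩⟩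
      · filter_upwards [hy.eventually_const_lt h', hpos] with n hn hp
        rw [lt_div_iff₀ hp, one_mul] at hn
        exact ⟨fun hh => absurd hh.2 (not_lt.2 hn.le), fun hh => absurd hh.2 (not_le.2 h')⟩
  filter_upwards [key] with n hn
  rw [← hn]
  norm_cast

end Limits

end BandToeplitz

namespace BandToeplitz

/-- The limiting proportion of starting points from which the displacements `Y k` stay in
`[0, 1]`. -/
noncomputable def pathIntegral {κ : Type*} (A : Finset κ) (Y : κ → ℝ) : ℝ :=
  ∫ r in Set.Icc (0 : ℝ) 1, ∏ k ∈ A, ind01 (r + Y k)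

lemma ind01_eq_ite (v : ℝ) [Decidable (v ∈ Set.Icc (0 : ℝ) 1)] :
    ind01 v = if v ∈ Set.Icc (0 : ℝ) 1 then 1 else 0 := by
  classical
  rw [ind01, Set.indicator_apply]

lemma measurable_ind01 : Measurable ind01 := measurable_const.indicator measurableSet_Icc

lemma abs_prod_ind01_le_one {κ : Type*} (A : Finset κ) (v : κ → ℝ) :
    |∏ k ∈ A, ind01 (v k)| ≤ 1 := by
  classical
  rw [Finset.abs_prod]
  refine Finset.prod_le_one (fun _ _ => abs_nonneg _) fun k _ => ?_
  rw [ind01_eq_ite]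
  split_ifs <;> simp

lemma pathCount_le {κ : Type*} (n : ℕ) (A : Finset κ) (S : κ → ℤ) : pathCount n A S ≤ n :=
  (Finset.card_filter_le _ _).trans (by simp)

lemma pathCount_div_le_one {κ : Type*} (n : ℕ) (A : Finset κ) (S : κ → ℤ) :
    (pathCount n A S : ℝ) / n ≤ 1 :=
  div_le_one_of_le₀ (by exact_mod_cast pathCount_le n A S) (by positivity)

lemma tendsto_pathCount_div {κ : Type*} (A : Finset κ) {S : ℕ → κ → ℤ} {Y : κ → ℝ}
    (hS : ∀ k ∈ A, Tendsto (fun n : ℕ => (S n k : ℝ) / n) atTop (𝓝 (Y k))) :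
    Tendsto (fun n : ℕ => (pathCount n A (S n) : ℝ) / n) atTop (𝓝 (pathIntegral A Y)) := by
  classical
  let Q : ℕ → (Unit → ℤ) → Prop := fun n x =>
    (0 ≤ x () ∧ x () < n) ∧ ∀ k ∈ A, 0 ≤ x () + S n k ∧ x () + S n k < n
  let R : ℝ → Prop := fun r =>
    r ∈ Set.Icc (0 : ℝ) 1 ∧ ∀ k ∈ A, r + Y k ∈ Set.Icc (0 : ℝ) 1
  have hcount : ∀ n : ℕ, (∑ x ∈ Fintype.piFinset (fun _ : Unit => Finset.Icc (-(n : ℤ)) n),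
      if Q n x then (1 : ℝ) else 0) = pathCount n A (S n) := by
    intro n
    rw [Finset.sum_boole, pathCount]
    congr 1
    refine Finset.card_nbij' (fun x => (x ()).toNat) (fun u _ => (u : ℤ)) ?_ ?_ ?_ ?_
    · intro x hx
      simp only [Q, Finset.mem_coe, Finset.mem_filter, Finset.mem_range] at hx ⊢
      refine ⟨by omega, fun k hk => ?_⟩
      rw [Int.toNat_of_nonneg hx.2.1.1]
      exact hx.2.2 k hk
    · intro u hu
      simp only [Q, Finset.mem_coe, Finset.mem_filter, Finset.mem_range, Fintype.mem_piFinset,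
        Finset.mem_Icc] at hu ⊢
      exact ⟨fun _ => by omega, by omega, hu.2⟩
    · intro x hx
      simp only [Q, Finset.mem_coe, Finset.mem_filter] at hx
      funext i
      exact Int.toNat_of_nonneg hx.2.1.1
    · intro u _
      simp
  have hint : pathIntegral A Y = ∫ z : Unit → ℝ, if R (z ()) then (1 : ℝ) else 0 := by
    have h1 := (volume_preserving_funUnique Unit ℝ).integral_comp'
      (g := fun r => if R r then (1 : ℝ) else 0)
    simp only [MeasurableEquiv.funUnique_apply] at h1
    change _ = ∫ z : Unit → ℝ, if R (z default) then (1 : ℝ) else 0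
    rw [h1, pathIntegral, ← integral_indicator measurableSet_Icc]
    refine integral_congr_ae (Eventually.of_forall fun r => ?_)
    simp only [Set.indicator_apply, R, ind01_eq_ite, Finset.prod_boole]
    split_ifs <;> first | rfl | tauto
  have hr := tendsto_riemann_sum (ι := Unit) (b := fun n : ℕ => (n : ℝ)) (t := 1) (C := 1)
    (K := fun n => (n : ℤ)) (G := fun n x => if Q n x then 1 else 0)
    (g := fun z => if R (z ()) then 1 else 0) tendsto_natCast_atTop_atTop (fun n => by simp)
    (fun n x => by split_ifs <;> simp) ?_ ?_
  · rw [hint]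
    refine hr.congr fun n => ?_
    rw [hcount]
    simp
  · intro n x hx V
    simp only [ne_eq, ite_eq_right_iff, one_ne_zero, imp_false, not_not, Q] at hx
    simp only [mul_one, Int.floor_natCast, abs_le]
    have hV : x V = x () := rfl
    omega
  · have hae : ∀ r : ℝ, ∀ᵐ z : Unit → ℝ, z () ≠ r := by
      intro r
      filter_upwards [ae_linear_ne (ι := Unit) (c := fun _ => 1)
        (by intro h; simpa using congrFun h ()) r] with z hz
      simpa using hz
    have hae2 : ∀ᵐ z : Unit → ℝ, ∀ k ∈ A, z () + Y k ≠ 0 ∧ z () + Y k ≠ 1 := by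
      rw [Finset.eventually_all]
      intro k _
      filter_upwards [hae (-Y k), hae (1 - Y k)] with z h1 h2
      exact ⟨fun h => h1 (by linarith), fun h => h2 (by linarith)⟩
    filter_upwards [hae 0, hae 1, hae2] with z h0 h1 h2
    have hz := tendsto_floor_mul_div (b := fun n : ℕ => (n : ℝ)) tendsto_natCast_atTop_atTop (z ())
    have e1 := eventually_interval_iff hz h0 h1
    have e2 : ∀ᶠ n : ℕ in atTop, ∀ k ∈ A, ((0 ≤ ⌊(n : ℝ) * z ()⌋ + S n k ∧
        ⌊(n : ℝ) * z ()⌋ + S n k < n) ↔ z () + Y k ∈ Set.Icc (0 : ℝ) 1) := by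
      rw [Finset.eventually_all]
      intro k hk
      refine eventually_interval_iff (y := fun n => ⌊(n : ℝ) * z ()⌋ + S n k) ?_
        (h2 k hk).1 (h2 k hk).2
      refine (hz.add (hS k hk)).congr fun n => ?_
      push_cast
      ring
    refine tendsto_const_nhds.congr' ?_
    filter_upwards [e1, e2] with n hn1 hn2
    have : R (z ()) ↔ Q n fun V => ⌊(n : ℝ) * z V⌋ := by
      simp only [R, Q, hn1]
      exact and_congr_right fun _ => forall₂_congr fun k hk => (hn2 k hk).symm
    simp only [this]

section Fubini

variable {X : Type*} [MeasurableSpace X]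

lemma integral_integral_integral_mul (ν : Measure X) [IsFiniteMeasure ν] {f g : X → ℝ → ℝ}
    (hf : Measurable (Function.uncurry f)) (hg : Measurable (Function.uncurry g))
    (hf1 : ∀ x r, |f x r| ≤ 1) (hg1 : ∀ x r, |g x r| ≤ 1) :
    ∫ r in Set.Icc (0 : ℝ) 1, ∫ s in Set.Icc (0 : ℝ) 1, ∫ x, f x r * g x s ∂ν =
      ∫ x, (∫ r in Set.Icc (0 : ℝ) 1, f x r) * (∫ s in Set.Icc (0 : ℝ) 1, g x s) ∂ν := by
  have hG : Measurable fun x => ∫ s in Set.Icc (0 : ℝ) 1, g x s :=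
    (hg.stronglyMeasurable.integral_prod_right (ν := volume.restrict (Set.Icc (0 : ℝ) 1))).measurable
  have hG1 : ∀ x, |∫ s in Set.Icc (0 : ℝ) 1, g x s| ≤ 1 := by
    intro x
    have := norm_setIntegral_le_of_norm_le_const (μ := volume) (s := Set.Icc (0 : ℝ) 1) (C := 1)
      (f := fun s => g x s) (by simp) (fun s _ => hg1 x s)
    simpa using this
  have step : ∀ r, ∫ s in Set.Icc (0 : ℝ) 1, ∫ x, f x r * g x s ∂ν =
      ∫ x, f x r * (∫ s in Set.Icc (0 : ℝ) 1, g x s) ∂ν := by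
    intro r
    rw [integral_integral_swap]
    · simp only [integral_const_mul]
    · refine Integrable.of_bound (C := 1) ?_ (Eventually.of_forall fun y => ?_)
      · refine Measurable.aestronglyMeasurable (Measurable.mul ?_ ?_)
        · exact hf.comp (measurable_snd.prodMk measurable_const)
        · exact hg.comp (measurable_snd.prodMk measurable_fst)
      · rw [Function.uncurry, norm_mul]
        exact mul_le_one₀ (hf1 _ _) (norm_nonneg _) (hg1 _ _)
  simp only [step]
  rw [integral_integral_swap]
  · simp only [integral_mul_const]
  · refine Integrable.of_bound (C := 1) ?_ (Eventually.of_forall fun y => ?_)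
    · refine Measurable.aestronglyMeasurable (Measurable.mul ?_ ?_)
      · exact hf.comp (measurable_snd.prodMk measurable_fst)
      · exact hG.comp measurable_snd
    · rw [Function.uncurry, norm_mul]
      exact mul_le_one₀ (hf1 _ _) (norm_nonneg _) (hG1 _)

variable {p q : ℕ}

lemma weight_eq (b σ : ℝ) (y : Fin (p + q) → ℝ) (r s : ℝ) :
    weight p b σ y r s = (∏ j ∈ firstHalf p q, ind01 (r + b * sumFst y j)) *
      ∏ j ∈ secondHalf p q, ind01 (s + σ * b * sumSnd p y j) := rfl

lemma integral_weight (ν : Measure X) [IsFiniteMeasure ν] (b σ : ℝ) {y : X → Fin (p + q) → ℝ}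
    (hy : ∀ i, Measurable fun x => y x i) :
    ∫ r in Set.Icc (0 : ℝ) 1, ∫ s in Set.Icc (0 : ℝ) 1, ∫ x, weight p b σ (y x) r s ∂ν =
      ∫ x, pathIntegral (firstHalf p q) (fun j => b * sumFst (y x) j) *
        pathIntegral (secondHalf p q) (fun j => σ * b * sumSnd p (y x) j) ∂ν := by
  simp only [weight_eq, pathIntegral]
  refine integral_integral_integral_mul ν
    (f := fun x r => ∏ j ∈ firstHalf p q, ind01 (r + b * sumFst (y x) j))
    (g := fun x s => ∏ j ∈ secondHalf p q, ind01 (s + σ * b * sumSnd p (y x) j)) ?_ ?_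
    (fun x r => abs_prod_ind01_le_one _ _) (fun x r => abs_prod_ind01_le_one _ _)
  · refine Finset.measurable_prod _ fun j _ => measurable_ind01.comp ?_
    refine measurable_snd.add (measurable_const.mul ?_)
    exact (Finset.measurable_sum _ fun i _ => hy i).comp measurable_fst
  · refine Finset.measurable_prod _ fun j _ => measurable_ind01.comp ?_
    refine measurable_snd.add (measurable_const.mul ?_)
    exact (Finset.measurable_sum _ fun i _ => hy i).comp measurable_fst

end Fubini

end BandToeplitz

namespace BandToeplitz

section Coefficients

variable {p q : ℕ} {π : Part (p + q)}

/-- The coefficients of the sum of the first `p` steps in the block variables. -/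
def coeffFst (p : ℕ) {q : ℕ} {π : Part (p + q)} (s : Fin (p + q) → ℤˣ) (V : Blocks π) : ℤ :=
  ∑ i ∈ V.1, if i.val < p then (s i : ℤ) else 0

/-- The coefficients of the sum of the last `q` steps in the block variables. -/
def coeffSnd (p : ℕ) {q : ℕ} {π : Part (p + q)} (s : Fin (p + q) → ℤˣ) (V : Blocks π) : ℤ :=
  ∑ i ∈ V.1, if p ≤ i.val then (s i : ℤ) else 0

lemma sum_eq_sum_blocks {N : ℕ} {M : Type*} [AddCommMonoid M] (π : Part N) (f : Fin N → M) :
    ∑ i, f i = ∑ V : Blocks π, ∑ i ∈ V.1, f i := by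
  rw [← Finset.sum_fiberwise Finset.univ (blockOf π)]
  refine Finset.sum_congr rfl fun V _ => Finset.sum_congr ?_ fun _ _ => rfl
  ext i
  simp [blockOf_eq_iff]

lemma sum_firstHalf_steps (s : Fin (p + q) → ℤˣ) (x : Blocks π → ℤ) :
    ∑ i ∈ firstHalf p q, steps π s x i = ∑ V, coeffFst p s V * x V := by
  rw [firstHalf, Finset.sum_filter, sum_eq_sum_blocks π]
  refine Finset.sum_congr rfl fun V _ => ?_
  rw [coeffFst, Finset.sum_mul]
  refine Finset.sum_congr rfl fun i hi => ?_
  rw [steps, blockOf_eq_iff.2 hi, ite_mul, zero_mul]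

lemma sum_secondHalf_steps (s : Fin (p + q) → ℤˣ) (x : Blocks π → ℤ) :
    ∑ i ∈ secondHalf p q, steps π s x i = ∑ V, coeffSnd p s V * x V := by
  rw [secondHalf, Finset.sum_filter, sum_eq_sum_blocks π]
  refine Finset.sum_congr rfl fun V _ => ?_
  rw [coeffSnd, Finset.sum_mul]
  refine Finset.sum_congr rfl fun i hi => ?_
  rw [steps, blockOf_eq_iff.2 hi, ite_mul, zero_mul]

end Coefficients

open Classical in
/-- The bound on the variable of the block `V`. -/
noncomputable def blockBound (p : ℕ) {q : ℕ} {π : Part (p + q)} (t₁ t₂ : ℝ) (V : Blocks π) : ℝ :=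
  if ∃ i ∈ V.1, i.val < p then t₁ else t₂

lemma mem_box_iff {p q : ℕ} {π : Part (p + q)} {t₁ t₂ : ℝ} {w : Blocks π → ℝ} :
    w ∈ box p π t₁ t₂ ↔ ∀ V, |w V| ≤ blockBound p t₁ t₂ V := by
  refine forall_congr' fun V => ?_
  rw [blockBound, abs_le]
  split_ifs <;> rfl

open Classical in
/-- The normalised contribution of the block variables `x` to the covariance. -/
noncomputable def blockTerm {Ω : Type*} [MeasurableSpace Ω] (μ : Measure Ω) (a : ℤ → Ω → ℝ)
    (bn : ℕ → ℝ) (t₁ t₂ : ℝ) (p : ℕ) {q : ℕ} (π : Part (p + q)) (s : Fin (p + q) → ℤˣ) (n : ℕ)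
    (x : Blocks π → ℤ) : ℝ :=
  if Admissible x then summand μ a p n ⌊bn n * t₁⌋ ⌊bn n * t₂⌋ (steps π s x) / (n : ℝ) ^ 2 else 0

section BlockTerm

variable {Ω : Type*} [MeasurableSpace Ω] {μ : Measure Ω} [IsProbabilityMeasure μ]
  {a : ℤ → Ω → ℝ} {κ : ℝ} {p q : ℕ} {bn : ℕ → ℝ} {t₁ t₂ : ℝ} {π : Part (p + q)}
  {s : Fin (p + q) → ℤˣ}

lemma abs_summand_le (n : ℕ) (m₁ m₂ : ℤ) (J : Fin (p + q) → ℤ) :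
    |summand μ a p n m₁ m₂ J / (n : ℝ) ^ 2| ≤ |covar μ a p J| := by
  rw [summand]
  split_ifs with h
  · have e : (pathCount n (firstHalf p q) (sumFst J) : ℝ) *
        pathCount n (secondHalf p q) (sumSnd p J) * covar μ a p J / (n : ℝ) ^ 2 =
        ((pathCount n (firstHalf p q) (sumFst J) : ℝ) / n) *
        ((pathCount n (secondHalf p q) (sumSnd p J) : ℝ) / n) * covar μ a p J := by ring
    rw [e, abs_mul]
    refine mul_le_of_le_one_left (abs_nonneg _) ?_
    rw [abs_of_nonneg (by positivity)]
    exact mul_le_one₀ (pathCount_div_le_one _ _ _) (by positivity) (pathCount_div_le_one _ _ _)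
  · simp

lemma exists_blockTerm_bound (h : IsEntrySequence μ a κ) (bn : ℕ → ℝ) (t₁ t₂ : ℝ)
    (π : Part (p + q)) (s : Fin (p + q) → ℤˣ) :
    ∃ C, ∀ n x, |blockTerm μ a bn t₁ t₂ p π s n x| ≤ C := by
  obtain ⟨C, hC⟩ := exists_covar_bound h (p := p) (q := q) (blockOf π)
  refine ⟨max C 0, fun n x => ?_⟩
  rw [blockTerm]
  split_ifs with hx
  · exact (abs_summand_le _ _ _ _).trans ((hC s x hx.1 hx.2).trans (le_max_left _ _))
  · simp

lemma blockTerm_ne_zero {n : ℕ} {x : Blocks π → ℤ} (h : blockTerm μ a bn t₁ t₂ p π s n x ≠ 0) :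
    Admissible x ∧ ∑ V, coeffFst p s V * x V = 0 ∧ ∑ V, coeffSnd p s V * x V = 0 ∧
      (∀ i, |steps π s x i| ≤ if i.val < p then ⌊bn n * t₁⌋ else ⌊bn n * t₂⌋) ∧
      covar μ a p (steps π s x) ≠ 0 := by
  rw [blockTerm] at h
  split_ifs at h with h1
  · rw [summand] at h
    split_ifs at h with h2
    · rw [sum_firstHalf_steps, sum_secondHalf_steps] at h2
      refine ⟨h1, h2.1.1, h2.1.2, h2.2, fun h3 => h ?_⟩
      rw [h3, mul_zero, zero_div]
    · simp at h
  · exact absurd rfl h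

lemma blockTerm_support (ht : t₁ ≤ t₂) (ht₁ : 0 < t₁) {n : ℕ} {x : Blocks π → ℤ}
    (h : blockTerm μ a bn t₁ t₂ p π s n x ≠ 0) (V : Blocks π) : |x V| ≤ ⌊bn n * t₂⌋ := by
  have h1 := (blockTerm_ne_zero h).2.2.2.1 (blockMin V)
  rw [abs_steps, blockOf_blockMin] at h1
  rcases le_or_gt 0 (bn n) with hb | hb
  · refine h1.trans ?_
    split_ifs
    · exact Int.floor_mono (mul_le_mul_of_nonneg_left ht hb)
    · exact le_rfl
  · exfalso
    have h2 : ∀ t : ℝ, 0 < t → ⌊bn n * t⌋ < 0 := fun t h0 => by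
      rw [Int.floor_lt]
      simpa using mul_neg_of_neg_of_pos hb h0
    have h3 := abs_nonneg (x V)
    have h4 := h2 _ ht₁
    have h5 := h2 _ (ht₁.trans_le ht)
    split_ifs at h1 <;> omega

/-- The limit of `blockTerm` along block variables asymptotic to `b_n w`, up to the factor
coming from the moments. -/
noncomputable def limitTerm (p : ℕ) {q : ℕ} (b : ℝ) (t₁ t₂ : ℝ) (π : Part (p + q))
    (s : Fin (p + q) → ℤˣ) (w : Blocks π → ℝ) : ℝ :=
  (box p π t₁ t₂).indicator (fun w =>
    pathIntegral (firstHalf p q) (fun j => b * sumFst (yVar π (fun i => ((s i : ℤ) : ℝ)) w) j) *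
      pathIntegral (secondHalf p q)
        (fun j => b * sumSnd p (yVar π (fun i => ((s i : ℤ) : ℝ)) w) j)) w

lemma steps_bound_iff (ht : t₁ ≤ t₂) {n : ℕ} (hb : 0 ≤ bn n) (x : Blocks π → ℤ) :
    (∀ i, |steps π s x i| ≤ if i.val < p then ⌊bn n * t₁⌋ else ⌊bn n * t₂⌋) ↔
      ∀ V, |x V| ≤ ⌊bn n * blockBound p t₁ t₂ V⌋ := by
  have hm : ⌊bn n * t₁⌋ ≤ ⌊bn n * t₂⌋ := Int.floor_mono (mul_le_mul_of_nonneg_left ht hb)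
  constructor
  · intro h V
    rw [blockBound]
    split_ifs with hV
    · obtain ⟨i, hi, hip⟩ := hV
      have := h i
      rwa [abs_steps, blockOf_eq_iff.2 hi, if_pos hip] at this
    · have := h (blockMin V)
      rwa [abs_steps, blockOf_blockMin, if_neg fun hlt => hV ⟨_, blockMin_mem V, hlt⟩] at this
  · intro h i
    rw [abs_steps]
    have := h (blockOf π i)
    rw [blockBound] at this
    split_ifs at this with hV
    · split_ifs
      · exact this
      · exact this.trans hm
    · rw [if_neg fun hlt => hV ⟨i, mem_part_self π i, hlt⟩]
      exact this

lemma tendsto_blockTerm {b γ : ℝ} (hbn_top : Tendsto bn atTop atTop)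
    (hbn_lim : Tendsto (fun n : ℕ => bn n / n) atTop (𝓝 b)) (ht : t₁ ≤ t₂)
    (hγ : ∀ x : Blocks π → ℤ, Admissible x → covar μ a p (steps π s x) = γ)
    {x : ℕ → Blocks π → ℤ} {w : Blocks π → ℝ}
    (hx : ∀ V, Tendsto (fun n => (x n V : ℝ) / bn n) atTop (𝓝 (w V)))
    (h1 : ∀ n, ∑ V, coeffFst p s V * x n V = 0) (h2 : ∀ n, ∑ V, coeffSnd p s V * x n V = 0)
    (hw : ∀ V, w V ≠ 0) (hinj : Function.Injective fun V => |w V|)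
    (hwt : ∀ V, |w V| ≠ blockBound p t₁ t₂ V) :
    Tendsto (fun n => blockTerm μ a bn t₁ t₂ p π s n (x n)) atTop
      (𝓝 (γ * limitTerm p b t₁ t₂ π s w)) := by
  classical
  have hb0 := hbn_top.eventually_gt_atTop 0
  have hstep : ∀ i, Tendsto (fun n : ℕ => (steps π s (x n) i : ℝ) / n) atTop
      (𝓝 (b * yVar π (fun i => ((s i : ℤ) : ℝ)) w i)) := by
    intro i
    have := hbn_lim.mul ((hx (blockOf π i)).const_mul ((s i : ℤ) : ℝ))
    refine this.congr' ?_
    filter_upwards [hb0] with n hn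
    simp only [steps]
    push_cast
    field_simp
  have hfst : ∀ k, Tendsto (fun n : ℕ => ((sumFst (steps π s (x n)) k : ℤ) : ℝ) / n) atTop
      (𝓝 (b * sumFst (yVar π (fun i => ((s i : ℤ) : ℝ)) w) k)) := by
    intro k
    simp only [sumFst, Int.cast_sum, Finset.sum_div, Finset.mul_sum]
    exact tendsto_finsetSum _ fun i _ => hstep i
  have hsnd : ∀ k, Tendsto (fun n : ℕ => ((sumSnd p (steps π s (x n)) k : ℤ) : ℝ) / n) atTop
      (𝓝 (b * sumSnd p (yVar π (fun i => ((s i : ℤ) : ℝ)) w) k)) := by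
    intro k
    simp only [sumSnd, Int.cast_sum, Finset.sum_div, Finset.mul_sum]
    exact tendsto_finsetSum _ fun i _ => hstep i
  have hpc := (tendsto_pathCount_div (firstHalf p q) fun k _ => hfst k).mul
    (tendsto_pathCount_div (secondHalf p q) fun k _ => hsnd k)
  have hbox : ∀ᶠ n in atTop, ∀ V, (|x n V| ≤ ⌊bn n * blockBound p t₁ t₂ V⌋ ↔
      |w V| ≤ blockBound p t₁ t₂ V) :=
    eventually_all.2 fun V => eventually_abs_le_floor_iff hbn_top (hx V) (hwt V)
  have hadm := eventually_admissible hx hw hinj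
  by_cases hmem : w ∈ box p π t₁ t₂
  · rw [limitTerm, Set.indicator_of_mem hmem]
    refine (hpc.const_mul γ).congr' ?_
    filter_upwards [hbox, hadm, hb0] with n hn1 hn2 hn3
    have hc : ∀ i, |steps π s (x n) i| ≤ if i.val < p then ⌊bn n * t₁⌋ else ⌊bn n * t₂⌋ := by
      rw [steps_bound_iff ht hn3.le]
      exact fun V => (hn1 V).2 (mem_box_iff.1 hmem V)
    rw [blockTerm, if_pos hn2, summand, sum_firstHalf_steps, sum_secondHalf_steps,
      if_pos ⟨⟨h1 n, h2 n⟩, hc⟩, hγ _ hn2]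
    ring
  · rw [limitTerm, Set.indicator_of_notMem hmem, mul_zero]
    refine tendsto_const_nhds.congr' ?_
    filter_upwards [hbox, hb0] with n hn1 hn3
    symm
    by_contra hne
    apply hmem
    have := (blockTerm_ne_zero hne).2.2.2.1
    rw [steps_bound_iff ht hn3.le] at this
    exact mem_box_iff.2 fun V => (hn1 V).1 (this V)

end BlockTerm

end BandToeplitz

namespace BandToeplitz

section Eliminate

variable {ι : Type*} [Fintype ι] [DecidableEq ι]

/-- Solve the equation `∑ i, c i * x i = 0` with `c k = 1` for the variable `x k`. -/
def eliminate {R : Type*} [CommRing R] (c : ι → R) (k : ι) (z : {i : ι // i ≠ k} → R) (i : ι) : R :=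
  if hi : i = k then -(∑ j : {i : ι // i ≠ k}, c j.1 * z j) else z ⟨i, hi⟩

variable {R : Type*} [CommRing R] {c : ι → R} {k : ι}

lemma eliminate_self (z : {i : ι // i ≠ k} → R) :
    eliminate c k z k = -(∑ j : {i : ι // i ≠ k}, c j.1 * z j) := by simp [eliminate]

lemma eliminate_of_ne (z : {i : ι // i ≠ k} → R) (j : {i : ι // i ≠ k}) :
    eliminate c k z j.1 = z j := by simp [eliminate, j.2]

lemma sum_eq_add_sum_ne (k : ι) (f : ι → R) : ∑ i, f i = f k + ∑ j : {i : ι // i ≠ k}, f j.1 := by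
  rw [← Finset.add_sum_erase _ _ (Finset.mem_univ k)]
  congr 1
  refine Finset.sum_subtype _ (fun i => ?_) f
  simp

lemma sum_mul_eliminate (d : ι → R) (z : {i : ι // i ≠ k} → R) :
    ∑ i, d i * eliminate c k z i = ∑ j : {i : ι // i ≠ k}, (d j.1 - d k * c j.1) * z j := by
  rw [sum_eq_add_sum_ne k, eliminate_self]
  simp only [eliminate_of_ne, sub_mul, Finset.sum_sub_distrib, mul_neg, Finset.mul_sum, mul_assoc]
  ring

lemma sum_mul_eliminate_self (hc : c k = 1) (z : {i : ι // i ≠ k} → R) :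
    ∑ i, c i * eliminate c k z i = 0 := by
  rw [sum_mul_eliminate]
  simp [hc]

lemma eliminate_restrict (hc : c k = 1) {x : ι → R} (hx : ∑ i, c i * x i = 0) :
    eliminate c k (fun j => x j.1) = x := by
  funext i
  by_cases hi : i = k
  · subst hi
    rw [eliminate_self]
    rw [sum_eq_add_sum_ne i, hc, one_mul] at hx
    exact (eq_neg_of_add_eq_zero_left hx).symm
  · exact eliminate_of_ne _ ⟨i, hi⟩

lemma eliminate_eq_sum (c : ι → R) (k : ι) (z : {i : ι // i ≠ k} → R) (i : ι) :
    eliminate c k z i = ∑ j, (if i = k then -c j.1 else if i = j.1 then 1 else 0) * z j := by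
  by_cases hi : i = k
  · subst hi
    simp [eliminate_self]
  · rw [eliminate_of_ne _ ⟨i, hi⟩]
    simp only [hi, if_false]
    rw [Finset.sum_eq_single_of_mem ⟨i, hi⟩ (Finset.mem_univ _)]
    · simp
    · intro j _ hj
      rw [if_neg fun h => hj (Subtype.ext h.symm), zero_mul]

lemma intCast_eliminate (c : ι → ℤ) (k : ι) (z : {i : ι // i ≠ k} → ℤ) (i : ι) :
    ((eliminate c k z i : ℤ) : ℝ) = eliminate (fun i => (c i : ℝ)) k (fun j => (z j : ℝ)) i := by
  simp only [eliminate]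
  split_ifs <;> simp

lemma sum_box_eq_sum_eliminate {K : ℤ} {G : (ι → ℤ) → ℝ} {c : ι → ℤ} {k : ι} (hc : c k = 1)
    (hG : ∀ x, G x ≠ 0 → ∑ i, c i * x i = 0)
    (hK : ∀ x, G x ≠ 0 → ∀ i, |x i| ≤ K) :
    ∑ x ∈ Fintype.piFinset (fun _ : ι => Finset.Icc (-K) K), G x =
      ∑ z ∈ Fintype.piFinset (fun _ : {i : ι // i ≠ k} => Finset.Icc (-K) K),
        G (eliminate c k z) := by
  classical
  rw [← Finset.sum_filter_ne_zero,
    ← Finset.sum_filter_ne_zero (f := fun z : {i : ι // i ≠ k} → ℤ => G (eliminate c k z))]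
  refine Finset.sum_nbij' (fun x j => x j.1) (fun z => eliminate c k z) ?_ ?_ ?_ ?_ ?_
  · intro x hx
    simp only [Finset.mem_filter, Fintype.mem_piFinset] at hx ⊢
    rw [eliminate_restrict hc (hG x hx.2)]
    exact ⟨fun j => hx.1 _, hx.2⟩
  · intro z hz
    simp only [Finset.mem_filter, Fintype.mem_piFinset] at hz ⊢
    refine ⟨fun i => ?_, hz.2⟩
    rw [Finset.mem_Icc, ← abs_le]
    exact hK _ hz.2 i
  · intro x hx
    exact eliminate_restrict hc (hG x (Finset.mem_filter.1 hx).2)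
  · intro z _
    funext j
    exact eliminate_of_ne _ _
  · intro x hx
    rw [eliminate_restrict hc (hG x (Finset.mem_filter.1 hx).2)]

lemma tendsto_eliminate_floor {b : ℕ → ℝ} (hb : Tendsto b atTop atTop) (c : ι → ℤ) (k : ι)
    (z : {i : ι // i ≠ k} → ℝ) (i : ι) :
    Tendsto (fun n => ((eliminate c k (fun j => ⌊b n * z j⌋) i : ℤ) : ℝ) / b n) atTop
      (𝓝 (eliminate (fun i => (c i : ℝ)) k z i)) := by
  simp only [intCast_eliminate]
  simp only [eliminate_eq_sum, Finset.sum_div, mul_div_assoc]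
  exact tendsto_finsetSum _ fun j _ => (tendsto_floor_mul_div hb (z j)).const_mul _

lemma card_box {K : ℤ} (hK : 0 ≤ K) (ι : Type*) [Fintype ι] [DecidableEq ι] :
    ((Fintype.piFinset (fun _ : ι => Finset.Icc (-K) K)).card : ℝ) =
      (2 * (K : ℝ) + 1) ^ Fintype.card ι := by
  rw [Fintype.card_piFinset, Finset.prod_const, Finset.card_univ, Int.card_Icc]
  push_cast
  congr 1
  have : (((K + 1 - -K).toNat : ℤ) : ℝ) = ((2 * K + 1 : ℤ) : ℝ) := by
    congr 1; omega
  push_cast at this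
  exact this

lemma card_box_filter_le {K : ℤ} (hK : 0 ≤ K) {c : ι → ℤ} {k : ι} (hc : c k ≠ 0) :
    (((Fintype.piFinset (fun _ : ι => Finset.Icc (-K) K)).filter
      fun x => ∑ i, c i * x i = 0).card : ℝ) ≤ (2 * (K : ℝ) + 1) ^ (Fintype.card ι - 1) := by
  have h1 : Fintype.card ι - 1 = Fintype.card {i : ι // i ≠ k} := by
    rw [Fintype.card_subtype_compl, Fintype.card_subtype_eq]
  rw [h1, ← card_box hK]
  norm_cast
  refine Finset.card_le_card_of_injOn (fun x j => x j.1) ?_ ?_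
  · intro x hx
    simp only [Finset.mem_coe, Finset.mem_filter, Fintype.mem_piFinset] at hx ⊢
    exact fun j => hx.1 _
  · intro x hx y hy hxy
    simp only [Finset.mem_coe, Finset.mem_filter] at hx hy
    have hne : ∀ i, i ≠ k → x i = y i := fun i hi => congrFun hxy ⟨i, hi⟩
    have e1 := hx.2
    have e2 := hy.2
    rw [sum_eq_add_sum_ne k] at e1 e2
    have e3 : ∑ j : {i : ι // i ≠ k}, c j.1 * x j.1 = ∑ j : {i : ι // i ≠ k}, c j.1 * y j.1 :=
      Finset.sum_congr rfl fun j _ => by rw [hne j.1 j.2]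
    funext i
    by_cases hi : i = k
    · subst hi
      exact mul_left_cancel₀ hc (by linarith)
    · exact hne i hi

lemma deltaMeasure_eq_map {c : ι → ℝ} (h : ∃ k, c k ≠ 0) (h1 : ∀ k, c k ≠ 0 → c k = 1) :
    ∃ k, c k = 1 ∧ deltaMeasure c = Measure.map (eliminate c k) volume := by
  refine ⟨h.choose, h1 _ h.choose_spec, ?_⟩
  rw [deltaMeasure, dif_pos h]
  have h2 := h1 _ h.choose_spec
  simp only [h2, abs_one, div_one, ENNReal.ofReal_one, one_smul]
  rfl

end Eliminate

lemma ae_generic {ι ι' : Type*} [Finite ι] [Fintype ι'] {A : ι → ι' → ℝ} (h0 : ∀ V, A V ≠ 0)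
    (h1 : ∀ V W, V ≠ W → A V + A W ≠ 0 ∧ A V - A W ≠ 0) (τ : ι → ℝ) :
    ∀ᵐ z : ι' → ℝ, (∀ V, ∑ j, A V j * z j ≠ 0) ∧
      (Function.Injective fun V => |∑ j, A V j * z j|) ∧ ∀ V, |∑ j, A V j * z j| ≠ τ V := by
  have e1 : ∀ᵐ z : ι' → ℝ, ∀ V, ∑ j, A V j * z j ≠ 0 := ae_all_iff.2 fun V => ae_linear_ne (h0 V) 0
  have e2 : ∀ᵐ z : ι' → ℝ, ∀ V W, V ≠ W →
      ∑ j, (A V + A W) j * z j ≠ 0 ∧ ∑ j, (A V - A W) j * z j ≠ 0 := by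
    refine ae_all_iff.2 fun V => ae_all_iff.2 fun W => ?_
    by_cases hVW : V = W
    · exact Eventually.of_forall fun z h => absurd hVW h
    · filter_upwards [ae_linear_ne (h1 V W hVW).1 0, ae_linear_ne (h1 V W hVW).2 0] with z h2 h3 _
      exact ⟨h2, h3⟩
  have e3 : ∀ᵐ z : ι' → ℝ, ∀ V, ∑ j, A V j * z j ≠ τ V ∧ ∑ j, A V j * z j ≠ -τ V :=
    ae_all_iff.2 fun V => (ae_linear_ne (h0 V) _).and (ae_linear_ne (h0 V) _)
  filter_upwards [e1, e2, e3] with z h2 h3 h4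
  refine ⟨h2, fun V W hVW => ?_, fun V h => ?_⟩
  · by_contra hne
    have h5 := h3 V W hne
    simp only [Pi.add_apply, Pi.sub_apply, add_mul, sub_mul, Finset.sum_add_distrib,
      Finset.sum_sub_distrib] at h5
    rcases abs_eq_abs.1 hVW with h6 | h6
    · exact h5.2 (by rw [h6, sub_self])
    · exact h5.1 (by rw [h6, neg_add_cancel])
  · rcases (abs_eq ((abs_nonneg _).trans_eq h)).1 h with h5 | h5
    · exact (h4 V).1 h5
    · exact (h4 V).2 h5

/-- The power of the bandwidth in front of the sum over block variables. -/
lemma scale_eq {β : ℝ} (hβ : 0 < β) {N d : ℕ} (h : N = 2 * d + 2) :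
    √β ^ 2 * (1 / √β) ^ N = 1 / β ^ d := by
  have h1 : √β ≠ 0 := (Real.sqrt_pos.2 hβ).ne'
  rw [h, pow_add, pow_mul, div_pow, div_pow, one_pow, Real.sq_sqrt hβ.le, one_pow]
  field_simp

/-- Sums with too few free variables are negligible. -/
lemma tendsto_scale_mul_zero {bn : ℕ → ℝ} (hbn : Tendsto bn atTop atTop) {N d : ℕ}
    (h : 2 * d + 2 < N) {C : ℝ} {S : ℕ → ℝ} (hS : ∀ᶠ n in atTop, |S n| ≤ C * bn n ^ d) :
    Tendsto (fun n => √(bn n) ^ 2 * (1 / √(bn n)) ^ N * S n) atTop (𝓝 0) := by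
  have h0 : Tendsto (fun n => C * (√(bn n))⁻¹) atTop (𝓝 0) := by
    simpa using (tendsto_inv_atTop_zero.comp (Real.tendsto_sqrt_atTop.comp hbn)).const_mul C
  refine squeeze_zero_norm' ?_ h0
  filter_upwards [hS, hbn.eventually_ge_atTop 1] with n hn hb
  have hb0 : 0 < bn n := by linarith
  have hs1 : 1 ≤ √(bn n) := Real.one_le_sqrt.2 hb
  have hs0 : 0 < √(bn n) := by linarith
  have hC : 0 ≤ C * bn n ^ d := (abs_nonneg _).trans hn
  rw [norm_mul, Real.norm_eq_abs, Real.norm_eq_abs, abs_of_nonneg (by positivity)]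
  have e1 : (1 / √(bn n)) ^ N ≤ (1 / √(bn n)) ^ (2 * d + 3) :=
    pow_le_pow_of_le_one (by positivity) (by rw [div_le_one hs0]; exact hs1) (by omega)
  calc √(bn n) ^ 2 * (1 / √(bn n)) ^ N * |S n|
      ≤ √(bn n) ^ 2 * (1 / √(bn n)) ^ (2 * d + 3) * (C * bn n ^ d) := by gcongr
    _ = C * (√(bn n))⁻¹ := by
        have : bn n ^ d = √(bn n) ^ (2 * d) := by rw [pow_mul, Real.sq_sqrt hb0.le]
        rw [this, pow_add, one_div, inv_pow, inv_pow]
        field_simp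

end BandToeplitz

namespace BandToeplitz

section LimitTerm

variable {p q : ℕ} {π : Part (p + q)}

/-- The sign `σ` on the last `q` indices. -/
def twist (p : ℕ) {q : ℕ} (σ : ℤˣ) (i : Fin (p + q)) : ℤˣ := if i.val < p then 1 else σ

lemma measurableSet_box (π : Part (p + q)) (t₁ t₂ : ℝ) : MeasurableSet (box p π t₁ t₂) := by
  have : box p π t₁ t₂ = ⋂ V, {w | |w V| ≤ blockBound p t₁ t₂ V} := by
    ext w; simp [mem_box_iff]
  rw [this]
  exact MeasurableSet.iInter fun V =>
    measurableSet_le (measurable_pi_apply V).norm measurable_const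

lemma measurable_pathIntegral {X κ : Type*} [MeasurableSpace X] (A : Finset κ) {Y : X → κ → ℝ}
    (hY : ∀ k, Measurable fun x => Y x k) : Measurable fun x => pathIntegral A (Y x) := by
  have : Measurable (Function.uncurry fun (x : X) (r : ℝ) => ∏ k ∈ A, ind01 (r + Y x k)) :=
    Finset.measurable_prod _ fun k _ =>
      measurable_ind01.comp (measurable_snd.add ((hY k).comp measurable_fst))
  exact (this.stronglyMeasurable.integral_prod_right
    (ν := volume.restrict (Set.Icc (0 : ℝ) 1))).measurable

lemma measurable_yVar (s : Fin (p + q) → ℝ) (i : Fin (p + q)) :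
    Measurable fun w : Blocks π → ℝ => yVar π s w i :=
  measurable_const.mul (measurable_pi_apply _)

lemma measurable_limitTerm (b t₁ t₂ : ℝ) (s : Fin (p + q) → ℤˣ) :
    Measurable (limitTerm p b t₁ t₂ π s) := by
  refine Measurable.indicator (Measurable.mul ?_ ?_) (measurableSet_box π t₁ t₂)
  · exact measurable_pathIntegral _ fun k => measurable_const.mul
      (Finset.measurable_sum _ fun i _ => measurable_yVar _ i)
  · exact measurable_pathIntegral _ fun k => measurable_const.mul
      (Finset.measurable_sum _ fun i _ => measurable_yVar _ i)

lemma pathIntegral_congr {κ : Type*} {A : Finset κ} {Y Z : κ → ℝ} (h : ∀ k ∈ A, Y k = Z k) :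
    pathIntegral A Y = pathIntegral A Z := by
  refine integral_congr_ae (Eventually.of_forall fun r => ?_)
  exact Finset.prod_congr rfl fun k hk => by rw [h k hk]

lemma limitTerm_twist (b t₁ t₂ : ℝ) (e : Fin (p + q) → ℤˣ) (σ : ℤˣ) (w : Blocks π → ℝ) :
    limitTerm p b t₁ t₂ π (fun i => e i * twist p σ i) w =
      (box p π t₁ t₂).indicator (fun w =>
        pathIntegral (firstHalf p q)
          (fun j => b * sumFst (yVar π (fun i => ((e i : ℤ) : ℝ)) w) j) *
        pathIntegral (secondHalf p q)
          (fun j => ((σ : ℤ) : ℝ) * b * sumSnd p (yVar π (fun i => ((e i : ℤ) : ℝ)) w) j)) w := by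
  rw [limitTerm]
  congr 1
  funext w
  congr 1
  · refine pathIntegral_congr fun k hk => ?_
    congr 1
    refine Finset.sum_congr rfl fun i hi => ?_
    have hk' : k.val < p := (Finset.mem_filter.1 hk).2
    have hi' : i.val < p := lt_of_le_of_lt (Fin.le_def.1 (Finset.mem_filter.1 hi).2) hk'
    simp [yVar, twist, hi']
  · refine pathIntegral_congr fun k _ => ?_
    rw [mul_comm _ b, mul_assoc]
    congr 1
    rw [sumSnd, sumSnd, Finset.mul_sum]
    refine Finset.sum_congr rfl fun i hi => ?_
    have hi' : ¬ i.val < p := not_lt.2 (Finset.mem_filter.1 hi).2.1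
    simp only [yVar, twist, hi', if_false]
    push_cast
    ring

lemma integral_limitTerm_twist {b t₁ t₂ : ℝ} (e : Fin (p + q) → ℤˣ) (σ : ℤˣ)
    (ν : Measure (Blocks π → ℝ)) (hν : ν (box p π t₁ t₂) < ⊤) :
    ∫ w, limitTerm p b t₁ t₂ π (fun i => e i * twist p σ i) w ∂ν =
      ∫ r in Set.Icc (0 : ℝ) 1, ∫ s in Set.Icc (0 : ℝ) 1, ∫ w in box p π t₁ t₂,
        weight p b ((σ : ℤ) : ℝ) (yVar π (fun i => ((e i : ℤ) : ℝ)) w) r s ∂ν := by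
  have : IsFiniteMeasure (ν.restrict (box p π t₁ t₂)) := ⟨by simpa using hν⟩
  rw [integral_weight (ν.restrict (box p π t₁ t₂)) _ _ fun i => measurable_yVar _ i,
    ← integral_indicator (measurableSet_box π t₁ t₂)]
  exact integral_congr_ae (Eventually.of_forall fun w => limitTerm_twist b t₁ t₂ e σ w)

lemma volume_box_lt_top (π : Part (p + q)) (t₁ t₂ : ℝ) :
    volume (box p π t₁ t₂) < ⊤ := by
  have : box p π t₁ t₂ ⊆ Set.pi Set.univ
      fun V => Set.Icc (-blockBound p t₁ t₂ V) (blockBound p t₁ t₂ V) :=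
    fun w hw V _ => abs_le.1 (mem_box_iff.1 hw V)
  exact (measure_mono this).trans_lt (isCompact_univ_pi fun _ => isCompact_Icc).measure_lt_top

lemma measurable_eliminate {ι : Type*} [Fintype ι] [DecidableEq ι] (c : ι → ℝ) (k : ι) :
    Measurable (eliminate c k) := by
  refine measurable_pi_lambda _ fun i => ?_
  simp only [eliminate_eq_sum]
  exact Finset.measurable_sum _ fun j _ => measurable_const.mul (measurable_pi_apply j)

lemma map_eliminate_box_lt_top (π : Part (p + q)) (t₁ t₂ : ℝ) (c : Blocks π → ℝ) (k : Blocks π) :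
    Measure.map (eliminate c k) volume (box p π t₁ t₂) < ⊤ := by
  rw [Measure.map_apply (measurable_eliminate c k) (measurableSet_box π t₁ t₂)]
  have : eliminate c k ⁻¹' box p π t₁ t₂ ⊆ Set.pi Set.univ
      fun j : {V // V ≠ k} => Set.Icc (-blockBound p t₁ t₂ j.1) (blockBound p t₁ t₂ j.1) := by
    intro z hz j _
    have := mem_box_iff.1 hz j.1
    rw [eliminate_of_ne] at this
    exact abs_le.1 this
  exact (measure_mono this).trans_lt (isCompact_univ_pi fun _ => isCompact_Icc).measure_lt_top

end LimitTerm

section BlockSum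

variable {Ω : Type*} [MeasurableSpace Ω] {μ : Measure Ω} [IsProbabilityMeasure μ]
  {a : ℤ → Ω → ℝ} {κ : ℝ} {p q : ℕ} {bn : ℕ → ℝ} {t₁ t₂ b : ℝ} {π : Part (p + q)}
  {s : Fin (p + q) → ℤˣ}

/-- The contribution of the partition `π` with signs `s` to the covariance. -/
noncomputable def blockSum {Ω : Type*} [MeasurableSpace Ω] (μ : Measure Ω) (a : ℤ → Ω → ℝ)
    (bn : ℕ → ℝ) (t₁ t₂ : ℝ) (p : ℕ) {q : ℕ} (π : Part (p + q)) (s : Fin (p + q) → ℤˣ) (n : ℕ) :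
    ℝ :=
  √(bn n) ^ 2 * (1 / √(bn n)) ^ (p + q) *
    ∑ x ∈ Fintype.piFinset (fun _ : Blocks π => Finset.Icc (-⌊bn n * t₂⌋) ⌊bn n * t₂⌋),
      blockTerm μ a bn t₁ t₂ p π s n x

lemma blockSum_eq_zero {n : ℕ} (h : ∀ x, blockTerm μ a bn t₁ t₂ p π s n x = 0) :
    blockSum μ a bn t₁ t₂ p π s n = 0 := by
  simp [blockSum, h]

lemma two_mul_floor_add_one_le {β t : ℝ} (hβ : 1 ≤ β) :
    2 * ((⌊β * t⌋ : ℤ) : ℝ) + 1 ≤ (2 * t + 1) * β := by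
  have := Int.floor_le (β * t)
  nlinarith

lemma abs_sum_blockTerm_le {C : ℝ} {n : ℕ} {d : ℕ} (hC : ∀ x, |blockTerm μ a bn t₁ t₂ p π s n x| ≤ C)
    (hb : 1 ≤ bn n) (ht₂ : 0 < t₂) {B : Finset (Blocks π → ℤ)}
    (hB : (B.card : ℝ) ≤ (2 * ((⌊bn n * t₂⌋ : ℤ) : ℝ) + 1) ^ d) :
    |∑ x ∈ B, blockTerm μ a bn t₁ t₂ p π s n x| ≤ C * (2 * t₂ + 1) ^ d * bn n ^ d := by
  have hC0 : 0 ≤ C := (abs_nonneg _).trans (hC 0)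
  have hfl : 0 ≤ ⌊bn n * t₂⌋ := Int.floor_nonneg.2 (by positivity)
  have hfl' : (0 : ℝ) ≤ ((⌊bn n * t₂⌋ : ℤ) : ℝ) := by exact_mod_cast hfl
  calc |∑ x ∈ B, blockTerm μ a bn t₁ t₂ p π s n x|
      ≤ ∑ x ∈ B, |blockTerm μ a bn t₁ t₂ p π s n x| := Finset.abs_sum_le_sum_abs _ _
    _ ≤ ∑ x ∈ B, C := Finset.sum_le_sum fun x _ => hC x
    _ = B.card * C := by rw [Finset.sum_const, nsmul_eq_mul]
    _ ≤ ((2 * t₂ + 1) * bn n) ^ d * C := by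
        gcongr
        exact hB.trans (pow_le_pow_left₀ (by positivity) (two_mul_floor_add_one_le hb) d)
    _ = C * (2 * t₂ + 1) ^ d * bn n ^ d := by rw [mul_pow]; ring

lemma tendsto_blockSum_zero_of_card_lt (h : IsEntrySequence μ a κ)
    (hbn : Tendsto bn atTop atTop) (ht₂ : 0 < t₂)
    (hcard : 2 * Fintype.card (Blocks π) + 2 < p + q) :
    Tendsto (blockSum μ a bn t₁ t₂ p π s) atTop (𝓝 0) := by
  obtain ⟨C, hC⟩ := exists_blockTerm_bound h bn t₁ t₂ π s
  refine tendsto_scale_mul_zero (C := C * (2 * t₂ + 1) ^ Fintype.card (Blocks π)) hbn hcard ?_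
  filter_upwards [hbn.eventually_ge_atTop 1] with n hn
  refine abs_sum_blockTerm_le (hC n) hn ht₂ (card_box (Int.floor_nonneg.2 ?_) _).le
  positivity

lemma tendsto_blockSum_zero_of_constraint (h : IsEntrySequence μ a κ)
    (hbn : Tendsto bn atTop atTop) (ht₂ : 0 < t₂)
    (hcard : 2 * Fintype.card (Blocks π) < p + q) {V : Blocks π}
    (hV : coeffFst p s V ≠ 0 ∨ coeffSnd p s V ≠ 0) :
    Tendsto (blockSum μ a bn t₁ t₂ p π s) atTop (𝓝 0) := by
  obtain ⟨C, hC⟩ := exists_blockTerm_bound h bn t₁ t₂ π s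
  have hpos : 0 < Fintype.card (Blocks π) := Fintype.card_pos_iff.2 ⟨V⟩
  obtain ⟨c, hc, hc0⟩ : ∃ c : Blocks π → ℤ, c V ≠ 0 ∧
      ∀ n x, blockTerm μ a bn t₁ t₂ p π s n x ≠ 0 → ∑ i, c i * x i = 0 := by
    rcases hV with hV | hV
    · exact ⟨_, hV, fun n x hx => (blockTerm_ne_zero hx).2.1⟩
    · exact ⟨_, hV, fun n x hx => (blockTerm_ne_zero hx).2.2.1⟩
  refine tendsto_scale_mul_zero (d := Fintype.card (Blocks π) - 1)
    (C := C * (2 * t₂ + 1) ^ (Fintype.card (Blocks π) - 1)) hbn (by omega) ?_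
  filter_upwards [hbn.eventually_ge_atTop 1] with n hn
  rw [← Finset.sum_filter_of_ne fun x _ hx => hc0 n x hx]
  refine abs_sum_blockTerm_le (hC n) hn ht₂ (card_box_filter_le (Int.floor_nonneg.2 ?_) hc)
  positivity

lemma tendsto_blockSum_of_unconstrained (h : IsEntrySequence μ a κ)
    (hbn : Tendsto bn atTop atTop) (hbn_lim : Tendsto (fun n : ℕ => bn n / n) atTop (𝓝 b))
    (ht₁ : 0 < t₁) (ht : t₁ ≤ t₂) (hcard : p + q = 2 * Fintype.card (Blocks π) + 2) {γ : ℝ}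
    (hγ : ∀ x : Blocks π → ℤ, Admissible x → covar μ a p (steps π s x) = γ)
    (hc : ∀ V : Blocks π, coeffFst p s V = 0) (hd : ∀ V : Blocks π, coeffSnd p s V = 0) :
    Tendsto (blockSum μ a bn t₁ t₂ p π s) atTop (𝓝 (γ * ∫ w, limitTerm p b t₁ t₂ π s w)) := by
  obtain ⟨C, hC⟩ := exists_blockTerm_bound h bn t₁ t₂ π s
  rw [← integral_const_mul]
  have hlim : ∀ᵐ z : Blocks π → ℝ,
      Tendsto (fun n => blockTerm μ a bn t₁ t₂ p π s n fun V => ⌊bn n * z V⌋) atTop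
        (𝓝 (γ * limitTerm p b t₁ t₂ π s z)) := by
    have hg := ae_generic (A := fun V W : Blocks π => if V = W then (1 : ℝ) else 0) ?_ ?_
      (blockBound p t₁ t₂)
    · filter_upwards [hg] with z hz
      simp only [ite_mul, one_mul, zero_mul, Finset.sum_ite_eq, Finset.mem_univ, if_true] at hz
      exact tendsto_blockTerm hbn hbn_lim ht hγ (fun V => tendsto_floor_mul_div hbn (z V))
        (fun n => by simp [hc]) (fun n => by simp [hd]) hz.1 hz.2.1 hz.2.2
    · intro V h0
      simpa using congrFun h0 V
    · intro V W hVW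
      constructor
      · intro h0
        simpa [hVW.symm] using congrFun h0 V
      · intro h0
        simpa [hVW.symm] using congrFun h0 V
  refine (tendsto_riemann_sum hbn (fun n => le_rfl) hC
    (fun n x hx V => blockTerm_support ht ht₁ hx V) hlim).congr' ?_
  filter_upwards [hbn.eventually_gt_atTop 0] with n hn
  rw [blockSum, scale_eq hn hcard]
  ring

lemma tendsto_blockSum_of_eliminate (h : IsEntrySequence μ a κ)
    (hbn : Tendsto bn atTop atTop) (ht₁ : 0 < t₁) (ht : t₁ ≤ t₂)
    (hcard : p + q = 2 * Fintype.card (Blocks π)) {k : Blocks π} (hk : coeffFst p s k = 1)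
    {g : ({V : Blocks π // V ≠ k} → ℝ) → ℝ}
    (hlim : ∀ᵐ z : {V : Blocks π // V ≠ k} → ℝ,
      Tendsto (fun n => blockTerm μ a bn t₁ t₂ p π s n
        (eliminate (coeffFst p s) k fun j => ⌊bn n * z j⌋)) atTop (𝓝 (g z))) :
    Tendsto (blockSum μ a bn t₁ t₂ p π s) atTop (𝓝 (∫ z, g z)) := by
  obtain ⟨C, hC⟩ := exists_blockTerm_bound h bn t₁ t₂ π s
  have hpos : 0 < Fintype.card (Blocks π) := Fintype.card_pos_iff.2 ⟨k⟩
  have hc1 : Fintype.card {V : Blocks π // V ≠ k} = Fintype.card (Blocks π) - 1 := by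
    rw [Fintype.card_subtype_compl, Fintype.card_subtype_eq]
  refine (tendsto_riemann_sum (t := t₂) (G := fun n z => blockTerm μ a bn t₁ t₂ p π s n
    (eliminate (coeffFst p s) k z)) hbn (fun n => le_rfl) (fun n z => hC n _)
    (fun n x hx V => ?_) hlim).congr' ?_
  · rw [← eliminate_of_ne (c := coeffFst p s) x V]
    exact blockTerm_support ht ht₁ hx V.1
  · filter_upwards [hbn.eventually_gt_atTop 0] with n hn
    rw [blockSum, scale_eq hn (d := Fintype.card {V : Blocks π // V ≠ k}) (by omega),
      sum_box_eq_sum_eliminate hk (fun x hx => (blockTerm_ne_zero hx).2.1)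
        (fun x hx => blockTerm_support ht ht₁ hx)]
    ring

lemma tendsto_blockSum_zero_of_independent (h : IsEntrySequence μ a κ)
    (hbn : Tendsto bn atTop atTop) (ht₁ : 0 < t₁) (ht : t₁ ≤ t₂)
    (hcard : p + q = 2 * Fintype.card (Blocks π)) {k V : Blocks π} (hk : coeffFst p s k = 1)
    (hV : coeffSnd p s V ≠ coeffSnd p s k * coeffFst p s V) :
    Tendsto (blockSum μ a bn t₁ t₂ p π s) atTop (𝓝 0) := by
  have hVk : V ≠ k := by
    rintro rfl
    rw [hk, mul_one] at hV
    exact hV rfl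
  have := tendsto_blockSum_of_eliminate (g := fun _ => 0) h hbn ht₁ ht hcard hk ?_
  · simpa using this
  have hne : (fun j : {V : Blocks π // V ≠ k} =>
      ((coeffSnd p s j.1 - coeffSnd p s k * coeffFst p s j.1 : ℤ) : ℝ)) ≠ 0 := by
    intro h0
    have := congrFun h0 ⟨V, hVk⟩
    simp only [Pi.zero_apply, Int.cast_eq_zero] at this
    exact hV (sub_eq_zero.1 this)
  filter_upwards [ae_linear_ne hne 0] with z hz
  have ht0 : Tendsto (fun n => (∑ j : {V : Blocks π // V ≠ k},
      ((coeffSnd p s j.1 - coeffSnd p s k * coeffFst p s j.1 : ℤ) : ℝ) *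
        ((⌊bn n * z j⌋ : ℝ) / bn n))) atTop (𝓝 (∑ j : {V : Blocks π // V ≠ k},
      ((coeffSnd p s j.1 - coeffSnd p s k * coeffFst p s j.1 : ℤ) : ℝ) * z j)) :=
    tendsto_finsetSum _ fun j _ => (tendsto_floor_mul_div hbn (z j)).const_mul _
  refine tendsto_const_nhds.congr' ?_
  filter_upwards [ht0.eventually_ne hz] with n hn
  symm
  by_contra hG
  apply hn
  have h2 := (blockTerm_ne_zero hG).2.2.1
  rw [sum_mul_eliminate] at h2
  simp only [← mul_div_assoc]
  rw [← Finset.sum_div]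
  have h3 : (∑ j : {V : Blocks π // V ≠ k},
      ((coeffSnd p s j.1 - coeffSnd p s k * coeffFst p s j.1 : ℤ) : ℝ) * (⌊bn n * z j⌋ : ℝ)) = 0 := by
    exact_mod_cast h2
  rw [h3, zero_div]

lemma tendsto_blockSum_of_dependent (h : IsEntrySequence μ a κ)
    (hbn : Tendsto bn atTop atTop) (hbn_lim : Tendsto (fun n : ℕ => bn n / n) atTop (𝓝 b))
    (ht₁ : 0 < t₁) (ht : t₁ ≤ t₂) (hcard : p + q = 2 * Fintype.card (Blocks π)) {γ : ℝ}
    (hγ : ∀ x : Blocks π → ℤ, Admissible x → covar μ a p (steps π s x) = γ)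
    {k : Blocks π} (hk : coeffFst p s k = 1) {τ : ℤ}
    (hτ : ∀ V : Blocks π, coeffSnd p s V = τ * coeffFst p s V)
    (hmany : ∀ V W : Blocks π, ∃ U, U ≠ V ∧ U ≠ W ∧ coeffFst p s U ≠ 0) :
    Tendsto (blockSum μ a bn t₁ t₂ p π s) atTop
      (𝓝 (γ * ∫ w, limitTerm p b t₁ t₂ π s w
        ∂(Measure.map (eliminate (fun V => (coeffFst p s V : ℝ)) k) volume))) := by
  rw [integral_map (measurable_eliminate _ _).aemeasurable
    (measurable_limitTerm b t₁ t₂ s).aestronglyMeasurable, ← integral_const_mul]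
  refine tendsto_blockSum_of_eliminate h hbn ht₁ ht hcard hk ?_
  have hg := ae_generic (A := fun (V : Blocks π) (j : {V : Blocks π // V ≠ k}) =>
    if V = k then -(coeffFst p s j.1 : ℝ) else if V = j.1 then 1 else 0) ?_ ?_
    (blockBound p t₁ t₂)
  · filter_upwards [hg] with z hz
    simp only [← eliminate_eq_sum (fun V => (coeffFst p s V : ℝ)) k z] at hz
    refine tendsto_blockTerm hbn hbn_lim ht hγ
      (fun V => tendsto_eliminate_floor hbn _ k z V) (fun n => ?_) (fun n => ?_)
      hz.1 hz.2.1 hz.2.2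
    · exact sum_mul_eliminate_self hk _
    · simp only [hτ, mul_assoc, ← Finset.mul_sum]
      rw [sum_mul_eliminate_self hk, mul_zero]
  · intro V h0
    by_cases hV : V = k
    · obtain ⟨U, hU, -, hU0⟩ := hmany k k
      have := congrFun h0 ⟨U, hU⟩
      simp [hV] at this
      exact hU0 this
    · have := congrFun h0 ⟨V, hV⟩
      simp [hV] at this
  · intro V W hVW
    obtain ⟨j, hj1, hj2⟩ : ∃ j : {V : Blocks π // V ≠ k},
        (V = k ∧ W ≠ j.1 ∧ W ≠ k ∧ coeffFst p s j.1 ≠ 0 ∨ V ≠ k ∧ V = j.1 ∧ W ≠ k ∨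
          V ≠ k ∧ W = k ∧ V ≠ j.1 ∧ coeffFst p s j.1 ≠ 0) ∧ (V = j.1 → W ≠ j.1) := by
      by_cases hV : V = k
      · obtain ⟨U, hU, hUW, hU0⟩ := hmany k W
        exact ⟨⟨U, hU⟩, Or.inl ⟨hV, hUW.symm, fun hW => hVW (hV.trans hW.symm), hU0⟩,
          fun h1 h2 => hVW (h1.trans h2.symm)⟩
      · by_cases hW : W = k
        · obtain ⟨U, hU, hUV, hU0⟩ := hmany k V
          exact ⟨⟨U, hU⟩, Or.inr (Or.inr ⟨hV, hW, hUV.symm, hU0⟩),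
            fun h1 h2 => hVW (h1.trans h2.symm)⟩
        · exact ⟨⟨V, hV⟩, Or.inr (Or.inl ⟨hV, rfl, hW⟩), fun h1 h2 => hVW (h1.trans h2.symm)⟩
    constructor
    · intro h0
      have := congrFun h0 j
      rcases hj1 with ⟨e1, e2, e3, e4⟩ | ⟨e1, e2, e3⟩ | ⟨e1, e2, e3, e4⟩
      · simp [e1, e2, e3, e4] at this
      · simp [e3, hj2 e2, e2] at this
        simp [← e2, e1] at this
      · simp [e1, e2, e3, e4] at this
    · intro h0
      have := congrFun h0 j
      rcases hj1 with ⟨e1, e2, e3, e4⟩ | ⟨e1, e2, e3⟩ | ⟨e1, e2, e3, e4⟩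
      · simp [e1, e2, e3, e4] at this
      · simp [e3, hj2 e2, e2] at this
        simp [← e2, e1] at this
      · simp [e1, e2, e3, e4] at this

end BlockSum

end BandToeplitz

namespace BandToeplitz

section Signs

variable {p q : ℕ} {π : Part (p + q)}

open Classical in
/-- The signs `ε_π(i)`. -/
noncomputable def epsUnit {N : ℕ} (π : Part N) (i : Fin N) : ℤˣ :=
  if ∀ j ∈ π.part i, i ≤ j then 1 else -1

lemma epsSign_eq {N : ℕ} (π : Part N) : epsSign π = fun i => ((epsUnit π i : ℤ) : ℝ) := by
  funext i
  rw [epsSign, epsUnit]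
  split_ifs <;> simp

open Classical in
/-- The sign `σ` on the blocks that do not meet the first `p` indices. -/
noncomputable def flipSign (p : ℕ) {q : ℕ} {π : Part (p + q)} (σ : ℤˣ) (V : Blocks π) : ℤˣ :=
  if ∃ i ∈ V.1, i.val < p then 1 else σ

/-- The signs `e i`, with those of the crosses on the last `q` indices multiplied by `σ`. -/
noncomputable def crossSign (p : ℕ) {q : ℕ} (π : Part (p + q)) (e : Fin (p + q) → ℤˣ) (σ : ℤˣ)
    (i : Fin (p + q)) : ℤˣ :=
  e i * twist p σ i * flipSign p σ (blockOf π i)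

lemma crossSign_of_lt {e : Fin (p + q) → ℤˣ} {σ : ℤˣ} {i : Fin (p + q)} (hi : i.val < p) :
    crossSign p π e σ i = e i := by
  rw [crossSign, twist, if_pos hi, flipSign, if_pos ⟨i, mem_part_self π i, hi⟩, mul_one, mul_one]

lemma crossSign_of_cross {e : Fin (p + q) → ℤˣ} {σ : ℤˣ} {i j : Fin (p + q)} (hi : p ≤ i.val)
    (hj : j ∈ π.part i) (hjp : j.val < p) : crossSign p π e σ i = e i * σ := by
  rw [crossSign, twist, if_neg (not_lt.2 hi), flipSign, if_pos ⟨j, hj, hjp⟩, mul_one]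

lemma crossSign_of_forall_ge {e : Fin (p + q) → ℤˣ} {σ : ℤˣ} {i : Fin (p + q)}
    (h : ∀ j ∈ π.part i, p ≤ j.val) : crossSign p π e σ i = e i := by
  rw [crossSign, twist, if_neg (not_lt.2 (h i (mem_part_self π i))), flipSign, if_neg, mul_assoc,
    Int.units_mul_self, mul_one]
  rintro ⟨j, hj, hjp⟩
  exact absurd hjp (not_lt.2 (h j hj))

lemma crossSign_mem_normSigns {e : Fin (p + q) → ℤˣ} (he : e ∈ normSigns π) (σ : ℤˣ) :
    crossSign p π e σ ∈ normSigns π := by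
  classical
  simp only [normSigns, Finset.mem_filter, Finset.mem_univ, true_and] at he ⊢
  intro i hi
  by_cases hip : i.val < p
  · rw [crossSign_of_lt hip, he i hi]
  · rw [crossSign_of_forall_ge fun j hj => (not_lt.1 hip).trans (Fin.le_def.1 (hi j hj)), he i hi]

lemma crossSign_ne {e : Fin (p + q) → ℤˣ} {i j : Fin (p + q)} (hi : p ≤ i.val)
    (hj : j ∈ π.part i) (hjp : j.val < p) : crossSign p π e 1 ≠ crossSign p π e (-1) := by
  intro h
  have h1 := congrFun h i
  rw [crossSign_of_cross hi hj hjp, crossSign_of_cross hi hj hjp] at h1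
  exact absurd (mul_left_cancel h1) (by decide)

lemma epsUnit_mem_normSigns (π : Part (p + q)) : epsUnit π ∈ normSigns π := by
  classical
  simp only [normSigns, Finset.mem_filter, Finset.mem_univ, true_and]
  intro i hi
  rw [epsUnit, if_pos hi]

lemma blockSum_crossSign {Ω : Type*} [MeasurableSpace Ω] (μ : Measure Ω) (a : ℤ → Ω → ℝ)
    (bn : ℕ → ℝ) (t₁ t₂ : ℝ) (e : Fin (p + q) → ℤˣ) (σ : ℤˣ) (n : ℕ) :
    blockSum μ a bn t₁ t₂ p π (crossSign p π e σ) n =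
      blockSum μ a bn t₁ t₂ p π (fun i => e i * twist p σ i) n := by
  classical
  simp only [blockSum, blockTerm]
  rw [← Finset.sum_filter, ← Finset.sum_filter]
  congr 1
  exact sum_steps_flip _ π (fun J => summand μ a p n ⌊bn n * t₁⌋ ⌊bn n * t₂⌋ J / (n : ℝ) ^ 2)
    _ _ (flipSign p σ) fun i => rfl

lemma coeffFst_mul_block (s : Fin (p + q) → ℤˣ) (ε : Blocks π → ℤˣ) (V : Blocks π) :
    coeffFst p (fun i => s i * ε (blockOf π i)) V = coeffFst p s V * ε V := by
  rw [coeffFst, coeffFst, Finset.sum_mul]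
  refine Finset.sum_congr rfl fun i hi => ?_
  rw [blockOf_eq_iff.2 hi]
  split_ifs <;> simp

lemma coeffSnd_mul_block (s : Fin (p + q) → ℤˣ) (ε : Blocks π → ℤˣ) (V : Blocks π) :
    coeffSnd p (fun i => s i * ε (blockOf π i)) V = coeffSnd p s V * ε V := by
  rw [coeffSnd, coeffSnd, Finset.sum_mul]
  refine Finset.sum_congr rfl fun i hi => ?_
  rw [blockOf_eq_iff.2 hi]
  split_ifs <;> simp

end Signs

section Counting

variable {p q : ℕ} {π : Part (p + q)}

/-- The number of elements of a block among the first `p` indices. -/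
def cardFst (p : ℕ) {q : ℕ} {π : Part (p + q)} (V : Blocks π) : ℕ :=
  (V.1.filter fun i => i.val < p).card

/-- The number of elements of a block among the last `q` indices. -/
def cardSnd (p : ℕ) {q : ℕ} {π : Part (p + q)} (V : Blocks π) : ℕ :=
  (V.1.filter fun i => p ≤ i.val).card

lemma fiberFst_blockOf (V : Blocks π) : fiberFst p (blockOf π) V = cardFst p V := by
  rw [fiberFst, cardFst]
  congr 1
  ext i
  simp [blockOf_eq_iff, and_comm]

lemma fiberSnd_blockOf (V : Blocks π) : fiberSnd p (blockOf π) V = cardSnd p V := by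
  rw [fiberSnd, cardSnd]
  congr 1
  ext i
  simp [blockOf_eq_iff, and_comm]

lemma cardFst_add_cardSnd (V : Blocks π) : cardFst p V + cardSnd p V = V.1.card := by
  have h := Finset.card_filter_add_card_filter_not (s := V.1) fun i : Fin (p + q) => i.val < p
  simp only [not_lt] at h
  exact h

lemma isCross_iff (V : Blocks π) : IsCross p V.1 ↔ cardFst p V ≠ 0 ∧ cardSnd p V ≠ 0 := by
  simp only [IsCross, cardFst, cardSnd, Finset.card_ne_zero, Finset.filter_nonempty_iff]

lemma card_pos (V : Blocks π) : 0 < V.1.card :=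
  Finset.card_pos.2 (π.nonempty_of_mem_parts V.2)

lemma sum_card_blocks (π : Part (p + q)) : ∑ V : Blocks π, V.1.card = p + q := by
  have := sum_eq_sum_blocks π fun _ => 1
  simpa using this.symm

lemma even_card_filter_of_sum_eq_zero {N : ℕ} (A : Finset (Fin N)) (P : Fin N → Prop)
    [DecidablePred P] (s : Fin N → ℤˣ) (h : ∑ i ∈ A, (if P i then (s i : ℤ) else 0) = 0) :
    Even (A.filter P).card := by
  rw [← Finset.sum_filter] at h
  have h1 : (2 : ℤ) ∣ ∑ i ∈ A.filter P, ((s i : ℤ) - 1) := by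
    refine Finset.dvd_sum fun i _ => ?_
    rcases Int.units_eq_one_or (s i) with h | h <;> simp [h]
  rw [Finset.sum_sub_distrib, h, zero_sub, dvd_neg] at h1
  simp only [Finset.sum_const, nsmul_eq_mul, mul_one] at h1
  exact even_iff_two_dvd.2 (by exact_mod_cast h1)

lemma even_cardFst {s : Fin (p + q) → ℤˣ} {V : Blocks π} (h : coeffFst p s V = 0) :
    Even (cardFst p V) := even_card_filter_of_sum_eq_zero _ _ s h

lemma even_cardSnd {s : Fin (p + q) → ℤˣ} {V : Blocks π} (h : coeffSnd p s V = 0) :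
    Even (cardSnd p V) := even_card_filter_of_sum_eq_zero _ _ s h

open Classical in
lemma card_crosses (π : Part (p + q)) :
    (π.parts.filter fun B => IsCross p B).card =
      (Finset.univ.filter fun V : Blocks π => IsCross p V.1).card := by
  rw [← Finset.card_map (Function.Embedding.subtype _)]
  congr 1
  ext B
  simp only [Finset.mem_filter, Finset.mem_map, Finset.mem_univ, true_and,
    Function.Embedding.subtype_apply, Subtype.exists, exists_and_left, exists_prop,
    exists_eq_right_right]
  tauto

lemma blockTerm_eq_zero_of_card {Ω : Type*} [MeasurableSpace Ω] {μ : Measure Ω}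
    [IsProbabilityMeasure μ] {a : ℤ → Ω → ℝ} {κ : ℝ} (h : IsEntrySequence μ a κ) (bn : ℕ → ℝ)
    (t₁ t₂ : ℝ) (s : Fin (p + q) → ℤˣ)
    (hπ : (∃ V : Blocks π, V.1.card = 1) ∨ ∀ V : Blocks π, ¬ IsCross p V.1) (n : ℕ)
    (x : Blocks π → ℤ) : blockTerm μ a bn t₁ t₂ p π s n x = 0 := by
  by_contra hne
  obtain ⟨hx, -, -, -, hcov⟩ := blockTerm_ne_zero hne
  apply hcov
  rcases hπ with ⟨V, hV⟩ | hπ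
  · exact covar_eq_zero_of_fiber_eq_one h hx.1 hx.2 (blockOf π) s (V := V)
      (by rw [fiberFst_blockOf, fiberSnd_blockOf, cardFst_add_cardSnd, hV])
  · refine covar_eq_zero_of_no_cross h hx.1 hx.2 (blockOf π) s fun V => ?_
    have := hπ V
    rw [isCross_iff] at this
    rw [fiberFst_blockOf, fiberSnd_blockOf]
    tauto

end Counting

section Pairs

variable {p q : ℕ} {π : Part (p + q)}

lemma exists_pair {V : Blocks π} (hV : V.1.card = 2) :
    ∃ m i, m < i ∧ V.1 = {m, i} ∧ blockMin V = m := by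
  obtain ⟨m, i, hne, h⟩ := Finset.card_eq_two.1 hV
  have key : ∀ m i : Fin (p + q), m < i → V.1 = {m, i} → blockMin V = m := by
    intro m i hmi h
    have h1 := blockMin_mem V
    have h2 : blockMin V ≤ m := Finset.min'_le _ _ (by rw [h]; simp)
    rw [h] at h1
    simp only [Finset.mem_insert, Finset.mem_singleton] at h1
    rcases h1 with h1 | h1
    · exact h1
    · exact absurd (h1 ▸ h2) (not_le.2 hmi)
  rcases lt_or_gt_of_ne hne with hmi | hmi
  · exact ⟨m, i, hmi, h, key m i hmi h⟩
  · rw [Finset.pair_comm] at h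
    exact ⟨i, m, hmi, h, key i m hmi h⟩

lemma part_eq_of_mem_block {V : Blocks π} {i : Fin (p + q)} (hi : i ∈ V.1) : π.part i = V.1 :=
  π.part_eq_of_mem V.2 hi

lemma epsUnit_of_lt {i j : Fin (p + q)} (hj : j ∈ π.part i) (hji : j < i) :
    epsUnit π i = -1 := by
  rw [epsUnit, if_neg]
  exact fun h => absurd (h j hj) (not_le.2 hji)

lemma coeffFst_pair {V : Blocks π} {m i : Fin (p + q)} (hmi : m < i) (hV : V.1 = {m, i})
    (s : Fin (p + q) → ℤˣ) :
    coeffFst p s V = (if m.val < p then (s m : ℤ) else 0) + if i.val < p then (s i : ℤ) else 0 := by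
  rw [coeffFst, hV, Finset.sum_pair hmi.ne]

lemma coeffSnd_pair {V : Blocks π} {m i : Fin (p + q)} (hmi : m < i) (hV : V.1 = {m, i})
    (s : Fin (p + q) → ℤˣ) :
    coeffSnd p s V = (if p ≤ m.val then (s m : ℤ) else 0) + if p ≤ i.val then (s i : ℤ) else 0 := by
  rw [coeffSnd, hV, Finset.sum_pair hmi.ne]

lemma isCross_pair {V : Blocks π} {m i : Fin (p + q)} (hmi : m < i) (hV : V.1 = {m, i}) :
    IsCross p V.1 ↔ m.val < p ∧ p ≤ i.val := by
  rw [IsCross, hV]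
  simp only [Finset.mem_insert, Finset.mem_singleton, exists_eq_or_imp, exists_eq_left]
  have := Fin.lt_def.1 hmi
  omega

lemma coeffFst_of_isCross {s : Fin (p + q) → ℤˣ} (hs : s ∈ normSigns π) {V : Blocks π}
    (hV : V.1.card = 2) (hc : IsCross p V.1) : coeffFst p s V = 1 := by
  obtain ⟨m, i, hmi, hVmi, hmin⟩ := exists_pair hV
  rw [isCross_pair hmi hVmi] at hc
  have h1 := normSigns_blockMin hs V
  rw [hmin] at h1
  rw [coeffFst_pair hmi hVmi, if_pos hc.1, if_neg (not_lt.2 hc.2), h1]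
  simp

lemma coeffFst_eps_twist {V : Blocks π} (hV : V.1.card = 2) (σ : ℤˣ)
    [Decidable (IsCross p V.1)] :
    coeffFst p (fun i => epsUnit π i * twist p σ i) V = if IsCross p V.1 then 1 else 0 := by
  obtain ⟨m, i, hmi, hVmi, hmin⟩ := exists_pair hV
  have h1 := normSigns_blockMin (epsUnit_mem_normSigns π) V
  rw [hmin] at h1
  have h2 : epsUnit π i = -1 := epsUnit_of_lt (j := m)
    (by rw [part_eq_of_mem_block (V := V) (by simp [hVmi]), hVmi]; simp) hmi
  rw [coeffFst_pair hmi hVmi]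
  simp only [isCross_pair hmi hVmi, h1, h2, twist]
  have := Fin.lt_def.1 hmi
  by_cases c1 : m.val < p <;> by_cases c2 : i.val < p
  · simp [c1, c2, not_le.2 c2]
  · simp [c1, c2, not_lt.1 c2]
  · omega
  · simp [c1, c2]

lemma coeffSnd_eps_twist {V : Blocks π} (hV : V.1.card = 2) (σ : ℤˣ) :
    coeffSnd p (fun i => epsUnit π i * twist p σ i) V =
      -(σ : ℤ) * coeffFst p (fun i => epsUnit π i * twist p σ i) V := by
  obtain ⟨m, i, hmi, hVmi, hmin⟩ := exists_pair hV
  have h1 := normSigns_blockMin (epsUnit_mem_normSigns π) V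
  rw [hmin] at h1
  have h2 : epsUnit π i = -1 := epsUnit_of_lt (j := m)
    (by rw [part_eq_of_mem_block (V := V) (by simp [hVmi]), hVmi]; simp) hmi
  rw [coeffFst_pair hmi hVmi, coeffSnd_pair hmi hVmi]
  simp only [h1, h2, twist]
  have := Fin.lt_def.1 hmi
  by_cases c1 : m.val < p <;> by_cases c2 : i.val < p
  · simp [c1, c2, not_le.2 c1, not_le.2 c2]
  · simp [c1, c2, not_lt.1 c2, not_le.2 c1]
  · omega
  · simp [c1, c2, not_lt.1 c2, not_lt.1 c1]

lemma eq_crossSign_of_dependent {s : Fin (p + q) → ℤˣ} (hs : s ∈ normSigns π)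
    (hπ : ∀ V : Blocks π, V.1.card = 2) {τ : ℤˣ}
    (h : ∀ V : Blocks π, coeffSnd p s V = (τ : ℤ) * coeffFst p s V) :
    s = crossSign p π (epsUnit π) (-τ) := by
  funext k
  obtain ⟨m, i, hmi, hV, hmin⟩ := exists_pair (hπ (blockOf π k))
  have hk : k ∈ (blockOf π k).1 := mem_part_self π k
  have h1 := normSigns_blockMin hs (blockOf π k)
  have h2 := normSigns_blockMin (crossSign_mem_normSigns (epsUnit_mem_normSigns π) (-τ))
    (blockOf π k)
  rw [hmin] at h1 h2
  have hpart : π.part i = {m, i} := by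
    rw [part_eq_of_mem_block (V := blockOf π k) (by simp [hV]), hV]
  have he : epsUnit π i = -1 := epsUnit_of_lt (j := m) (by rw [hpart]; simp) hmi
  have h3 := h (blockOf π k)
  rw [coeffFst_pair hmi hV, coeffSnd_pair hmi hV, h1] at h3
  rw [hV] at hk
  simp only [Finset.mem_insert, Finset.mem_singleton] at hk
  have hlt := Fin.lt_def.1 hmi
  rcases hk with rfl | rfl
  · rw [h1, h2]
  · by_cases c1 : m.val < p <;> by_cases c2 : k.val < p
    · rw [crossSign_of_lt c2, he]
      simp only [c1, c2, not_le.2 c1, not_le.2 c2, if_true, if_false] at h3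
      rcases Int.units_eq_one_or (s k) with h4 | h4
      · rw [h4] at h3
        rcases Int.units_eq_one_or τ with h5 | h5 <;> simp [h5] at h3
      · exact h4
    · rw [crossSign_of_cross (j := m) (not_lt.1 c2) (by rw [hpart]; simp) c1, he]
      simp only [c1, c2, not_le.2 c1, not_lt.1 c2, if_true, if_false] at h3
      ext
      simpa using h3
    · omega
    · rw [crossSign_of_forall_ge, he]
      · simp only [c1, c2, not_lt.1 c1, not_lt.1 c2, if_true, if_false] at h3
        rcases Int.units_eq_one_or (s k) with h4 | h4
        · simp [h4] at h3
        · exact h4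
      · rw [hpart]
        intro j hj
        simp only [Finset.mem_insert, Finset.mem_singleton] at hj
        rcases hj with rfl | rfl
        · exact not_lt.1 c1
        · exact not_lt.1 c2

end Pairs

end BandToeplitz

namespace BandToeplitz

section PairLimit

variable {Ω : Type*} [MeasurableSpace Ω] {μ : Measure Ω} [IsProbabilityMeasure μ]
  {a : ℤ → Ω → ℝ} {κ : ℝ} {p q : ℕ} {bn : ℕ → ℝ} {t₁ t₂ b : ℝ} {π : Part (p + q)}
  {s : Fin (p + q) → ℤˣ}

lemma card_blocks_of_pairs (hπ : ∀ V : Blocks π, V.1.card = 2) :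
    p + q = 2 * Fintype.card (Blocks π) := by
  have h := sum_card_blocks π
  rw [Finset.sum_congr rfl fun V _ => hπ V, Finset.sum_const, smul_eq_mul, mul_comm] at h
  exact h.symm

lemma covar_pairs (h : IsEntrySequence μ a κ) (hπ : ∀ V : Blocks π, V.1.card = 2) {k : Blocks π}
    (hk : IsCross p k.1) (x : Blocks π → ℤ) (hx : Admissible x) :
    covar μ a p (steps π s x) = 1 := by
  refine covar_eq_one h hx.1 hx.2 (blockOf π) s (fun V => ?_) (V := k) ?_
  · rw [fiberFst_blockOf, fiberSnd_blockOf, cardFst_add_cardSnd, hπ]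
  · rw [isCross_iff] at hk
    have := cardFst_add_cardSnd k
    rw [hπ k] at this
    rw [fiberFst_blockOf]
    omega

lemma typeI_eq {k : Blocks π} (σ : ℤˣ)
    (hk : deltaMeasure (firstSumCoeff p π) =
      Measure.map (eliminate (firstSumCoeff p π) k) volume) :
    typeI p b ((σ : ℤ) : ℝ) π t₁ t₂ =
      ∫ w, limitTerm p b t₁ t₂ π (fun i => epsUnit π i * twist p σ i) w
        ∂(Measure.map (eliminate (firstSumCoeff p π) k) volume) := by
  rw [integral_limitTerm_twist _ _ _ (map_eliminate_box_lt_top π t₁ t₂ _ k), typeI, hk, epsSign_eq]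

open Classical in
lemma firstSumCoeff_eq (π : Part (p + q)) (σ : ℤˣ) :
    firstSumCoeff p π =
      fun V => (coeffFst p (fun i => epsUnit π i * twist p σ i) V : ℝ) := by
  funext V
  rw [firstSumCoeff, coeffFst, Finset.sum_filter, epsSign_eq]
  push_cast
  refine Finset.sum_congr rfl fun i _ => ?_
  split_ifs with hi
  · simp [twist, hi]
  · simp

lemma tendsto_blockSum_pairs (h : IsEntrySequence μ a κ)
    (hbn : Tendsto bn atTop atTop) (hbn_lim : Tendsto (fun n : ℕ => bn n / n) atTop (𝓝 b))
    (ht₁ : 0 < t₁) (ht : t₁ ≤ t₂) (hπ : π ∈ pairPartitions p q) (σ : ℤˣ) :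
    Tendsto (blockSum μ a bn t₁ t₂ p π (crossSign p π (epsUnit π) σ)) atTop
      (𝓝 (typeI p b ((σ : ℤ) : ℝ) π t₁ t₂)) := by
  classical
  rw [pairPartitions, Finset.mem_filter] at hπ
  have hpair : ∀ V : Blocks π, V.1.card = 2 := fun V => hπ.2.1 V.1 V.2
  have hcross : 3 ≤ (Finset.univ.filter fun V : Blocks π => IsCross p V.1).card := by
    rw [← card_crosses]
    convert hπ.2.2
  have hc : ∀ V : Blocks π, coeffFst p (fun i => epsUnit π i * twist p σ i) V =
      if IsCross p V.1 then 1 else 0 := fun V => coeffFst_eps_twist (hpair V) σ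
  have hfs := firstSumCoeff_eq π σ
  have hmany : ∀ V W : Blocks π, ∃ U, U ≠ V ∧ U ≠ W ∧ IsCross p U.1 := by
    intro V W
    obtain ⟨U, hU, hU'⟩ := Finset.exists_mem_notMem_of_card_lt_card
      (lt_of_le_of_lt (Finset.card_le_two (a := V) (b := W)) hcross)
    simp only [Finset.mem_insert, Finset.mem_singleton, not_or] at hU'
    exact ⟨U, hU'.1, hU'.2, (Finset.mem_filter.1 hU).2⟩
  obtain ⟨U, hU⟩ := Finset.card_pos.1 (lt_of_lt_of_le (by norm_num) hcross)
  replace hU : IsCross p U.1 := (Finset.mem_filter.1 hU).2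
  obtain ⟨k, hk1, hk⟩ := deltaMeasure_eq_map (c := firstSumCoeff p π)
    ⟨U, by rw [hfs]; simp [hc, hU]⟩ (fun V hV => by
      rw [hfs] at hV ⊢
      simp only [hc] at hV ⊢
      split_ifs at hV ⊢ <;> simp at hV ⊢)
  have hkc : coeffFst p (fun i => epsUnit π i * twist p σ i) k = 1 := by
    simp only [hfs] at hk1
    exact_mod_cast hk1
  rw [typeI_eq σ hk, ← one_mul (∫ w, _ ∂_)]
  refine Tendsto.congr (fun n => (blockSum_crossSign μ a bn t₁ t₂ _ σ n).symm) ?_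
  rw [hfs]
  exact tendsto_blockSum_of_dependent h hbn hbn_lim ht₁ ht (card_blocks_of_pairs hpair)
    (covar_pairs h hpair hU) hkc (fun V => coeffSnd_eps_twist (hpair V) σ) fun V W => by
      obtain ⟨U, h1, h2, h3⟩ := hmany V W
      exact ⟨U, h1, h2, by simp [hc, h3]⟩

lemma blockSum_eq_zero_of_few_crosses (hpair : ∀ V : Blocks π, V.1.card = 2)
    {U : Blocks π} (hU : IsCross p U.1) (hπ : π ∉ pairPartitions p q) (σ : ℤˣ) (n : ℕ) :
    blockSum μ a bn t₁ t₂ p π (crossSign p π (epsUnit π) σ) n = 0 := by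
  classical
  rw [blockSum_crossSign]
  refine blockSum_eq_zero fun x => ?_
  by_contra hne
  obtain ⟨hx, h1, -⟩ := blockTerm_ne_zero hne
  simp only [coeffFst_eps_twist (hpair _) σ, ite_mul, one_mul, zero_mul] at h1
  rw [← Finset.sum_filter] at h1
  have hlt : (Finset.univ.filter fun V : Blocks π => IsCross p V.1).card < 3 := by
    by_contra hge
    apply hπ
    rw [pairPartitions, Finset.mem_filter]
    refine ⟨Finset.mem_univ _, fun B hB => hpair ⟨B, hB⟩, ?_⟩
    rw [← card_crosses] at hge
    convert not_lt.1 hge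
  have hpos : 0 < (Finset.univ.filter fun V : Blocks π => IsCross p V.1).card :=
    Finset.card_pos.2 ⟨U, by simp [hU]⟩
  obtain hc | hc : (Finset.univ.filter fun V : Blocks π => IsCross p V.1).card = 1 ∨
      (Finset.univ.filter fun V : Blocks π => IsCross p V.1).card = 2 := by omega
  · obtain ⟨V, hV⟩ := Finset.card_eq_one.1 hc
    rw [hV, Finset.sum_singleton] at h1
    exact hx.1 V h1
  · obtain ⟨V, W, hVW, hV⟩ := Finset.card_eq_two.1 hc
    rw [hV, Finset.sum_pair hVW] at h1
    refine hVW (hx.2 ?_)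
    simp only [eq_neg_of_add_eq_zero_left h1, abs_neg]

end PairLimit

end BandToeplitz

namespace BandToeplitz

section Quad

variable {p q : ℕ} {π : Part (p + q)}

open Classical in
/-- The signs `τ_π(i)`. -/
noncomputable def tauUnit {N : ℕ} (π : Part N) (i : Fin N) : ℤˣ :=
  if (∀ j ∈ π.part i, i ≤ j) ∨ ((π.part i).card = 4 ∧ ∀ j ∈ π.part i, j ≤ i) then 1 else -1

lemma tauSign_eq {N : ℕ} (π : Part N) : tauSign π = fun i => ((tauUnit π i : ℤ) : ℝ) := by
  funext i
  rw [tauSign, tauUnit]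
  split_ifs <;> simp

lemma tauUnit_mem_normSigns (π : Part (p + q)) : tauUnit π ∈ normSigns π := by
  classical
  simp only [normSigns, Finset.mem_filter, Finset.mem_univ, true_and]
  intro i hi
  rw [tauUnit, if_pos (Or.inl hi)]

/-- The block `V` consists of two elements of each side, and all other blocks are pairs on one
side. -/
def IsQuadBlock (p : ℕ) {q : ℕ} {π : Part (p + q)} (V : Blocks π) : Prop :=
  (cardFst p V = 2 ∧ cardSnd p V = 2) ∧ ∀ W : Blocks π, W ≠ V → W.1.card = 2 ∧ ¬ IsCross p W.1

lemma not_isCross_iff (W : Blocks π) :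
    ¬ IsCross p W.1 ↔ (∀ i ∈ W.1, i.val < p) ∨ ∀ i ∈ W.1, p ≤ i.val := by
  rw [IsCross, not_and_or]
  push Not
  exact or_comm

lemma mem_pairQuadPartitions_iff :
    π ∈ pairQuadPartitions p q ↔ Even p ∧ Even q ∧ ∃ V : Blocks π, IsQuadBlock p V := by
  classical
  rw [pairQuadPartitions, Finset.mem_filter]
  simp only [Finset.mem_univ, true_and]
  refine and_congr_right fun _ => and_congr_right fun _ => ⟨?_, ?_⟩
  · rintro ⟨V, hV, -, h2, h3, h4⟩
    refine ⟨⟨V, hV⟩, ⟨?_, ?_⟩, fun W hW => ?_⟩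
    · rw [cardFst]; convert h2
    · rw [cardSnd]; convert h3
    · rw [not_isCross_iff]
      exact h4 W.1 W.2 fun h => hW (Subtype.ext h)
  · rintro ⟨V, ⟨h2, h3⟩, h4⟩
    refine ⟨V.1, V.2, ?_, ?_, ?_, fun B hB hne => ?_⟩
    · rw [← cardFst_add_cardSnd, h2, h3]
    · rw [cardFst] at h2; convert h2
    · rw [cardSnd] at h3; convert h3
    · have := h4 ⟨B, hB⟩ fun h => hne (congrArg Subtype.val h)
      rwa [not_isCross_iff] at this

lemma exists_lt_of_card_eq_two {N : ℕ} {A : Finset (Fin N)} (h : A.card = 2) :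
    ∃ m i, m < i ∧ A = {m, i} := by
  obtain ⟨m, i, hne, h⟩ := Finset.card_eq_two.1 h
  rcases lt_or_gt_of_ne hne with hmi | hmi
  · exact ⟨m, i, hmi, h⟩
  · exact ⟨i, m, hmi, h.trans (Finset.pair_comm _ _)⟩

lemma exists_quad {V : Blocks π} (h : cardFst p V = 2 ∧ cardSnd p V = 2) :
    ∃ m i j k : Fin (p + q), m < i ∧ i.val < p ∧ p ≤ j.val ∧ j < k ∧ V.1 = {m, i, j, k} := by
  obtain ⟨m, i, hmi, h1⟩ := exists_lt_of_card_eq_two h.1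
  obtain ⟨j, k, hjk, h2⟩ := exists_lt_of_card_eq_two h.2
  have hi : i ∈ V.1.filter fun i => i.val < p := by rw [h1]; simp
  have hj : j ∈ V.1.filter fun i => p ≤ i.val := by rw [h2]; simp
  refine ⟨m, i, j, k, hmi, (Finset.mem_filter.1 hi).2, (Finset.mem_filter.1 hj).2, hjk, ?_⟩
  have h3 := Finset.filter_union_filter_not_eq (fun i : Fin (p + q) => i.val < p) V.1
  simp only [not_lt] at h3
  rw [← h3, h1, h2, Finset.insert_union, Finset.singleton_union]

section QuadBlock

variable {V : Blocks π} {m i j k : Fin (p + q)}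

lemma coeffFst_quad (hmi : m < i) (hi : i.val < p) (hj : p ≤ j.val) (hjk : j < k)
    (hV : V.1 = {m, i, j, k}) (s : Fin (p + q) → ℤˣ) :
    coeffFst p s V = (s m : ℤ) + s i := by
  rw [Fin.lt_def] at hmi hjk
  rw [coeffFst, hV, Finset.sum_insert, Finset.sum_insert, Finset.sum_pair]
  · rw [if_pos (by omega), if_pos hi, if_neg (by omega), if_neg (by omega)]
    simp
  all_goals simp only [Finset.mem_insert, Finset.mem_singleton, ne_eq, Fin.ext_iff]; omega

lemma coeffSnd_quad (hmi : m < i) (hi : i.val < p) (hj : p ≤ j.val) (hjk : j < k)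
    (hV : V.1 = {m, i, j, k}) (s : Fin (p + q) → ℤˣ) :
    coeffSnd p s V = (s j : ℤ) + s k := by
  rw [Fin.lt_def] at hmi hjk
  rw [coeffSnd, hV, Finset.sum_insert, Finset.sum_insert, Finset.sum_pair]
  · rw [if_neg (by omega), if_neg (by omega), if_pos hj, if_pos (by omega)]
    simp
  all_goals simp only [Finset.mem_insert, Finset.mem_singleton, ne_eq, Fin.ext_iff]; omega

lemma tauUnit_quad (hmi : m < i) (hi : i.val < p) (hj : p ≤ j.val) (hjk : j < k)
    (hV : V.1 = {m, i, j, k}) :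
    tauUnit π m = 1 ∧ tauUnit π i = -1 ∧ tauUnit π j = -1 ∧ tauUnit π k = 1 := by
  rw [Fin.lt_def] at hmi hjk
  have hp : ∀ x, x ∈ V.1 → π.part x = {m, i, j, k} := fun x hx => by
    rw [part_eq_of_mem_block hx, hV]
  have hcard : ({m, i, j, k} : Finset (Fin (p + q))).card = 4 := by
    rw [Finset.card_eq_succ]
    refine ⟨m, {i, j, k}, ?_, rfl, Finset.card_eq_three.2 ⟨i, j, k, ?_, ?_, ?_, rfl⟩⟩
    all_goals
      simp only [Finset.mem_insert, Finset.mem_singleton, ne_eq, Fin.ext_iff]; omega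
  have key : ∀ x ∈ V.1, tauUnit π x = if (x ≤ m ∧ x ≤ i ∧ x ≤ j ∧ x ≤ k) ∨
      (m ≤ x ∧ i ≤ x ∧ j ≤ x ∧ k ≤ x) then 1 else -1 := by
    intro x hx
    rw [tauUnit, hp x hx]
    simp [hcard]
  refine ⟨?_, ?_, ?_, ?_⟩
  · rw [key m (by simp [hV]), if_pos]
    simp only [Fin.le_def]; omega
  · rw [key i (by simp [hV]), if_neg]
    simp only [Fin.le_def]; omega
  · rw [key j (by simp [hV]), if_neg]
    simp only [Fin.le_def]; omega
  · rw [key k (by simp [hV]), if_pos]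
    simp only [Fin.le_def]; omega

lemma tauUnit_pair (hmi : m < i) (hV : V.1 = {m, i}) : tauUnit π m = 1 ∧ tauUnit π i = -1 := by
  have hp : ∀ x, x ∈ V.1 → π.part x = {m, i} := fun x hx => by
    rw [part_eq_of_mem_block hx, hV]
  constructor
  · rw [tauUnit, hp m (by simp [hV]), if_pos]
    left
    simp [hmi.le]
  · rw [tauUnit, hp i (by simp [hV]), if_neg]
    rw [Finset.card_pair hmi.ne]
    simp [hmi]

end QuadBlock

lemma coeff_tau_twist {V : Blocks π} (hV : IsQuadBlock p V) (σ : ℤˣ) (W : Blocks π) :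
    coeffFst p (fun i => tauUnit π i * twist p σ i) W = 0 ∧
      coeffSnd p (fun i => tauUnit π i * twist p σ i) W = 0 := by
  by_cases hWV : W = V
  · subst hWV
    obtain ⟨m, i, j, k, hmi, hi, hj, hjk, hW⟩ := exists_quad hV.1
    obtain ⟨h1, h2, h3, h4⟩ := tauUnit_quad hmi hi hj hjk hW
    rw [coeffFst_quad hmi hi hj hjk hW, coeffSnd_quad hmi hi hj hjk hW, h1, h2, h3, h4]
    have e1 := Fin.lt_def.1 hmi
    have e2 := Fin.lt_def.1 hjk
    have f1 : m.val < p := by omega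
    have f2 : ¬ j.val < p := by omega
    have f3 : ¬ k.val < p := by omega
    simp only [twist, hi, f1, f2, f3, if_true, if_false]
    simp
  · obtain ⟨hc, hx⟩ := hV.2 W hWV
    obtain ⟨m, i, hmi, hW, -⟩ := exists_pair hc
    obtain ⟨h1, h2⟩ := tauUnit_pair hmi hW
    rw [isCross_pair hmi hW] at hx
    rw [coeffFst_pair hmi hW, coeffSnd_pair hmi hW, h1, h2]
    have e1 := Fin.lt_def.1 hmi
    by_cases c1 : m.val < p
    · simp [twist, c1, not_le.2 c1, (by omega : i.val < p)]
    · have f1 : ¬ i.val < p := by omega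
      simp only [twist, c1, f1, not_lt.1 c1, not_lt.1 f1, if_true, if_false]
      simp

lemma coeff_crossSign_tau {V : Blocks π} (hV : IsQuadBlock p V) (σ : ℤˣ) (W : Blocks π) :
    coeffFst p (crossSign p π (tauUnit π) σ) W = 0 ∧
      coeffSnd p (crossSign p π (tauUnit π) σ) W = 0 := by
  have h := coeff_tau_twist hV σ W
  constructor
  · exact (coeffFst_mul_block (fun i => tauUnit π i * twist p σ i) (flipSign p σ) W).trans
      (by rw [h.1, zero_mul])
  · exact (coeffSnd_mul_block (fun i => tauUnit π i * twist p σ i) (flipSign p σ) W).trans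
      (by rw [h.2, zero_mul])

lemma units_eq_neg_of_add_eq_zero {u v : ℤˣ} (h : (u : ℤ) + v = 0) : v = -u := by
  ext
  rw [Units.val_neg]
  omega

lemma exists_eq_crossSign_of_coeff_eq_zero {V : Blocks π} (hV : IsQuadBlock p V)
    {s : Fin (p + q) → ℤˣ} (hs : s ∈ normSigns π)
    (hc : ∀ W : Blocks π, coeffFst p s W = 0) (hd : ∀ W : Blocks π, coeffSnd p s W = 0) :
    ∃ σ, s = crossSign p π (tauUnit π) σ := by
  obtain ⟨m, i, j, k, hmi, hi, hj, hjk, hW⟩ := exists_quad hV.1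
  obtain ⟨h1, h2, h3, h4⟩ := tauUnit_quad hmi hi hj hjk hW
  have e1 := Fin.lt_def.1 hmi
  have e2 := Fin.lt_def.1 hjk
  have hp : ∀ x, x ∈ V.1 → π.part x = {m, i, j, k} := fun x hx => by
    rw [part_eq_of_mem_block hx, hW]
  have hsm : s m = 1 := by
    classical
    simp only [normSigns, Finset.mem_filter, Finset.mem_univ, true_and] at hs
    refine hs m ?_
    rw [hp m (by simp [hW])]
    simp only [Finset.mem_insert, Finset.mem_singleton, forall_eq_or_imp, forall_eq, Fin.le_def]
    omega
  have hsi := hc V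
  rw [coeffFst_quad hmi hi hj hjk hW, hsm] at hsi
  have hsj := hd V
  rw [coeffSnd_quad hmi hi hj hjk hW, add_comm] at hsj
  refine ⟨s k, funext fun x => ?_⟩
  by_cases hx : blockOf π x = V
  · rw [blockOf_eq_iff, hW] at hx
    simp only [Finset.mem_insert, Finset.mem_singleton] at hx
    rcases hx with rfl | rfl | rfl | rfl
    · rw [crossSign_of_lt (by omega), h1, hsm]
    · rw [crossSign_of_lt hi, h2]
      exact units_eq_neg_of_add_eq_zero hsi
    · rw [crossSign_of_cross (j := m) hj (by rw [hp x (by simp [hW])]; simp) (by omega), h3,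
        units_eq_neg_of_add_eq_zero hsj, neg_one_mul]
    · rw [crossSign_of_cross (j := m) (by omega) (by rw [hp x (by simp [hW])]; simp) (by omega),
        h4, one_mul]
  · obtain ⟨hcard, hcr⟩ := hV.2 _ hx
    obtain ⟨m', i', hmi', hW', hmin⟩ := exists_pair hcard
    obtain ⟨g1, g2⟩ := tauUnit_pair hmi' hW'
    have e3 := Fin.lt_def.1 hmi'
    have hx' : x ∈ (blockOf π x).1 := mem_part_self π x
    have hpart : π.part x = {m', i'} := hW'
    have hsm' := normSigns_blockMin hs (blockOf π x)
    rw [hmin] at hsm'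
    have c1 := hc (blockOf π x)
    have d1 := hd (blockOf π x)
    rw [coeffFst_pair hmi' hW', hsm'] at c1
    rw [coeffSnd_pair hmi' hW', hsm'] at d1
    rw [isCross_pair hmi' hW'] at hcr
    have hside : crossSign p π (tauUnit π) (s k) x = tauUnit π x := by
      by_cases hxp : x.val < p
      · exact crossSign_of_lt hxp
      · refine crossSign_of_forall_ge ?_
        rw [hW'] at hx'
        rw [hpart]
        simp only [Finset.mem_insert, Finset.mem_singleton, forall_eq_or_imp, forall_eq] at hx' ⊢
        rcases hx' with rfl | rfl <;> omega
    rw [hside]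
    rw [hW'] at hx'
    simp only [Finset.mem_insert, Finset.mem_singleton] at hx'
    rcases hx' with rfl | rfl
    · rw [hsm', g1]
    · rw [g2]
      by_cases hmp : m'.val < p
      · rw [if_pos hmp, if_pos (by omega)] at c1
        exact units_eq_neg_of_add_eq_zero c1
      · rw [if_pos (by omega), if_pos (by omega)] at d1
        exact units_eq_neg_of_add_eq_zero d1

lemma card_blocks_of_quad {V : Blocks π} (hV : IsQuadBlock p V) :
    p + q = 2 * Fintype.card (Blocks π) + 2 := by
  have h := sum_card_blocks π
  rw [← Finset.add_sum_erase _ _ (Finset.mem_univ V),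
    Finset.sum_congr rfl fun W hW => (hV.2 W (Finset.ne_of_mem_erase hW)).1, Finset.sum_const,
    Finset.card_erase_of_mem (Finset.mem_univ V), ← cardFst_add_cardSnd, hV.1.1, hV.1.2,
    Finset.card_univ, smul_eq_mul] at h
  have hpos : 0 < Fintype.card (Blocks π) := Fintype.card_pos_iff.2 ⟨V⟩
  omega

section Limit

variable {Ω : Type*} [MeasurableSpace Ω] {μ : Measure Ω} [IsProbabilityMeasure μ]
  {a : ℤ → Ω → ℝ} {κ : ℝ} {bn : ℕ → ℝ} {t₁ t₂ b : ℝ} {s : Fin (p + q) → ℤˣ}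

lemma covar_quad (h : IsEntrySequence μ a κ) {V : Blocks π} (hV : IsQuadBlock p V)
    (x : Blocks π → ℤ) (hx : Admissible x) : covar μ a p (steps π s x) = κ - 1 := by
  refine covar_eq_sub_one h hx.1 hx.2 (blockOf π) s (V := V) ?_ fun W hW => ?_
  · rw [fiberFst_blockOf, fiberSnd_blockOf]
    exact hV.1
  · obtain ⟨h1, h2⟩ := hV.2 W hW
    rw [isCross_iff] at h2
    rw [fiberFst_blockOf, fiberSnd_blockOf]
    have := cardFst_add_cardSnd W
    omega

lemma tendsto_blockSum_quad (h : IsEntrySequence μ a κ)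
    (hbn : Tendsto bn atTop atTop) (hbn_lim : Tendsto (fun n : ℕ => bn n / n) atTop (𝓝 b))
    (ht₁ : 0 < t₁) (ht : t₁ ≤ t₂) {V : Blocks π} (hV : IsQuadBlock p V) (σ : ℤˣ) :
    Tendsto (blockSum μ a bn t₁ t₂ p π (crossSign p π (tauUnit π) σ)) atTop
      (𝓝 ((κ - 1) * typeII p b ((σ : ℤ) : ℝ) π t₁ t₂)) := by
  refine Tendsto.congr (fun n => (blockSum_crossSign μ a bn t₁ t₂ _ σ n).symm) ?_
  rw [typeII, tauSign_eq, ← integral_limitTerm_twist (tauUnit π) σ volume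
    (volume_box_lt_top π t₁ t₂)]
  exact tendsto_blockSum_of_unconstrained h hbn hbn_lim ht₁ ht (card_blocks_of_quad hV)
    (covar_quad h hV) (fun W => (coeff_tau_twist hV σ W).1) fun W => (coeff_tau_twist hV σ W).2

end Limit

end Quad

end BandToeplitz

namespace BandToeplitz

section Dispatch

variable {p q : ℕ} {π : Part (p + q)}

open Classical in
/-- The limit of the contribution of the partition `π` with signs `s`. -/
noncomputable def limitValue (p : ℕ) {q : ℕ} (κ b t₁ t₂ : ℝ) (π : Part (p + q))
    (s : Fin (p + q) → ℤˣ) : ℝ :=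
  (if π ∈ pairPartitions p q then
    (if s = crossSign p π (epsUnit π) 1 then fIminus p b π t₁ t₂ else 0) +
      if s = crossSign p π (epsUnit π) (-1) then fIplus p b π t₁ t₂ else 0 else 0) +
  (κ - 1) * if π ∈ pairQuadPartitions p q then
    (if s = crossSign p π (tauUnit π) 1 then fIIminus p b π t₁ t₂ else 0) +
      if s = crossSign p π (tauUnit π) (-1) then fIIplus p b π t₁ t₂ else 0 else 0

variable {κ b t₁ t₂ : ℝ} {s : Fin (p + q) → ℤˣ}

lemma card_of_mem_pairPartitions (hπ : π ∈ pairPartitions p q) (V : Blocks π) : V.1.card = 2 :=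
  (Finset.mem_filter.1 hπ).2.1 V.1 V.2

lemma exists_isCross_of_mem_pairPartitions (hπ : π ∈ pairPartitions p q) :
    ∃ V : Blocks π, IsCross p V.1 := by
  classical
  have h3 := (Finset.mem_filter.1 hπ).2.2
  obtain ⟨B, hB⟩ := Finset.card_pos.1 (lt_of_lt_of_le (by norm_num) h3)
  rw [Finset.mem_filter] at hB
  exact ⟨⟨B, hB.1⟩, hB.2⟩

lemma IsQuadBlock.isCross {V : Blocks π} (hV : IsQuadBlock p V) : IsCross p V.1 := by
  rw [isCross_iff]
  have := hV.1
  omega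

lemma IsQuadBlock.two_le_card {V : Blocks π} (hV : IsQuadBlock p V) (W : Blocks π) :
    2 ≤ W.1.card := by
  by_cases h : W = V
  · subst h
    have := cardFst_add_cardSnd W
    have := hV.1
    omega
  · rw [(hV.2 W h).1]

lemma notMem_pairQuadPartitions (hπ : ∀ V : Blocks π, V.1.card = 2) :
    π ∉ pairQuadPartitions p q := by
  rw [mem_pairQuadPartitions_iff]
  rintro ⟨-, -, V, hV⟩
  have h1 := card_blocks_of_pairs hπ
  have h2 := card_blocks_of_quad hV
  omega

lemma crossSign_ne_of_isCross {V : Blocks π} (hV : IsCross p V.1) (e : Fin (p + q) → ℤˣ) :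
    crossSign p π e 1 ≠ crossSign p π e (-1) := by
  obtain ⟨⟨j, hj, hjp⟩, i, hi, hip⟩ := hV
  exact crossSign_ne hip (by rwa [part_eq_of_mem_block hi]) hjp

lemma limitValue_eq_typeI (hπ : π ∈ pairPartitions p q) (σ : ℤˣ) :
    limitValue p κ b t₁ t₂ π (crossSign p π (epsUnit π) σ) = typeI p b ((σ : ℤ) : ℝ) π t₁ t₂ := by
  obtain ⟨V, hV⟩ := exists_isCross_of_mem_pairPartitions hπ
  have hne := crossSign_ne_of_isCross hV (epsUnit π)
  rw [limitValue, if_pos hπ,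
    if_neg (notMem_pairQuadPartitions (card_of_mem_pairPartitions hπ)), mul_zero, add_zero]
  rcases Int.units_eq_one_or σ with rfl | rfl
  · simp [hne, fIminus]
  · simp [hne.symm, fIplus]

lemma limitValue_eq_typeII (hπ : π ∈ pairQuadPartitions p q) (σ : ℤˣ) :
    limitValue p κ b t₁ t₂ π (crossSign p π (tauUnit π) σ) =
      (κ - 1) * typeII p b ((σ : ℤ) : ℝ) π t₁ t₂ := by
  obtain ⟨-, -, V, hV⟩ := mem_pairQuadPartitions_iff.1 hπ
  have hne := crossSign_ne_of_isCross hV.isCross (tauUnit π)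
  rw [limitValue, if_pos hπ,
    if_neg fun h => notMem_pairQuadPartitions (card_of_mem_pairPartitions h) hπ, zero_add]
  rcases Int.units_eq_one_or σ with rfl | rfl
  · simp [hne, fIIminus]
  · simp [hne.symm, fIIplus]

lemma limitValue_eq_zero
    (h1 : π ∈ pairPartitions p q → ∀ σ, s ≠ crossSign p π (epsUnit π) σ)
    (h2 : π ∈ pairQuadPartitions p q → ∀ σ, s ≠ crossSign p π (tauUnit π) σ) :
    limitValue p κ b t₁ t₂ π s = 0 := by
  rw [limitValue]
  by_cases hp : π ∈ pairPartitions p q <;> by_cases hq : π ∈ pairQuadPartitions p q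
  · simp [hp, hq, h1 hp, h2 hq]
  · simp [hp, hq, h1 hp]
  · simp [hp, hq, h2 hq]
  · simp [hp, hq]

open Classical in
lemma sum_limitValue (π : Part (p + q)) :
    ∑ s ∈ normSigns π, limitValue p κ b t₁ t₂ π s =
      (if π ∈ pairPartitions p q then fIminus p b π t₁ t₂ + fIplus p b π t₁ t₂ else 0) +
        (κ - 1) * if π ∈ pairQuadPartitions p q then
          fIIminus p b π t₁ t₂ + fIIplus p b π t₁ t₂ else 0 := by
  have hI := fun σ => crossSign_mem_normSigns (epsUnit_mem_normSigns π) σ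
  have hII := fun σ => crossSign_mem_normSigns (tauUnit_mem_normSigns π) σ
  simp only [limitValue, Finset.sum_add_distrib, ← Finset.mul_sum]
  split_ifs <;> simp [Finset.sum_add_distrib, hI, hII]

lemma coeffSnd_of_isCross {V : Blocks π} (hV : V.1.card = 2) (hc : IsCross p V.1) :
    ∃ τ : ℤˣ, coeffSnd p s V = τ := by
  obtain ⟨m, i, hmi, hVmi, -⟩ := exists_pair hV
  rw [isCross_pair hmi hVmi] at hc
  exact ⟨s i, by rw [coeffSnd_pair hmi hVmi, if_pos hc.2, if_neg (not_le.2 hc.1), zero_add]⟩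

lemma coeffSnd_crossSign_eps (hπ : ∀ V : Blocks π, V.1.card = 2) (σ : ℤˣ) (V : Blocks π) :
    coeffSnd p (crossSign p π (epsUnit π) σ) V =
      -(σ : ℤ) * coeffFst p (crossSign p π (epsUnit π) σ) V := by
  have h1 := coeffFst_mul_block (fun i => epsUnit π i * twist p σ i) (flipSign p σ) V
  have h2 := coeffSnd_mul_block (fun i => epsUnit π i * twist p σ i) (flipSign p σ) V
  refine h2.trans ?_
  rw [coeffSnd_eps_twist (hπ V)]
  refine Eq.trans ?_ (congrArg (fun y => -(σ : ℤ) * y) h1.symm)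
  ring

lemma sum_cardFst (π : Part (p + q)) : ∑ V : Blocks π, cardFst p V = p := by
  have h := sum_eq_sum_blocks π fun i : Fin (p + q) => if i.val < p then 1 else 0
  simp only [← Finset.sum_filter, sum_filter_lt_eq] at h
  simpa [cardFst] using h.symm

lemma sum_cardSnd (π : Part (p + q)) : ∑ V : Blocks π, cardSnd p V = q := by
  have h := sum_eq_sum_blocks π fun i : Fin (p + q) => if p ≤ i.val then 1 else 0
  simp only [← Finset.sum_filter, sum_filter_ge_eq] at h
  simpa [cardSnd] using h.symm

lemma sum_const_blocks (π : Part (p + q)) (c : ℕ) :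
    ∑ _V : Blocks π, c = c * Fintype.card (Blocks π) := by
  rw [Finset.sum_const, smul_eq_mul, mul_comm]
  rfl

lemma two_mul_card_blocks_le (hπ : ∀ V : Blocks π, 2 ≤ V.1.card) :
    2 * Fintype.card (Blocks π) ≤ p + q := by
  have h := Finset.sum_le_sum fun V (_ : V ∈ Finset.univ) => hπ V
  rwa [sum_card_blocks, sum_const_blocks] at h

lemma card_eq_two_of_card_blocks (hπ : ∀ V : Blocks π, 2 ≤ V.1.card)
    (h : 2 * Fintype.card (Blocks π) = p + q) (V : Blocks π) : V.1.card = 2 := by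
  refine ((Finset.sum_eq_sum_iff_of_le fun V _ => hπ V).1 ?_ V (Finset.mem_univ V)).symm
  rw [sum_card_blocks, sum_const_blocks, h]

lemma sum_two_add_ite (V : Blocks π) :
    ∑ W : Blocks π, (if W = V then 4 else 2) = 2 * Fintype.card (Blocks π) + 2 := by
  rw [← Finset.add_sum_erase _ _ (Finset.mem_univ V), if_pos rfl,
    Finset.sum_congr rfl fun W hW => if_neg (Finset.ne_of_mem_erase hW), Finset.sum_const,
    Finset.card_erase_of_mem (Finset.mem_univ V), Finset.card_univ, smul_eq_mul]
  have hpos : 0 < Fintype.card (Blocks π) := Fintype.card_pos_iff.2 ⟨V⟩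
  omega

lemma two_mul_card_blocks_add_two_le (hπ : ∀ V : Blocks π, 2 ≤ V.1.card) {V : Blocks π}
    (hV : 4 ≤ V.1.card) : 2 * Fintype.card (Blocks π) + 2 ≤ p + q := by
  rw [← sum_two_add_ite V]
  refine le_trans (Finset.sum_le_sum fun W _ => ?_) (sum_card_blocks π).le
  split_ifs with h
  · rwa [h]
  · exact hπ W

lemma isQuadBlock_of_card_blocks (hc : ∀ W : Blocks π, Even (cardFst p W))
    (hd : ∀ W : Blocks π, Even (cardSnd p W)) {V : Blocks π} (hV : IsCross p V.1)
    (h : 2 * Fintype.card (Blocks π) + 2 = p + q) : IsQuadBlock p V := by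
  have hle : ∀ W ∈ Finset.univ, (if W = V then 4 else 2) ≤ W.1.card := by
    intro W _
    have h1 := cardFst_add_cardSnd W
    have h2 := card_pos W
    have h3 := (hc W).two_dvd
    have h4 := (hd W).two_dvd
    split_ifs with hW
    · subst hW
      rw [isCross_iff] at hV
      omega
    · omega
  have heq := (Finset.sum_eq_sum_iff_of_le hle).1 (by rw [sum_two_add_ite, sum_card_blocks, h])
  constructor
  · have h0 := heq V (Finset.mem_univ V)
    rw [if_pos rfl] at h0
    have h1 := cardFst_add_cardSnd V
    have h3 := (hc V).two_dvd
    have h4 := (hd V).two_dvd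
    rw [isCross_iff] at hV
    omega
  · intro W hW
    have h0 := heq W (Finset.mem_univ W)
    rw [if_neg hW] at h0
    have h1 := cardFst_add_cardSnd W
    have h3 := (hc W).two_dvd
    have h4 := (hd W).two_dvd
    rw [isCross_iff]
    omega

variable {Ω : Type*} [MeasurableSpace Ω] {μ : Measure Ω} [IsProbabilityMeasure μ]
  {a : ℤ → Ω → ℝ} {bn : ℕ → ℝ}

lemma tendsto_blockSum_of_mem_pairs (h : IsEntrySequence μ a κ)
    (hbn : Tendsto bn atTop atTop) (hbn_lim : Tendsto (fun n : ℕ => bn n / n) atTop (𝓝 b))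
    (ht₁ : 0 < t₁) (ht : t₁ ≤ t₂) (hs : s ∈ normSigns π) (hπ : ∀ V : Blocks π, V.1.card = 2)
    {k : Blocks π} (hk : IsCross p k.1) :
    Tendsto (blockSum μ a bn t₁ t₂ p π s) atTop (𝓝 (limitValue p κ b t₁ t₂ π s)) := by
  have hquad := notMem_pairQuadPartitions hπ
  have hk1 := coeffFst_of_isCross hs (hπ k) hk
  obtain ⟨τ, hτ⟩ := coeffSnd_of_isCross (s := s) (hπ k) hk
  by_cases hdep : ∀ V : Blocks π, coeffSnd p s V = (τ : ℤ) * coeffFst p s V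
  · have hs' := eq_crossSign_of_dependent hs hπ hdep
    by_cases hmem : π ∈ pairPartitions p q
    · rw [hs', limitValue_eq_typeI hmem]
      exact tendsto_blockSum_pairs h hbn hbn_lim ht₁ ht hmem (-τ)
    · rw [limitValue_eq_zero (fun h => absurd h hmem) (fun h => absurd h hquad), hs']
      exact tendsto_const_nhds.congr fun n =>
        (blockSum_eq_zero_of_few_crosses hπ hk hmem (-τ) n).symm
  · push Not at hdep
    obtain ⟨V, hV⟩ := hdep
    rw [limitValue_eq_zero ?_ (fun h => absurd h hquad)]
    · exact tendsto_blockSum_zero_of_independent h hbn ht₁ ht (card_blocks_of_pairs hπ) hk1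
        (V := V) (by rwa [hτ])
    · rintro - σ rfl
      have h1 := coeffSnd_crossSign_eps hπ σ k
      rw [hτ, hk1, mul_one] at h1
      exact hV (by rw [coeffSnd_crossSign_eps hπ, h1])

lemma tendsto_blockSum (h : IsEntrySequence μ a κ)
    (hbn : Tendsto bn atTop atTop) (hbn_lim : Tendsto (fun n : ℕ => bn n / n) atTop (𝓝 b))
    (ht₁ : 0 < t₁) (ht : t₁ ≤ t₂) (hs : s ∈ normSigns π) :
    Tendsto (blockSum μ a bn t₁ t₂ p π s) atTop (𝓝 (limitValue p κ b t₁ t₂ π s)) := by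
  have ht₂ : 0 < t₂ := ht₁.trans_le ht
  by_cases h0 : (∃ V : Blocks π, V.1.card = 1) ∨ ∀ V : Blocks π, ¬ IsCross p V.1
  · rw [limitValue_eq_zero]
    · exact tendsto_const_nhds.congr fun n =>
        (blockSum_eq_zero (blockTerm_eq_zero_of_card h bn t₁ t₂ s h0 n)).symm
    · intro hmem
      obtain ⟨U, hU⟩ := exists_isCross_of_mem_pairPartitions hmem
      rcases h0 with ⟨V, hV⟩ | h0
      · have := card_of_mem_pairPartitions hmem V
        omega
      · exact absurd hU (h0 U)
    · intro hmem
      obtain ⟨-, -, U, hU⟩ := mem_pairQuadPartitions_iff.1 hmem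
      rcases h0 with ⟨V, hV⟩ | h0
      · have := hU.two_le_card V
        omega
      · exact absurd hU.isCross (h0 U)
  push Not at h0
  obtain ⟨hcard1, k, hk⟩ := h0
  have hcard : ∀ V : Blocks π, 2 ≤ V.1.card := fun V => by
    have := hcard1 V
    have := card_pos V
    omega
  by_cases hcd : ∃ V : Blocks π, coeffFst p s V ≠ 0 ∨ coeffSnd p s V ≠ 0
  · obtain ⟨V, hV⟩ := hcd
    rcases (two_mul_card_blocks_le hcard).lt_or_eq with hlt | heq
    · rw [limitValue_eq_zero]
      · exact tendsto_blockSum_zero_of_constraint h hbn ht₂ hlt hV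
      · intro hmem
        have := card_blocks_of_pairs (card_of_mem_pairPartitions hmem)
        omega
      · rintro hmem σ rfl
        obtain ⟨-, -, U, hU⟩ := mem_pairQuadPartitions_iff.1 hmem
        have := coeff_crossSign_tau hU σ V
        tauto
    · exact tendsto_blockSum_of_mem_pairs h hbn hbn_lim ht₁ ht hs
        (card_eq_two_of_card_blocks hcard heq) hk
  · push Not at hcd
    have hc : ∀ V : Blocks π, Even (cardFst p V) := fun V => even_cardFst (hcd V).1
    have hd : ∀ V : Blocks π, Even (cardSnd p V) := fun V => even_cardSnd (hcd V).2
    have h4 : 4 ≤ k.1.card := by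
      have h1 := cardFst_add_cardSnd k
      have h3 := (hc k).two_dvd
      have h4 := (hd k).two_dvd
      rw [isCross_iff] at hk
      omega
    rcases (two_mul_card_blocks_add_two_le hcard h4).lt_or_eq with hlt | heq
    · rw [limitValue_eq_zero]
      · exact tendsto_blockSum_zero_of_card_lt h hbn ht₂ hlt
      · intro hmem
        have := card_blocks_of_pairs (card_of_mem_pairPartitions hmem)
        omega
      · intro hmem
        obtain ⟨-, -, U, hU⟩ := mem_pairQuadPartitions_iff.1 hmem
        have := card_blocks_of_quad hU
        omega
    · have hq := isQuadBlock_of_card_blocks hc hd hk heq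
      obtain ⟨σ, hσ⟩ := exists_eq_crossSign_of_coeff_eq_zero hq hs (fun W => (hcd W).1)
        fun W => (hcd W).2
      have hmem : π ∈ pairQuadPartitions p q := by
        refine mem_pairQuadPartitions_iff.2 ⟨?_, ?_, k, hq⟩
        · rw [← sum_cardFst π]
          exact Finset.even_sum _ fun V _ => hc V
        · rw [← sum_cardSnd π]
          exact Finset.even_sum _ fun V _ => hd V
      rw [hσ, limitValue_eq_typeII hmem]
      exact tendsto_blockSum_quad h hbn hbn_lim ht₁ ht hq σ

lemma summand_eq_zero_of_apply_eq_zero (h : IsEntrySequence μ a κ) (n : ℕ) (m₁ m₂ : ℤ)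
    {J : Fin (p + q) → ℤ} {i : Fin (p + q)} (hi : J i = 0) : summand μ a p n m₁ m₂ J = 0 := by
  have h0 : ∀ w, a (J i) w = 0 := fun w => by rw [hi, h.zero]; rfl
  have hcov : covar μ a p J = 0 := by
    have h1 : ∀ w, ∏ i, a (J i) w = 0 := fun w => Finset.prod_eq_zero (Finset.mem_univ i) (h0 w)
    rw [covar]
    simp only [h1]
    by_cases hip : i.val < p
    · have h2 : ∀ w, ∏ i : Fin (p + q) with i.val < p, a (J i) w = 0 := fun w =>
        Finset.prod_eq_zero (i := i) (by simpa using hip) (h0 w)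
      simp [h2]
    · have h2 : ∀ w, ∏ i : Fin (p + q) with p ≤ i.val, a (J i) w = 0 := fun w =>
        Finset.prod_eq_zero (i := i) (by simpa using hip) (h0 w)
      simp [h2]
  rw [summand]
  split_ifs
  · rw [hcov, mul_zero]
  · rfl

lemma integral_fluctuation_mul_eq_sum_blockSum (h : IsEntrySequence μ a κ) (ht : t₁ ≤ t₂) {n : ℕ}
    (hb : 0 < bn n) :
    ∫ w, fluctuation μ a bn p n t₁ w * fluctuation μ a bn q n t₂ w ∂μ =
      ∑ π : Part (p + q), ∑ s ∈ normSigns π, blockSum μ a bn t₁ t₂ p π s n := by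
  classical
  rw [integral_fluctuation_mul h bn n t₁ t₂
      (Int.floor_mono (mul_le_mul_of_nonneg_left ht hb.le)) le_rfl,
    sum_box_eq_sum_partitions _ _ fun J i hi => summand_eq_zero_of_apply_eq_zero h _ _ _ hi,
    Finset.mul_sum]
  refine Finset.sum_congr rfl fun π _ => ?_
  rw [Finset.mul_sum]
  refine Finset.sum_congr rfl fun s _ => ?_
  simp only [blockSum, blockTerm]
  rw [← Finset.sum_filter, ← Finset.sum_div, div_pow]
  ring

end Dispatch

lemma pos_of_mem_timeInterval {b t : ℝ} (h : t ∈ timeInterval b) : 0 < t := by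
  rw [timeInterval] at h
  split_ifs at h
  · exact h
  · exact h.1

end BandToeplitz

theorem lemma3p1 {Ω : Type*} [MeasurableSpace Ω] (μ : Measure Ω) [IsProbabilityMeasure μ]
    (a : ℤ → Ω → ℝ) (κ : ℝ)
    (ha_meas : ∀ i, Measurable (a i))
    (ha_zero : a 0 = 0)
    (ha_symm : ∀ i, a (-i) = a i)
    (ha_indep : iIndepFun (fun i : ℕ => a ((i : ℤ) + 1)) μ)
    (ha_mean : ∀ i, i ≠ 0 → ∫ w, a i w ∂μ = 0)
    (ha_var : ∀ i, i ≠ 0 → variance (a i) μ = 1)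
    (ha_fourth : ∀ i, i ≠ 0 → ∫ w, |a i w| ^ 4 ∂μ = κ)
    (ha_moments : ∀ k : ℕ, 2 < k → ∃ C : ℝ, ∀ i, i ≠ 0 →
      Integrable (fun w => |a i w| ^ k) μ ∧ ∫ w, |a i w| ^ k ∂μ < C)
    (bn : ℕ → ℝ) (b : ℝ)
    (hbn_le : ∀ n : ℕ, 1 ≤ n → bn n ≤ n)
    (hbn_top : Tendsto bn atTop atTop)
    (hbn_lim : Tendsto (fun n : ℕ => bn n / n) atTop (𝓝 b))
    (p q : ℕ) (hp : 2 ≤ p) (hq : 2 ≤ q)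
    (t₁ t₂ : ℝ) (ht₁ : t₁ ∈ BandToeplitz.timeInterval b) (ht₂ : t₂ ∈ BandToeplitz.timeInterval b)
    (ht : t₁ ≤ t₂) :
    (∀ n, Integrable (BandToeplitz.tracePow a bn p n t₁) μ) ∧
    (∀ n, Integrable (BandToeplitz.tracePow a bn q n t₂) μ) ∧
    (∀ n, Integrable (fun w => BandToeplitz.fluctuation μ a bn p n t₁ w *
      BandToeplitz.fluctuation μ a bn q n t₂ w) μ) ∧
    Tendsto
      (fun n => ∫ w, BandToeplitz.fluctuation μ a bn p n t₁ w *
        BandToeplitz.fluctuation μ a bn q n t₂ w ∂μ)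
      atTop
      (𝓝 ((∑ π ∈ BandToeplitz.pairPartitions p q,
            (BandToeplitz.fIminus p b π t₁ t₂ + BandToeplitz.fIplus p b π t₁ t₂)) +
          (κ - 1) * ∑ π ∈ BandToeplitz.pairQuadPartitions p q,
            (BandToeplitz.fIIminus p b π t₁ t₂ + BandToeplitz.fIIplus p b π t₁ t₂))) := by
  have h : BandToeplitz.IsEntrySequence μ a κ :=
    { meas := ha_meas
      zero := ha_zero
      symm := ha_symm
      indep := ha_indep
      mean := ha_mean
      sq := fun i hi => by
        rw [← variance_of_integral_eq_zero (ha_meas i).aemeasurable (ha_mean i hi), ha_var i hi]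
      fourth := fun i hi => by
        rw [← ha_fourth i hi]
        refine integral_congr_ae (Eventually.of_forall fun w => ?_)
        simp only [Even.pow_abs (by decide : Even 4)]
      moments := ha_moments }
  refine ⟨fun n => (BandToeplitz.hasAllMoments_tracePow h bn p n t₁).integrable,
    fun n => (BandToeplitz.hasAllMoments_tracePow h bn q n t₂).integrable,
    fun n => ((BandToeplitz.hasAllMoments_fluctuation h bn p n t₁).mul
      (BandToeplitz.hasAllMoments_fluctuation h bn q n t₂)).integrable, ?_⟩
  have hlim : Tendsto (fun n => ∑ π : BandToeplitz.Part (p + q), ∑ s ∈ BandToeplitz.normSigns π,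
      BandToeplitz.blockSum μ a bn t₁ t₂ p π s n) atTop
      (𝓝 (∑ π : BandToeplitz.Part (p + q), ∑ s ∈ BandToeplitz.normSigns π,
        BandToeplitz.limitValue p κ b t₁ t₂ π s)) :=
    tendsto_finsetSum _ fun π _ => tendsto_finsetSum _ fun s hs =>
      BandToeplitz.tendsto_blockSum h hbn_top hbn_lim
        (BandToeplitz.pos_of_mem_timeInterval ht₁) ht hs
  simp only [BandToeplitz.sum_limitValue, Finset.sum_add_distrib, ← Finset.mul_sum,
    Finset.sum_ite_mem, Finset.univ_inter] at hlim
  simp only [← Finset.sum_add_distrib] at hlim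
  refine hlim.congr' ?_
  filter_upwards [hbn_top.eventually_gt_atTop 0] with n hn
  exact (BandToeplitz.integral_fluctuation_mul_eq_sum_blockSum h ht hn).symm
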